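/- Let $M$ be a smooth 3-manifold with (possibly empty) boundary. Let $(B,\nu,\mu)$ be a tangential flux system on $M$: $B$ is a smooth vector field, $\nu$ a smooth closed 1-form and $\mu$ a volume form on $M$ such that $\nu(B)=0$ and $\mathcal{L}_B\mu=0$, the field $B$ is tangent to $\partial M$, and the kernel of $\nu$ contains all vectors tangent to $\partial M$. Let $S$ be a regular torus of $(B,\nu,\mu)$, that is, a compact leaf of the foliation defined by $\ker\nu$ on $\{\nu\neq 0\}$ such that $B$ has no zero on $S$. Then the following are equivalent. 1. There exist an open neighbourhood $\mathcal{U}$ of $S$ and a smooth vector field $u$ on $\mathcal{U}$ satisfying $\iota_u\iota_B\mu=\nu$ and $[u,B]=0$ on $\mathcal{U}$. 2. There exist an open neighbourhood $\mathcal{U}$ of $S$, a smooth vector field $u$ on $\mathcal{U}$ satisfying $\iota_u\iota_B\mu=\nu$, and a diffeomorphism $\Phi=(\theta_1,\theta_2,z):\mathcal{U}\to\mathbb{T}^2\times I$, where $I\subset\mathbb{R}$ is some (nondegenerate) interval, such that on $\mathcal{U}$ $$\nu=d\psi(z),\qquad B=a(z)\,\partial_{\theta_1}+b(z)\,\partial_{\theta_2},\qquad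 u=c(z)\,\partial_{\theta_1}+d(z)\,\partial_{\theta_2},$$ where $\psi,a,b,c,d:I\to\mathbb{R}$ are smooth. -/

import Mathlib

open Set Manifold
open scoped ContDiff Manifold Topology

noncomputable section

namespace FluxSystem

universe u

/-- The model vector space of a `3`-manifold. -/
abbrev E3 : Type := EuclideanSpace ℝ (Fin 3)

section Forms

variable {M : Type u} [TopologicalSpace M] [ChartedSpace (EuclideanHalfSpace 3) M]

/-- A (not necessarily smooth) vector field on a `3`-manifold `M` with boundary. -/
abbrev VField (M : Type u) [TopologicalSpace M] [ChartedSpace (EuclideanHalfSpace 3) M] :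
    Type u :=
  ∀ x : M, TangentSpace (𝓡∂ 3) x

/-- A (not necessarily smooth) differential `k`-form on a `3`-manifold `M` with boundary. -/
abbrev DForm (k : ℕ) (M : Type u) [TopologicalSpace M] [ChartedSpace (EuclideanHalfSpace 3) M] :
    Type u :=
  ∀ x : M, TangentSpace (𝓡∂ 3) x [⋀^Fin k]→L[ℝ] ℝ

/-- Smoothness of a vector field on a set (in the applications, an open set). -/
def SmoothVFieldOn [IsManifold (𝓡∂ 3) ∞ M] (X : VField M) (U : Set M) : Prop :=
  ContMDiffOn (𝓡∂ 3) (𝓡∂ 3).tangent ∞ (fun x => (⟨x, X x⟩ : TangentBundle (𝓡∂ 3) M)) U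

/-- The representative of the form `α` in the chart around `x₀`: the pullback of `α` by the inverse
of the chart. Meaningful on the image of the chart. -/
def formInChart {k : ℕ} (α : DForm k M) (x₀ : M) (y : E3) : E3 [⋀^Fin k]→L[ℝ] ℝ :=
  (α ((extChartAt (𝓡∂ 3) x₀).symm y)).compContinuousLinearMap
    (mfderivWithin 𝓘(ℝ, E3) (𝓡∂ 3) (extChartAt (𝓡∂ 3) x₀).symm (range (𝓡∂ 3)) y)

/-- A form is smooth if its representatives in the charts are smooth. -/
def SmoothForm {k : ℕ} (α : DForm k M) : Prop :=
  ∀ x₀ : M, ContDiffOn ℝ ∞ (formInChart α x₀) (extChartAt (𝓡∂ 3) x₀).target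

/-- The exterior derivative, computed at `x` in the chart around `x`. -/
def extD {k : ℕ} (α : DForm k M) : DForm (k + 1) M := fun x =>
  (extDerivWithin (formInChart α x) (range (𝓡∂ 3))
    (extChartAt (𝓡∂ 3) x x)).compContinuousLinearMap
      (mfderiv (𝓡∂ 3) 𝓘(ℝ, E3) (extChartAt (𝓡∂ 3) x) x)

/-- The interior product `ι_X α`, where `(ι_X α)(v₁, …, v_k) = α(X, v₁, …, v_k)`. -/
def interiorProd {k : ℕ} (X : VField M) (α : DForm (k + 1) M) : DForm k M := fun x =>
  ContinuousAlternatingMap.curryLeft (E := E3) (α x) (X x)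

/-- The Lie derivative of a form of positive degree, by Cartan's formula
`L_X α = d (ι_X α) + ι_X (d α)`. -/
def lieD {k : ℕ} (X : VField M) (α : DForm (k + 1) M) : DForm (k + 1) M := fun x =>
  extD (interiorProd X α) x + interiorProd X (extD α) x

/-- The differential `df` of a function, as a `1`-form. -/
def differential (f : M → ℝ) : DForm 1 M := fun x =>
  ContinuousAlternatingMap.ofSubsingleton ℝ (TangentSpace (𝓡∂ 3) x) ℝ (0 : Fin 1)
    (mfderiv (𝓡∂ 3) 𝓘(ℝ, ℝ) f x)

/-- At a boundary point `x`, the vectors tangent to the boundary: the kernel of the differential of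
the `0`-th coordinate in the chart around `x`, which is nonnegative and vanishes on the boundary. -/
def TangentToBoundary (x : M) (v : TangentSpace (𝓡∂ 3) x) : Prop :=
  mfderiv (𝓡∂ 3) 𝓘(ℝ, ℝ) (fun y => extChartAt (𝓡∂ 3) x y 0) x v = 0

/-- `(B, ν, μ)` is a flux system: `B` is a smooth vector field, `ν` is a smooth closed `1`-form,
`μ` is a volume form (a smooth nowhere vanishing `3`-form), `ν(B) = 0` and `L_B μ = 0`. -/
structure IsFluxSystem [IsManifold (𝓡∂ 3) ∞ M] (B : VField M) (ν : DForm 1 M)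
    (μ : DForm 3 M) : Prop where
  smooth_B : SmoothVFieldOn B univ
  smooth_ν : SmoothForm ν
  smooth_μ : SmoothForm μ
  volume : ∀ x, μ x ≠ 0
  closed : ∀ x, extD ν x = 0
  ν_B : ∀ x, ν x ![B x] = 0
  lie_μ : ∀ x, lieD B μ x = 0

/-- A flux system is tangential if `B` is tangent to `∂M` and the kernel of `ν` contains all
vectors tangent to `∂M`. -/
structure IsTangentialFluxSystem [IsManifold (𝓡∂ 3) ∞ M] (B : VField M)
    (ν : DForm 1 M) (μ : DForm 3 M) : Prop
    extends IsFluxSystem B ν μ where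
  tangent_B : ∀ x ∈ (𝓡∂ 3).boundary M, TangentToBoundary x (B x)
  tangent_ν : ∀ x ∈ (𝓡∂ 3).boundary M, ∀ v : TangentSpace (𝓡∂ 3) x,
    TangentToBoundary x v → ν x ![v] = 0

/-- The injective immersion `f : N → M` of a surface without boundary presents its image as an
integral manifold of the distribution `ker ν` on the set where `ν ≠ 0`. -/
structure IsIntegralImmersion (ν : DForm 1 M) (N : Type u) [TopologicalSpace N]
    [ChartedSpace (EuclideanSpace ℝ (Fin 2)) N] (f : N → M) : Prop where
  smooth : ContMDiff (𝓡 2) (𝓡∂ 3) ∞ f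
  injective : Function.Injective f
  immersion : ∀ p, Function.Injective (mfderiv (𝓡 2) (𝓡∂ 3) f p)
  nonzero : ∀ p, ν (f p) ≠ 0
  tangent : ∀ p (v : TangentSpace (𝓡∂ 3) (f p)),
    v ∈ range (mfderiv (𝓡 2) (𝓡∂ 3) f p) ↔ ν (f p) ![v] = 0

/-- `S` is a regular closed leaf of `ν`: a compact connected integral manifold of the distribution
`ker ν` on `{ν ≠ 0}`. (A compact integral manifold is automatically a maximal one, that is, a leaf
of the foliation defined by `ν`.) -/
def IsRegularClosedLeaf (ν : DForm 1 M) (S : Set M) : Prop :=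
  ∃ (N : Type u) (_ : TopologicalSpace N) (_ : ChartedSpace (EuclideanSpace ℝ (Fin 2)) N)
    (_ : IsManifold (𝓡 2) ∞ N) (_ : CompactSpace N) (_ : ConnectedSpace N) (f : N → M),
    IsIntegralImmersion ν N f ∧ range f = S

/-- `S` is a regular torus: a regular closed leaf of `ν` on which `B` does not vanish. -/
def IsRegularTorus (B : VField M) (ν : DForm 1 M) (S : Set M) : Prop :=
  IsRegularClosedLeaf ν S ∧ ∀ x ∈ S, B x ≠ 0

/-- `Φ = (θ₁, θ₂, z)` restricts to a diffeomorphism from `U` onto `𝕋² × J`, where `J` is a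
(nondegenerate) interval. -/
structure IsTorusChart (Φ : PartialEquiv M (Circle × Circle × ℝ)) (U : Set M) (J : Set ℝ) :
    Prop where
  interval : J.OrdConnected
  nondegenerate : J.Nontrivial
  source_eq : Φ.source = U
  target_eq : Φ.target = univ ×ˢ univ ×ˢ J
  smooth : ContMDiffOn (𝓡∂ 3) ((𝓡 1).prod ((𝓡 1).prod 𝓘(ℝ, ℝ))) ∞ Φ U
  smooth_symm : ContMDiffOn ((𝓡 1).prod ((𝓡 1).prod 𝓘(ℝ, ℝ))) (𝓡∂ 3) ∞ Φ.symm
    (univ ×ˢ univ ×ˢ J)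

/-- The coordinate function `z`. -/
def zCoord (Φ : PartialEquiv M (Circle × Circle × ℝ)) (x : M) : ℝ := (Φ x).2.2

/-- The coordinate vector field `∂_{θ₁}`: the velocity of the first coordinate line through `x`. -/
def dTheta1 (Φ : PartialEquiv M (Circle × Circle × ℝ)) : VField M := fun x =>
  mfderiv 𝓘(ℝ, ℝ) (𝓡∂ 3)
    (fun t : ℝ => Φ.symm (Circle.exp t * (Φ x).1, (Φ x).2.1, (Φ x).2.2)) 0 (1 : ℝ)

/-- The coordinate vector field `∂_{θ₂}`: the velocity of the second coordinate line through `x`. -/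
def dTheta2 (Φ : PartialEquiv M (Circle × Circle × ℝ)) : VField M := fun x =>
  mfderiv 𝓘(ℝ, ℝ) (𝓡∂ 3)
    (fun t : ℝ => Φ.symm ((Φ x).1, Circle.exp t * (Φ x).2.1, (Φ x).2.2)) 0 (1 : ℝ)

/-- `U` is an open neighbourhood of `S`, and `u` is a smooth vector field on `U` satisfying
`ι_u ι_B μ = ν` on `U`. (The values of `u` outside `U` play no role.) -/
structure IsFluxFieldOn [IsManifold (𝓡∂ 3) ∞ M] (B : VField M) (ν : DForm 1 M)
    (μ : DForm 3 M) (S U : Set M) (u : VField M) : Prop where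
  isOpen : IsOpen U
  subset : S ⊆ U
  smooth : SmoothVFieldOn u U
  flux : ∀ x ∈ U, interiorProd u (interiorProd B μ) x = ν x

/-- On `U`, with coordinates `Φ = (θ₁, θ₂, z) : U → 𝕋² × J`, one has `ν = dψ(z)`,
`B = a(z) ∂_{θ₁} + b(z) ∂_{θ₂}` and `u = c(z) ∂_{θ₁} + d(z) ∂_{θ₂}` for some smooth functions
`ψ, a, b, c, d` on `J`. -/
def Rectifies (Φ : PartialEquiv M (Circle × Circle × ℝ)) (B : VField M) (ν : DForm 1 M)
    (u : VField M) (U : Set M) (J : Set ℝ) : Prop :=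
  ∃ ψ a b c d : ℝ → ℝ,
    ContDiffOn ℝ ∞ ψ J ∧ ContDiffOn ℝ ∞ a J ∧ ContDiffOn ℝ ∞ b J ∧
    ContDiffOn ℝ ∞ c J ∧ ContDiffOn ℝ ∞ d J ∧
    (∀ x ∈ U, ν x = differential (fun y => ψ (zCoord Φ y)) x) ∧
    (∀ x ∈ U, B x = a (zCoord Φ x) • dTheta1 Φ x + b (zCoord Φ x) • dTheta2 Φ x) ∧
    (∀ x ∈ U, u x = c (zCoord Φ x) • dTheta1 Φ x + d (zCoord Φ x) • dTheta2 Φ x)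

end Forms

end FluxSystem

end

/-! Suppose that $u$ and $B$ commute. Since $\nu=\iota_u\iota_B\mu$, both fields lie in $\ker\nu$
and they are independent wherever $\nu\neq 0$, in particular near $S$. So they generate a local
action of $\mathbb{R}^2$ along the leaves, and the theorem is an Arnold–Liouville argument for this
action.

Near each point of $S$ there is a chart (`FlowBox`, `exists_flowBox`) in which $B$ and $u$ are the
first two coordinate fields and $\nu=\pm dz$. At a boundary point $\nu$ kills the vectors tangent to
$\partial M$, so the boundary is a level set of $z$ and the box is cut off by a condition $0\le kz$.
No differential equation is solved to get these charts: the Poincaré lemma straightens $\nu$, and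
the coframe dual to a commuting frame is closed along the leaves, so a radial integral straightens
the frame (`exists_local_normal_form`). An inverse function theorem for half-spaces
(`exists_inverse_halfSpace`) treats interior and boundary points alike.

The transverse coordinates, with their signs, glue to a primitive $\psi$ of $\nu$ near $S$ which
vanishes exactly on $S$. By compactness the translations in the boxes have a uniform size, and a
neighbourhood saturated by the levels of $\psi$ is preserved by them. Hence the local action extends
to an action of $\mathbb{R}^2$ (`exists_extension_of_local_hom`, `exists_leafAction`). The connected
leaf $S$ is a single orbit; its isotropy group is discrete, and cocompact because $S$ is compact, so
it is a lattice. That $S$ is a torus is thus a conclusion.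

A basis of this lattice deforms smoothly to periods $l_1(z),l_2(z)$ of the nearby leaves, and
compactness of a fundamental square shows that these generate all periods (`exists_periods`). The
map $(x,z)\mapsto\varphi_{x_1l_1(z)+x_2l_2(z)}(c(0,z))$ then descends to a diffeomorphism from
$\mathbb{T}^2\times J$ onto an open neighbourhood of $S$. Moving along $\theta_i$ is acting by a
multiple of $l_i(z)$, so $\partial_{\theta_i}$ is a combination of $B$ and $u$ with coefficients
depending on $z$ alone; inverting a $2\times 2$ matrix gives the normal form.

Conversely, in such coordinates both fields are tangent to the tori $z=\mathrm{const}$, and on each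
torus they are images of constant fields under one map from the plane. Symmetry of its second
derivative makes the bracket vanish (`mlieBracket_eq_zero_of_rectifies`). -/

namespace FluxSystem
open Filter Metric VectorField

/-! ### Half-spaces and their inverse function theorem -/

section HalfSpace

variable {E E' : Type*} [NormedAddCommGroup E] [NormedSpace ℝ E]
  [NormedAddCommGroup E'] [NormedSpace ℝ E']

/-- The closed half-space of a linear form; the whole space if the form vanishes. -/
def halfSpace (l : E →L[ℝ] ℝ) : Set E := {x | 0 ≤ l x}

theorem mem_halfSpace {l : E →L[ℝ] ℝ} {x : E} : x ∈ halfSpace l ↔ 0 ≤ l x := Iff.rfl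

theorem convex_halfSpace (l : E →L[ℝ] ℝ) : Convex ℝ (halfSpace l) :=
  convex_halfSpace_ge l.isLinear 0

theorem zero_mem_halfSpace (l : E →L[ℝ] ℝ) : (0 : E) ∈ halfSpace l := by
  simp [mem_halfSpace]

theorem interior_halfSpace_nonempty (l : E →L[ℝ] ℝ) : (interior (halfSpace l)).Nonempty := by
  by_cases h : l = 0
  · subst h
    have : halfSpace (0 : E →L[ℝ] ℝ) = univ := by ext; simp [mem_halfSpace]
    rw [this, interior_univ]
    exact ⟨0, trivial⟩
  · obtain ⟨v, hv⟩ : ∃ v, l v ≠ 0 := by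
      by_contra! h'
      exact h (ContinuousLinearMap.ext h')
    refine ⟨(l v) • v, ?_⟩
    have ho : IsOpen {x | 0 < l x} := isOpen_lt continuous_const l.continuous
    refine interior_maximal (s := halfSpace l) (t := {x | 0 < l x}) (fun x hx => le_of_lt (show 0 < l x from hx)) ho ?_
    simp only [mem_ofPred_eq, map_smul, smul_eq_mul]
    exact mul_self_pos.2 hv

theorem uniqueDiffOn_halfSpace (l : E →L[ℝ] ℝ) : UniqueDiffOn ℝ (halfSpace l) :=
  uniqueDiffOn_convex (convex_halfSpace l) (interior_halfSpace_nonempty l)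

/-- On convex sets, `C¹` maps are strictly differentiable. -/
theorem exists_strict_estimate {s : Set E} (hs : Convex ℝ s) (hu : UniqueDiffOn ℝ s) {N : Set E}
    (hN : IsOpen N) {y : E} (hy : y ∈ s ∩ N) {F : E → E'} (hF : ContDiffOn ℝ 1 F (s ∩ N))
    {L : E →L[ℝ] E'} (hL : HasFDerivWithinAt F L s y) {ε : ℝ} (hε : 0 < ε) :
    ∃ δ > 0, ∀ a ∈ s ∩ ball y δ, ∀ b ∈ s ∩ ball y δ, ‖F b - F a - L (b - a)‖ ≤ ε * ‖b - a‖ := by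
  have hu' : UniqueDiffOn ℝ (s ∩ N) := hu.inter hN
  have hc : ContinuousOn (fderivWithin ℝ F (s ∩ N)) (s ∩ N) :=
    hF.continuousOn_fderivWithin hu' le_rfl
  have hLy : fderivWithin ℝ F (s ∩ N) y = L :=
    (hL.mono inter_subset_left).fderivWithin (hu' y hy)
  have h1 := (Metric.continuousOn_iff.1 hc) y hy ε hε
  obtain ⟨δ₁, h₁, hδ₁⟩ := h1
  obtain ⟨δ₂, h₂, hδ₂⟩ := Metric.isOpen_iff.1 hN y hy.2
  refine ⟨min δ₁ δ₂, lt_min h₁ h₂, fun a ha b hb => ?_⟩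
  have hsub : s ∩ ball y (min δ₁ δ₂) ⊆ s ∩ N :=
    inter_subset_inter_right _ ((ball_subset_ball (min_le_right _ _)).trans hδ₂)
  refine (hs.inter (convex_ball y (min δ₁ δ₂))).norm_image_sub_le_of_norm_hasFDerivWithin_le'
    (f' := fderivWithin ℝ F (s ∩ N)) (fun x hx => ?_) (fun x hx => ?_) ha hb
  · exact ((hF.differentiableOn one_ne_zero) x (hsub hx)).hasFDerivWithinAt.mono hsub
  · have := hδ₁ x (hsub hx) (lt_of_lt_of_le hx.2 (min_le_left _ _))
    rw [dist_eq_norm, hLy] at this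
    exact this.le

/-- A local inverse of a smooth map is smooth. -/
theorem contDiffOn_of_inverse [CompleteSpace E] {s : Set E} {t : Set E'} (hs : UniqueDiffOn ℝ s)
    (ht : UniqueDiffOn ℝ t)
    {F : E → E'} {K : E' → E} (hF : ContDiffOn ℝ ∞ F s) (hK : ContinuousOn K t)
    (hKt : MapsTo K t s) (hFK : ∀ b ∈ t, F (K b) = b)
    (hinv : ∀ a ∈ s, ∃ L : E ≃L[ℝ] E', (L : E →L[ℝ] E') = fderivWithin ℝ F s a) :
    ContDiffOn ℝ ∞ K t := by
  have hd : ∀ b ∈ t, HasFDerivWithinAt K (ContinuousLinearMap.inverse (fderivWithin ℝ F s (K b)))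
      t b := by
    intro b hb
    obtain ⟨L, hL⟩ := hinv _ (hKt hb)
    have h1 : HasFDerivWithinAt F (L : E →L[ℝ] E') s (K b) := by
      rw [hL]
      exact ((hF.differentiableOn (by simp)) _ (hKt hb)).hasFDerivWithinAt
    rw [← hL, ContinuousLinearMap.inverse_equiv]
    refine HasFDerivWithinAt.of_local_left_inverse ?_ h1 hb ?_
    · exact tendsto_nhdsWithin_iff.2 ⟨hK b hb, eventually_mem_nhdsWithin.mono fun x hx => hKt hx⟩
    · exact eventually_mem_nhdsWithin.mono hFK
  have hF' : ContDiffOn ℝ ∞ (fderivWithin ℝ F s) s := hF.fderivWithin hs (by simp)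
  -- Bootstrap: the derivative of `K` is the inverse of $F'\circ K$, so it is as regular as `K`
  -- itself, and each round gains one derivative.
  rw [contDiffOn_infty]
  intro n
  induction n with
  | zero => exact contDiffOn_zero.2 hK
  | succ n ih =>
    have : ((n + 1 : ℕ) : ℕ∞ω) = (n : ℕ∞ω) + 1 := by push_cast; rfl
    rw [this, contDiffOn_succ_iff_hasFDerivWithinAt_of_uniqueDiffOn ht]
    refine ⟨by simp, _, ?_, hd⟩
    intro b hb
    obtain ⟨L, hL⟩ := hinv _ (hKt hb)
    have h2 : ContDiffAt ℝ n ContinuousLinearMap.inverse (fderivWithin ℝ F s (K b)) := by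
      rw [← hL]
      exact contDiffAt_map_inverse L
    exact h2.comp_contDiffWithinAt b
      (((hF'.of_le (by exact_mod_cast le_top)).comp ih hKt) b hb)

/-- Inverse function theorem for maps between half-spaces. -/
theorem exists_inverse_halfSpace [CompleteSpace E] [CompleteSpace E']
    (l : E →L[ℝ] ℝ) (l' : E' →L[ℝ] ℝ) {e : E} (he : l = 0 ∨ l e = 1) {y : E} (hy : l y = 0)
    {N : Set E} (hN : IsOpen N) (hyN : y ∈ N) {F : E → E'}
    (hF : ContDiffOn ℝ ∞ F (halfSpace l ∩ N)) (L : E ≃L[ℝ] E')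
    (hL : HasFDerivWithinAt F (L : E →L[ℝ] E') (halfSpace l) y)
    (h0 : ∀ x ∈ N, l x = 0 → l' (F x) = 0) (hp : ∀ x ∈ N, 0 < l x → 0 < l' (F x)) :
    ∃ G : OpenPartialHomeomorph E E', y ∈ G.source ∧ G.source ⊆ N ∧
      EqOn G F (halfSpace l ∩ G.source) ∧ (∀ x ∈ G.source, x ∈ halfSpace l ↔ G x ∈ halfSpace l') ∧
      ContDiffOn ℝ ∞ G.symm (halfSpace l' ∩ G.target) := by
  have hyH : y ∈ halfSpace l := by simp [mem_halfSpace, hy]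
  -- the reflection trick
  set p : E → E := fun x => x + (max (- l x) 0) • e with hpdef
  set q : E → E := fun x => x - (l x) • e with hqdef
  set m : E → E := fun x => q x + (max (- l x) 0) • e with hmdef
  -- If `l` is nonzero, then beyond the wall `p` and `q` are both the projection along `e` and `m`
  -- is the mirror image, so `G` is $2F\circ q-F\circ m$, an odd extension of `F`. Since $p+q-m$ is
  -- the identity, the linear parts add up to `L`. If `l` vanishes, `G` is just `F`.
  set G : E → E' := fun x => F (p x) + F (q x) - F (m x) with hG
  have hsum : ∀ x, p x + q x - m x = x := fun x => by simp only [hpdef, hmdef]; abel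
  have hlp : ∀ x, 0 ≤ l (p x) := by
    intro x
    rcases he with rfl | he
    · simp
    · simp only [hpdef, map_add, map_smul, he, smul_eq_mul, mul_one]
      linarith [le_max_left (-l x) 0]
  have hlq : ∀ x, l (q x) = 0 := by
    intro x
    rcases he with rfl | he
    · simp
    · simp [hqdef, he]
  have hlm : ∀ x, l (m x) = max (- l x) 0 := by
    intro x
    rcases he with rfl | he
    · simp
    · simp [hmdef, hlq, he]
  have hpx : ∀ x ∈ halfSpace l, p x = x := by
    intro x hx
    have : max (- l x) 0 = 0 := max_eq_right (by rw [mem_halfSpace] at hx; linarith)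
    simp [hpdef, this]
  have hmx : ∀ x ∈ halfSpace l, m x = q x := by
    intro x hx
    have : max (- l x) 0 = 0 := max_eq_right (by rw [mem_halfSpace] at hx; linarith)
    simp [hmdef, this]
  have hGF : ∀ x ∈ halfSpace l, G x = F x := by
    intro x hx
    simp [hG, hpx x hx, hmx x hx]
  have hqy : q y = y := by simp [hqdef, hy]
  have hpy : p y = y := hpx y hyH
  have hmy : m y = y := by rw [hmx y hyH, hqy]
  have hpc : Continuous p := by fun_prop
  have hqc : Continuous q := by fun_prop
  have hmc : Continuous m := by fun_prop
  -- Lipschitz bounds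
  set C : ℝ := 1 + 2 * (‖l‖ * ‖e‖) with hC
  have hC1 : 0 < C := by positivity
  have habs : ∀ a b : ℝ, |max (-b) 0 - max (-a) 0| ≤ |b - a| := by
    intro a b
    calc |max (-b) 0 - max (-a) 0| ≤ |(-b) - (-a)| := abs_max_sub_max_le_abs _ _ _
      _ = |b - a| := by rw [← abs_neg]; congr 1; ring
  have hlip1 : ∀ a b : E, ‖(max (-l b) 0 - max (-l a) 0) • e‖ ≤ ‖l‖ * ‖e‖ * ‖b - a‖ := by
    intro a b
    rw [norm_smul, Real.norm_eq_abs]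
    have h1 : |l b - l a| ≤ ‖l‖ * ‖b - a‖ := by
      rw [← map_sub]; exact l.le_opNorm _
    have := (habs (l a) (l b)).trans h1
    nlinarith [norm_nonneg e]
  have hlip2 : ∀ a b : E, ‖(l b - l a) • e‖ ≤ ‖l‖ * ‖e‖ * ‖b - a‖ := by
    intro a b
    rw [norm_smul, Real.norm_eq_abs]
    have h1 : |l b - l a| ≤ ‖l‖ * ‖b - a‖ := by
      rw [← map_sub]; exact l.le_opNorm _
    nlinarith [norm_nonneg e]
  have hpos : 0 ≤ ‖l‖ * ‖e‖ := by positivity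
  have hpl : ∀ a b, ‖p b - p a‖ ≤ C * ‖b - a‖ := by
    intro a b
    have : p b - p a = (b - a) + (max (-l b) 0 - max (-l a) 0) • e := by
      simp only [hpdef, sub_smul]; abel
    rw [this]
    refine (norm_add_le _ _).trans ?_
    nlinarith [hlip1 a b, norm_nonneg (b - a)]
  have hql : ∀ a b, ‖q b - q a‖ ≤ C * ‖b - a‖ := by
    intro a b
    have : q b - q a = (b - a) - (l b - l a) • e := by
      simp only [hqdef, sub_smul]; abel
    rw [this]
    refine (norm_sub_le _ _).trans ?_
    nlinarith [hlip2 a b, norm_nonneg (b - a)]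
  have hml : ∀ a b, ‖m b - m a‖ ≤ C * ‖b - a‖ := by
    intro a b
    have : m b - m a = (b - a) - (l b - l a) • e + (max (-l b) 0 - max (-l a) 0) • e := by
      simp only [hmdef, hqdef, sub_smul]; abel
    rw [this]
    refine (norm_add_le _ _).trans ((add_le_add_left (norm_sub_le _ _) _).trans ?_)
    nlinarith [hlip2 a b, hlip1 a b, norm_nonneg (b - a)]
  -- strict differentiability
  have hstrict : HasStrictFDerivAt G (L : E →L[ℝ] E') y := by
    rw [hasStrictFDerivAt_iff_isLittleO, Asymptotics.isLittleO_iff]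
    intro ε hε
    obtain ⟨δ, hδ, H⟩ := exists_strict_estimate (convex_halfSpace l) (uniqueDiffOn_halfSpace l) hN
      ⟨hyH, hyN⟩ (hF.of_le (by simp)) hL (ε := ε / (3 * C)) (by positivity)
    have hev : ∀ᶠ x in 𝓝 y, p x ∈ ball y δ ∧ q x ∈ ball y δ ∧ m x ∈ ball y δ := by
      refine (hpc.continuousAt.eventually_mem ?_).and
        ((hqc.continuousAt.eventually_mem ?_).and (hmc.continuousAt.eventually_mem ?_))
      · rw [hpy]; exact ball_mem_nhds _ hδ
      · rw [hqy]; exact ball_mem_nhds _ hδ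
      · rw [hmy]; exact ball_mem_nhds _ hδ
    have hev2 := hev.prod_mk hev
    rw [← nhds_prod_eq] at hev2
    filter_upwards [hev2] with ⟨b, a⟩ hab
    obtain ⟨⟨hb1, hb2, hb3⟩, ha1, ha2, ha3⟩ := hab
    have k1 := H (p a) ⟨hlp a, ha1⟩ (p b) ⟨hlp b, hb1⟩
    have k2 := H (q a) ⟨(hlq a).ge, ha2⟩ (q b) ⟨(hlq b).ge, hb2⟩
    have k3 := H (m a) ⟨by rw [mem_halfSpace, hlm]; exact le_max_right _ _, ha3⟩
      (m b) ⟨by rw [mem_halfSpace, hlm]; exact le_max_right _ _, hb3⟩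
    have heq : G b - G a - L (b - a) = (F (p b) - F (p a) - L (p b - p a)) +
        (F (q b) - F (q a) - L (q b - q a)) - (F (m b) - F (m a) - L (m b - m a)) := by
      have : L (b - a) = L (p b - p a) + L (q b - q a) - L (m b - m a) := by
        rw [← map_add, ← map_sub]
        congr 1
        nth_rewrite 1 [← hsum b, ← hsum a]
        abel
      rw [this]
      simp only [hG]
      abel
    have hC3 : ∀ t : ℝ, t ≤ C * ‖b - a‖ → ε / (3 * C) * t ≤ ε / 3 * ‖b - a‖ := by
      intro t ht
      calc ε / (3 * C) * t ≤ ε / (3 * C) * (C * ‖b - a‖) := by gcongr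
        _ = ε / 3 * ‖b - a‖ := by field_simp
    have e1 := k1.trans (hC3 _ (hpl a b))
    have e2 := k2.trans (hC3 _ (hql a b))
    have e3 := k3.trans (hC3 _ (hml a b))
    simp only [ContinuousLinearEquiv.coe_coe] at e1 e2 e3 ⊢
    rw [heq]
    refine (norm_sub_le _ _).trans ((add_le_add_left (norm_add_le _ _) _).trans ?_)
    linarith
  -- shrinking
  have hu' : UniqueDiffOn ℝ (halfSpace l ∩ N) := (uniqueDiffOn_halfSpace l).inter hN
  have hcF : ContinuousOn (fderivWithin ℝ F (halfSpace l ∩ N)) (halfSpace l ∩ N) :=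
    hF.continuousOn_fderivWithin hu' (by simp)
  have hLy : fderivWithin ℝ F (halfSpace l ∩ N) y = L :=
    (hL.mono inter_subset_left).fderivWithin (hu' y ⟨hyH, hyN⟩)
  have hinv : ∀ᶠ x in 𝓝 y, x ∈ halfSpace l ∩ N → ∃ L' : E ≃L[ℝ] E',
      (L' : E →L[ℝ] E') = fderivWithin ℝ F (halfSpace l ∩ N) x := by
    have := (hcF y ⟨hyH, hyN⟩)
    rw [ContinuousWithinAt, hLy] at this
    have h2 := this.eventually (ContinuousLinearEquiv.nhds L)
    rw [eventually_nhdsWithin_iff] at h2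
    exact h2
  have hev : ∀ᶠ x in 𝓝 y, x ∈ N ∧ q x ∈ N ∧ m x ∈ N := by
    refine (hN.eventually_mem hyN).and
      ((hqc.continuousAt.eventually_mem ?_).and (hmc.continuousAt.eventually_mem ?_))
    · rw [hqy]; exact hN.mem_nhds hyN
    · rw [hmy]; exact hN.mem_nhds hyN
  obtain ⟨O, hO, hOo, hyO⟩ := _root_.eventually_nhds_iff.1 (hinv.and hev)
  set G₀ := (hstrict.toOpenPartialHomeomorph G).restrOpen O hOo with hG₀
  have hsrc : G₀.source ⊆ O := fun x hx => hx.2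
  have hGG : ∀ x, G₀ x = G x := fun x => rfl
  have hiff : ∀ x ∈ G₀.source, x ∈ halfSpace l ↔ G₀ x ∈ halfSpace l' := by
    intro x hx
    obtain ⟨-, hxN, hqN, hmN⟩ := hO x (hsrc hx)
    rw [hGG]
    constructor
    · intro hxl
      rw [hGF x hxl, mem_halfSpace]
      rcases (mem_halfSpace.1 hxl).eq_or_lt with h | h
      · exact (h0 x hxN h.symm).ge
      · exact (hp x hxN h).le
    · intro hxl
      by_contra hneg
      rw [mem_halfSpace, not_le] at hneg
      -- Beyond the wall the two projected terms lie on the target wall, so $l'(Gx)=-l'(F(mx))$,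
      -- which is negative because `m x` is strictly inside.
      have h1 : p x = q x := by
        have : max (- l x) 0 = - l x := max_eq_left (by linarith)
        simp [hpdef, hqdef, this, sub_eq_add_neg]
      have h2 := h0 _ hqN (hlq x)
      have h3 := hp _ hmN (by rw [hlm]; exact lt_max_of_lt_left (by linarith))
      rw [mem_halfSpace] at hxl
      simp only [hG, h1, map_add, map_sub, h2] at hxl
      linarith
  have hEq : EqOn G₀ F (halfSpace l ∩ G₀.source) := fun x hx => hGF x hx.1
  refine ⟨G₀, ⟨hstrict.mem_toOpenPartialHomeomorph_source, hyO⟩,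
    fun x hx => (hO x (hsrc hx)).2.1, hEq, hiff, ?_⟩
  have hsub : halfSpace l ∩ G₀.source ⊆ halfSpace l ∩ N :=
    fun x hx => ⟨hx.1, (hO x (hsrc hx.2)).2.1⟩
  have hus : UniqueDiffOn ℝ (halfSpace l ∩ G₀.source) :=
    (uniqueDiffOn_halfSpace l).inter G₀.open_source
  have hmaps : MapsTo G₀.symm (halfSpace l' ∩ G₀.target) (halfSpace l ∩ G₀.source) := by
    intro b hb
    have h1 := G₀.map_target hb.2
    exact ⟨(hiff _ h1).2 (by rw [G₀.right_inv hb.2]; exact hb.1), h1⟩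
  refine contDiffOn_of_inverse hus ((uniqueDiffOn_halfSpace l').inter G₀.open_target)
    (hF.mono hsub) (G₀.continuousOn_symm.mono inter_subset_right) hmaps ?_ ?_
  · intro b hb
    rw [← hEq (hmaps hb), G₀.right_inv hb.2]
  · intro a ha
    obtain ⟨L', hL'⟩ := (hO a (hsrc ha.2)).1 (hsub ha)
    refine ⟨L', ?_⟩
    have := ((hF.differentiableOn (by simp)) a (hsub ha)).hasFDerivWithinAt.mono hsub
    rw [hL', this.fderivWithin (hus a ha)]

end HalfSpace
-- Integrals over the unit interval depending smoothly on a parameter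
section ParametricIntegral

universe v

open intervalIntegral MeasureTheory

/-- Tube lemma: compactness of $[0,1]$ turns continuity at each $(t,x)$ into a bound that is uniform
in $t$. -/
theorem eventually_uniform_close {E F : Type*} [TopologicalSpace E]
    [SeminormedAddCommGroup F] {D : Set E} {h : ℝ × E → F}
    (hh : ContinuousOn h (Icc 0 1 ×ˢ D)) {x : E} (hx : x ∈ D) {ε : ℝ} (hε : 0 < ε) :
    ∀ᶠ y in 𝓝 x, ∀ t ∈ Icc (0 : ℝ) 1, y ∈ D → ‖h (t, y) - h (t, x)‖ ≤ ε := by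
  have key : ∀ᶠ y in 𝓝 x, ∀ t ∈ Icc (0 : ℝ) 1, t ∈ Icc (0 : ℝ) 1 → y ∈ D →
      ‖h (t, y) - h (t, x)‖ ≤ ε := by
    refine isCompact_Icc.eventually_forall_of_forall_eventually
      (P := fun y t => t ∈ Icc (0 : ℝ) 1 → y ∈ D → ‖h (t, y) - h (t, x)‖ ≤ ε) fun t ht => ?_
    have h1 := Metric.tendsto_nhds.1 (hh (t, x) ⟨ht, hx⟩) (ε / 2) (by positivity)
    rw [eventually_nhdsWithin_iff] at h1
    have c1 : Tendsto (fun z : E × ℝ => (z.2, z.1)) (𝓝 (x, t)) (𝓝 (t, x)) :=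
      (continuous_swap (X := E) (Y := ℝ)).tendsto (x, t)
    have c2 : Tendsto (fun z : E × ℝ => (z.2, x)) (𝓝 (x, t)) (𝓝 (t, x)) :=
      (Continuous.prodMk continuous_snd continuous_const : Continuous
        (fun z : E × ℝ => (z.2, x))).tendsto (x, t)
    filter_upwards [c1.eventually h1, c2.eventually h1] with z k1 k2 hz1 hz2
    have e1 := k1 ⟨hz1, hz2⟩
    have e2 := k2 ⟨hz1, hx⟩
    rw [dist_eq_norm] at e1 e2
    have : h (z.2, z.1) - h (z.2, x) = (h (z.2, z.1) - h (t, x)) - (h (z.2, x) - h (t, x)) := by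
      abel
    rw [this]
    refine (norm_sub_le _ _).trans ?_
    linarith
  exact key.mono fun y hy t ht => hy t ht ht

theorem continuousOn_integral_unitInterval {E F : Type*} [TopologicalSpace E]
    [FirstCountableTopology E]
    [NormedAddCommGroup F] [NormedSpace ℝ F] {D : Set E} {h : ℝ × E → F}
    (hh : ContinuousOn h (Icc 0 1 ×ˢ D)) :
    ContinuousOn (fun x => ∫ t in (0 : ℝ)..1, h (t, x)) D := by
  rw [continuousOn_iff_continuous_domRestrict]
  -- Projecting the time to $[0,1]$ extends the integrand continuously to all times without changing
  -- the integral.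
  have h1 : Continuous (fun z : D × ℝ => h ((projIcc (0 : ℝ) 1 zero_le_one z.2 : ℝ), z.1)) :=
    hh.comp_continuous (by fun_prop) fun z => ⟨(projIcc (0 : ℝ) 1 zero_le_one z.2).2, z.1.2⟩
  have h2 := intervalIntegral.continuous_parametric_intervalIntegral_of_continuous' (μ := volume)
    (f := fun (x : D) (t : ℝ) => h ((projIcc (0 : ℝ) 1 zero_le_one t : ℝ), x)) h1 0 1
  refine h2.congr fun x => ?_
  refine intervalIntegral.integral_congr fun t ht => ?_
  rw [uIcc_of_le zero_le_one] at ht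
  simp only [projIcc_of_mem zero_le_one ht]

/-- Differentiation under the integral sign on a convex set which need not be open: the mean value
inequality on each slice, with an error made uniform in $t$ by `eventually_uniform_close`. -/
theorem hasFDerivWithinAt_integral_unitInterval {E F : Type*} [NormedAddCommGroup E]
    [NormedSpace ℝ E] [NormedAddCommGroup F] [NormedSpace ℝ F] [CompleteSpace F] {D : Set E}
    (hD : Convex ℝ D) {h : ℝ × E → F} {h' : ℝ × E → E →L[ℝ] F}
    (hh : ContinuousOn h (Icc 0 1 ×ˢ D)) (hh' : ContinuousOn h' (Icc 0 1 ×ˢ D))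
    (hd : ∀ t ∈ Icc (0 : ℝ) 1, ∀ x ∈ D, HasFDerivWithinAt (fun y => h (t, y)) (h' (t, x)) D x)
    {x : E} (hx : x ∈ D) :
    HasFDerivWithinAt (fun x => ∫ t in (0 : ℝ)..1, h (t, x)) (∫ t in (0 : ℝ)..1, h' (t, x))
      D x := by
  have hi : ∀ y ∈ D, IntervalIntegrable (fun t => h (t, y)) volume 0 1 := fun y hy =>
    ContinuousOn.intervalIntegrable (by
      rw [uIcc_of_le zero_le_one]
      exact hh.comp (by fun_prop) fun _ ht => ⟨ht, hy⟩)
  have hi' : IntervalIntegrable (fun t => h' (t, x)) volume 0 1 :=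
    ContinuousOn.intervalIntegrable (by
      rw [uIcc_of_le zero_le_one]
      exact hh'.comp (by fun_prop) fun _ ht => ⟨ht, hx⟩)
  have hi'' : ∀ v, IntervalIntegrable (fun t => h' (t, x) v) volume 0 1 := fun v =>
    ContinuousOn.intervalIntegrable (by
      rw [uIcc_of_le zero_le_one]
      exact (hh'.comp (by fun_prop) fun _ ht => ⟨ht, hx⟩ : ContinuousOn (fun t => h' (t, x))
        (Icc 0 1)).clm_apply continuousOn_const)
  rw [hasFDerivWithinAt_iff_isLittleO, Asymptotics.isLittleO_iff]
  intro ε hε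
  obtain ⟨δ, hδ, H⟩ := Metric.eventually_nhds_iff_ball.1 (eventually_uniform_close hh' hx hε)
  filter_upwards [self_mem_nhdsWithin, mem_nhdsWithin_of_mem_nhds (ball_mem_nhds x hδ)]
    with y hy hyδ
  have e1 : (∫ t in (0 : ℝ)..1, h (t, y)) - (∫ t in (0 : ℝ)..1, h (t, x)) -
      (∫ t in (0 : ℝ)..1, h' (t, x)) (y - x) =
      ∫ t in (0 : ℝ)..1, (h (t, y) - h (t, x) - h' (t, x) (y - x)) := by
    rw [intervalIntegral.integral_sub ((hi y hy).sub (hi x hx))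
      (hi'' _),
      intervalIntegral.integral_sub (hi y hy) (hi x hx), ContinuousLinearMap.intervalIntegral_apply hi']
  rw [e1]
  have := intervalIntegral.norm_integral_le_of_norm_le_const (a := (0 : ℝ)) (b := 1)
    (f := fun t => h (t, y) - h (t, x) - h' (t, x) (y - x)) (C := ε * ‖y - x‖) (fun t ht => by
      rw [uIoc_of_le zero_le_one] at ht
      have ht' : t ∈ Icc (0 : ℝ) 1 := ⟨ht.1.le, ht.2⟩
      refine (hD.inter (convex_ball x δ)).norm_image_sub_le_of_norm_hasFDerivWithin_le'
        (f := fun y => h (t, y))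
        (f' := fun z => h' (t, z)) (fun z hz => (hd t ht' z hz.1).mono inter_subset_left)
        (fun z hz => H z hz.2 t ht' hz.1) ⟨hx, mem_ball_self hδ⟩ ⟨hy, hyδ⟩)
  simpa using this

/-- The derivative is again such an integral, with values in `E →L[ℝ] F`. The induction therefore
has to vary the target space, which is why `E` and `F` share a universe. -/
theorem contDiffOn_integral_unitInterval_nat (n : ℕ) {E : Type v} [NormedAddCommGroup E]
    [NormedSpace ℝ E] {D : Set E} (hD : Convex ℝ D) (hu : UniqueDiffOn ℝ D) :
    ∀ {F : Type v} [NormedAddCommGroup F] [NormedSpace ℝ F] [CompleteSpace F] {h : ℝ × E → F},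
    ContDiffOn ℝ n h (Icc 0 1 ×ˢ D) →
    ContDiffOn ℝ n (fun x => ∫ t in (0 : ℝ)..1, h (t, x)) D := by
  induction n with
  | zero =>
    intro F _ _ _ h hh
    exact contDiffOn_zero.2 (continuousOn_integral_unitInterval hh.continuousOn)
  | succ n ih =>
    intro F _ _ _ h hh
    have hcast : ((n + 1 : ℕ) : ℕ∞ω) = (n : ℕ∞ω) + 1 := by push_cast; rfl
    have huI : UniqueDiffOn ℝ (Icc (0 : ℝ) 1 ×ˢ D) := (uniqueDiffOn_Icc_zero_one).prod hu
    rw [hcast] at hh ⊢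
    set h' : ℝ × E → E →L[ℝ] F := fun z =>
      (fderivWithin ℝ h (Icc (0 : ℝ) 1 ×ˢ D) z).comp (ContinuousLinearMap.inr ℝ ℝ E) with hh'
    have c1 : ContDiffOn ℝ n h' (Icc (0 : ℝ) 1 ×ˢ D) :=
      (hh.fderivWithin huI le_rfl).clm_comp contDiffOn_const
    rw [contDiffOn_succ_iff_hasFDerivWithinAt_of_uniqueDiffOn hu]
    refine ⟨by simp, fun x => ∫ t in (0 : ℝ)..1, h' (t, x), ih c1, fun x hx => ?_⟩
    refine hasFDerivWithinAt_integral_unitInterval hD hh.continuousOn c1.continuousOn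
      (fun t ht y hy => ?_) hx
    have k1 := ((hh.differentiableOn (by simp)) (t, y) ⟨ht, hy⟩).hasFDerivWithinAt
    have k2 : HasFDerivWithinAt (fun y : E => (t, y)) (ContinuousLinearMap.inr ℝ ℝ E) D y :=
      (hasFDerivAt_prodMk_right t y).hasFDerivWithinAt
    exact k1.comp y k2 fun z hz => ⟨ht, hz⟩

theorem contDiffOn_integral_unitInterval {E F : Type v} [NormedAddCommGroup E]
    [NormedSpace ℝ E] [NormedAddCommGroup F] [NormedSpace ℝ F] [CompleteSpace F] {D : Set E}
    (hD : Convex ℝ D) (hu : UniqueDiffOn ℝ D) {h : ℝ × E → F}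
    (hh : ContDiffOn ℝ ∞ h (Icc 0 1 ×ˢ D)) :
    ContDiffOn ℝ ∞ (fun x => ∫ t in (0 : ℝ)..1, h (t, x)) D :=
  contDiffOn_infty.2 fun n => contDiffOn_integral_unitInterval_nat n hD hu
    (hh.of_le (by exact_mod_cast le_top))

end ParametricIntegral
-- Straightening a closed one-form
section Straightening

universe v

variable {E : Type*} [NormedAddCommGroup E] [NormedSpace ℝ E]

theorem contDiffOn_of_hasFDerivWithinAt {F : Type*} [NormedAddCommGroup F] [NormedSpace ℝ F]
    {s : Set E} (hs : UniqueDiffOn ℝ s) {f : E → F} {f' : E → E →L[ℝ] F}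
    (hf' : ContDiffOn ℝ ∞ f' s) (h : ∀ x ∈ s, HasFDerivWithinAt f (f' x) s x) :
    ContDiffOn ℝ ∞ f s := by
  have : (∞ : ℕ∞ω) = ∞ + 1 := by simp
  rw [this, contDiffOn_succ_iff_hasFDerivWithinAt_of_uniqueDiffOn hs]
  exact ⟨by simp, f', hf', h⟩

theorem HasFDerivWithinAt.of_inter_isOpen {F : Type*} [NormedAddCommGroup F] [NormedSpace ℝ F]
    {s N : Set E} (hN : IsOpen N) {f : E → F} {f' : E →L[ℝ] F} {x : E} (hx : x ∈ N)
    (h : HasFDerivWithinAt f f' (s ∩ N) x) : HasFDerivWithinAt f f' s x :=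
  (hasFDerivWithinAt_inter (hN.mem_nhds hx)).1 h

/-- Poincaré lemma on a relatively open piece of a half-space. -/
theorem exists_primitive_halfSpace (l : E →L[ℝ] ℝ) {y : E} (hy : l y = 0) {N : Set E}
    (hN : IsOpen N) (hyN : y ∈ N) {η : E → E →L[ℝ] ℝ} (hη : ContDiffOn ℝ ∞ η (halfSpace l ∩ N))
    (hsymm : ∀ a ∈ halfSpace l ∩ N, ∀ v w,
      fderivWithin ℝ η (halfSpace l) a v w = fderivWithin ℝ η (halfSpace l) a w v)
    (hb : l ≠ 0 → ∀ a ∈ N, l a = 0 → ∀ v, l v = 0 → η a v = 0) :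
    ∃ (r : ℝ) (ψ : E → ℝ), 0 < r ∧ ball y r ⊆ N ∧ ψ y = 0 ∧
      ContDiffOn ℝ ∞ ψ (halfSpace l ∩ ball y r) ∧
      (∀ a ∈ halfSpace l ∩ ball y r, HasFDerivWithinAt ψ (η a) (halfSpace l) a) ∧
      (l ≠ 0 → ∀ a ∈ ball y r, l a = 0 → ψ a = 0) := by
  obtain ⟨r, hr, hrN⟩ := Metric.isOpen_iff.1 hN y hyN
  have hsub : halfSpace l ∩ ball y r ⊆ halfSpace l ∩ N := inter_subset_inter_right _ hrN
  have hyl : y ∈ halfSpace l := hy.ge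
  obtain ⟨ψ₀, hψ₀⟩ := ((convex_halfSpace l).inter
    (convex_ball y r)).exists_forall_hasFDerivWithinAt_of_fderivWithin_symmetric
    ((hη.mono hsub).differentiableOn (by simp)) (by
      intro a ha v _ w _
      rw [fderivWithin_inter (isOpen_ball.mem_nhds ha.2)]
      exact hsymm a (hsub ha) v w)
  have hd : ∀ a ∈ halfSpace l ∩ ball y r,
      HasFDerivWithinAt (fun x => ψ₀ x - ψ₀ y) (η a) (halfSpace l ∩ ball y r) a :=
    fun a ha => (hψ₀ a ha).sub_const _
  refine ⟨r, fun x => ψ₀ x - ψ₀ y, hr, hrN, by simp, ?_, fun a ha =>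
    HasFDerivWithinAt.of_inter_isOpen isOpen_ball ha.2 (hd a ha), ?_⟩
  · exact contDiffOn_of_hasFDerivWithinAt ((uniqueDiffOn_halfSpace l).inter isOpen_ball)
      (hη.mono hsub) hd
  -- The segment from `y` to `a` stays in the wall, where the form kills its direction, so the
  -- primitive is constant along it.
  · intro hl a ha hla
    set g : ℝ → E := fun t => y + t • (a - y) with hg
    have hgl : ∀ t, l (g t) = 0 := fun t => by simp [hg, hy, hla]
    have hgm : MapsTo g (Icc 0 1) (halfSpace l ∩ ball y r) := by
      intro t ht
      refine ⟨(hgl t).ge, ?_⟩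
      rw [mem_ball_iff_norm, hg, add_sub_cancel_left, norm_smul, Real.norm_of_nonneg ht.1]
      rw [mem_ball_iff_norm] at ha
      nlinarith [ht.2, norm_nonneg (a - y)]
    have hder : ∀ t ∈ Icc (0 : ℝ) 1,
        HasDerivWithinAt (fun t => ψ₀ (g t) - ψ₀ y) 0 (Icc 0 1) t := by
      intro t ht
      have h1 : HasDerivWithinAt g (a - y) (Icc 0 1) t := by
        have := (((hasDerivAt_id t).smul_const (a - y)).const_add y).hasDerivWithinAt (s := Icc 0 1)
        rwa [one_smul] at this
      have h2 := (hd (g t) (hgm ht)).comp_hasDerivWithinAt t h1 hgm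
      have h3 : η (g t) (a - y) = 0 :=
        hb hl _ (hrN (hgm ht).2) (hgl t) _ (by simp [hy, hla])
      rw [h3] at h2
      exact h2
    have := constant_of_derivWithin_zero (fun t ht => (hder t ht).differentiableWithinAt)
      (fun t ht => (hder t ⟨ht.1, ht.2.le⟩).derivWithin
        (uniqueDiffOn_Icc_zero_one t ⟨ht.1, ht.2.le⟩)) 1 (right_mem_Icc.2 zero_le_one)
    simpa [hg] using this

variable {V : Type*} [NormedAddCommGroup V] [NormedSpace ℝ V]

/-- The last coordinate on `V × ℝ`, multiplied by `k`. -/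
def lastForm (V : Type*) [NormedAddCommGroup V] [NormedSpace ℝ V] (k : ℝ) : V × ℝ →L[ℝ] ℝ :=
  k • ContinuousLinearMap.snd ℝ V ℝ

@[simp] theorem lastForm_apply (k : ℝ) (q : V × ℝ) : lastForm V k q = k * q.2 := rfl

/-- A closed one-form, vanishing on the boundary, is straightened to the last coordinate. -/
theorem exists_straightening_form [FiniteDimensional ℝ E] [FiniteDimensional ℝ V] (l : E →L[ℝ] ℝ) {e : E} (he : l = 0 ∨ l e = 1)
    {y : E} (hy : l y = 0) {N : Set E}
    (hN : IsOpen N) (hyN : y ∈ N) {η : E → E →L[ℝ] ℝ} (hη : ContDiffOn ℝ ∞ η (halfSpace l ∩ N))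
    (hsymm : ∀ a ∈ halfSpace l ∩ N, ∀ v w,
      fderivWithin ℝ η (halfSpace l) a v w = fderivWithin ℝ η (halfSpace l) a w v)
    (hb : l ≠ 0 → ∀ a ∈ N, l a = 0 → ∀ v, l v = 0 → η a v = 0)
    (hηy : η y ≠ 0) (p : E →L[ℝ] V) (hinj : ∀ v, p v = 0 → η y v = 0 → v = 0)
    (hrank : Module.finrank ℝ E = Module.finrank ℝ V + 1) :
    ∃ (σ k : ℝ) (G : OpenPartialHomeomorph E (V × ℝ)), (σ = 1 ∨ σ = -1) ∧ y ∈ G.source ∧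
      G.source ⊆ N ∧ G y = 0 ∧
      (∀ x ∈ G.source, x ∈ halfSpace l ↔ G x ∈ halfSpace (lastForm V k)) ∧
      ContDiffOn ℝ ∞ G (halfSpace l ∩ G.source) ∧
      ContDiffOn ℝ ∞ G.symm (halfSpace (lastForm V k) ∩ G.target) ∧
      ∀ a ∈ halfSpace l ∩ G.source, HasFDerivWithinAt G (p.prod (σ • η a)) (halfSpace l) a := by
  obtain ⟨r, ψ, hr, hrN, hψy, hψc, hψd, hψ0⟩ := exists_primitive_halfSpace l hy hN hyN hη hsymm hb
  have hyl : y ∈ halfSpace l := hy.ge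
  -- choice of the sign
  obtain ⟨σ, k, hσ, hk0, hpos⟩ : ∃ σ k : ℝ, (σ = 1 ∨ σ = -1) ∧ (l = 0 → k = 0) ∧
      ∃ δ > 0, δ ≤ r ∧ ∀ x ∈ ball y δ, 0 < l x → 0 < k * (σ * ψ x) := by
    by_cases hl : l = 0
    -- Without a wall, `k = 0` makes the target half-space the whole space.
    · exact ⟨1, 0, Or.inl rfl, fun _ => rfl, r, hr, le_rfl, fun x _ hx => by simp [hl] at hx⟩
    · have hle : l e = 1 := he.resolve_left hl
      have hc : η y e ≠ 0 := by
        intro h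
        apply hηy
        ext v
        have h1 : η y (v - l v • e) = 0 := hb hl y hyN hy _ (by simp [hle])
        simpa [h] using h1
      -- With a wall, the sign makes the last coordinate increase in the inward direction `e`.
      refine ⟨SignType.sign (η y e), 1, ?_, fun h => absurd h hl, ?_⟩
      · rcases hc.lt_or_gt with h | h
        · right; simp [sign_neg h]
        · left; simp [sign_pos h]
      -- The sign is needed at every interior point near `y`, so `x` is compared with its projection
      -- to the wall, where the primitive vanishes. The chosen tolerance bounds the error by half of
      -- the main term $|\eta_y(e)|\,l(x)$.
      obtain ⟨δ, hδ, H⟩ := exists_strict_estimate (convex_halfSpace l) (uniqueDiffOn_halfSpace l)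
        isOpen_ball ⟨hyl, mem_ball_self hr⟩ (hψc.of_le (by simp)) (hψd y ⟨hyl, mem_ball_self hr⟩)
        (ε := |η y e| / (2 * (‖e‖ + 1))) (by positivity)
      have hcont : ContinuousAt (fun x => x - l x • e) y := by fun_prop
      have hmem : ∀ᶠ x in 𝓝 y, x ∈ ball y (min δ r) ∧ x - l x • e ∈ ball y (min δ r) := by
        have hm := lt_min hδ hr
        refine (isOpen_ball.eventually_mem (mem_ball_self hm)).and (hcont.eventually_mem ?_)
        rw [hy]; simpa using ball_mem_nhds y hm
      obtain ⟨δ', hδ', H'⟩ := Metric.eventually_nhds_iff_ball.1 hmem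
      refine ⟨min δ' r, lt_min hδ' hr, min_le_right _ _, fun x hx hlx => ?_⟩
      obtain ⟨h1, h2⟩ := H' x (ball_subset_ball (min_le_left _ _) hx)
      have hl0 : l (x - l x • e) = 0 := by simp [hle]
      have h3 := H (x - l x • e) ⟨hl0.ge, ball_subset_ball (min_le_left _ _) h2⟩ x
        ⟨hlx.le, ball_subset_ball (min_le_left _ _) h1⟩
      rw [hψ0 hl _ (ball_subset_ball (min_le_right _ _) h2) hl0, sub_sub_cancel, map_smul,
        norm_smul, Real.norm_eq_abs, Real.norm_of_nonneg hlx.le, sub_zero, smul_eq_mul] at h3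
      have h4 : |η y e| / (2 * (‖e‖ + 1)) * (l x * ‖e‖) ≤ |η y e| * l x / 2 := by
        rw [div_mul_eq_mul_div, div_le_div_iff₀ (by positivity) (by positivity)]
        have : 0 ≤ |η y e| * l x := by positivity
        nlinarith [norm_nonneg e]
      have h5 : 0 < |η y e| * l x := by positivity
      have h6 := abs_le.1 (h3.trans h4)
      rcases hc.lt_or_gt with h | h
      · rw [abs_of_neg h] at h6 h5
        simp only [sign_neg h, SignType.coe_neg_one]
        linarith [h6.2]
      · rw [abs_of_pos h] at h6 h5
        simp only [sign_pos h, SignType.coe_one]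
        linarith [h6.1]
  obtain ⟨δ, hδ, hδr, hpos⟩ := hpos
  have hσ0 : σ ≠ 0 := by rcases hσ with rfl | rfl <;> norm_num
  set F : E → V × ℝ := fun x => (p (x - y), σ * ψ x) with hF
  have hFd : ∀ a ∈ halfSpace l ∩ ball y δ,
      HasFDerivWithinAt F (p.prod (σ • η a)) (halfSpace l) a := by
    intro a ha
    have h1 := hψd a ⟨ha.1, ball_subset_ball hδr ha.2⟩
    refine HasFDerivWithinAt.prodMk ?_ (by simpa [smul_eq_mul] using! h1.const_smul σ)
    have := (p.hasFDerivAt (x := a - y)).comp a ((hasFDerivAt_id a).sub_const y)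
    exact this.hasFDerivWithinAt
  have hFc : ContDiffOn ℝ ∞ F (halfSpace l ∩ ball y δ) := by
    refine ContDiffOn.prodMk ?_ ?_
    · exact (p.contDiff.comp (contDiff_id.sub contDiff_const)).contDiffOn
    · exact contDiffOn_const.mul
        (hψc.mono (inter_subset_inter_right _ (ball_subset_ball hδr)))
  have hLinj : Function.Injective (p.prod (σ • η y)).toLinearMap := by
    rw [injective_iff_map_eq_zero]
    intro v hv
    have hv' : (p v, σ * η y v) = (0, 0) := hv
    rw [Prod.mk.injEq] at hv'
    exact hinj v hv'.1 ((mul_eq_zero.1 hv'.2).resolve_left hσ0)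
  set L : E ≃L[ℝ] (V × ℝ) := ((p.prod (σ • η y)).toLinearMap.linearEquivOfInjective hLinj (by
    rw [Module.finrank_prod, Module.finrank_self, hrank])).toContinuousLinearEquiv with hL
  have hLL : (L : E →L[ℝ] V × ℝ) = p.prod (σ • η y) := by ext v <;> rfl
  have : CompleteSpace E := FiniteDimensional.complete ℝ E
  have : CompleteSpace V := FiniteDimensional.complete ℝ V
  obtain ⟨G, hyG, hGN, hGF, hGiff, hGs⟩ := exists_inverse_halfSpace l (lastForm V k) he hy
    (isOpen_ball (x := y) (ε := δ)) (mem_ball_self hδ) hFc L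
    (by rw [hLL]; exact hFd y ⟨hyl, mem_ball_self hδ⟩)
    (fun x hx hlx => by
      by_cases hl : l = 0
      · simp [hk0 hl]
      · simp [hF, hψ0 hl x (ball_subset_ball hδr hx) hlx])
    (fun x hx hlx => by simpa [hF] using hpos x hx hlx)
  refine ⟨σ, k, G, hσ, hyG, hGN.trans ((ball_subset_ball hδr).trans hrN), ?_, hGiff, ?_, hGs, ?_⟩
  · rw [hGF ⟨hyl, hyG⟩]; simp [hF, hψy]
  · exact (hFc.mono (inter_subset_inter_right _ hGN)).congr hGF
  · intro a ha
    refine HasFDerivWithinAt.of_inter_isOpen G.open_source ha.2 ?_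
    exact ((hFd a ⟨ha.1, hGN ha.2⟩).mono inter_subset_left).congr hGF (hGF ha)

end Straightening
-- Straightening a commuting frame along the leaves
section LeafStraightening

universe v

variable {V : Type v} [NormedAddCommGroup V] [NormedSpace ℝ V]

/-- The leafwise radial primitive of a leafwise one-form. -/
noncomputable def radialPrimitive (η : V × ℝ → V →L[ℝ] V) (q : V × ℝ) : V :=
  ∫ t in (0 : ℝ)..1, η (t • q.1, q.2) q.1

theorem radial_mem {k r t : ℝ} (ht : t ∈ Icc (0 : ℝ) 1) {q : V × ℝ}
    (hq : q ∈ halfSpace (lastForm V k) ∩ ball 0 r) :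
    (t • q.1, q.2) ∈ halfSpace (lastForm V k) ∩ ball 0 r := by
  refine ⟨hq.1, ?_⟩
  have h := hq.2
  rw [mem_ball_zero_iff] at h ⊢
  refine lt_of_le_of_lt ?_ h
  rw [Prod.norm_def, Prod.norm_def]
  refine max_le_max ?_ le_rfl
  rw [norm_smul, Real.norm_of_nonneg ht.1]
  nlinarith [ht.2, norm_nonneg q.1]

/-- Poincaré lemma with the parameter $z$, used only in the leaf directions: closedness is assumed,
and the derivative is prescribed, on the vectors $(w,0)$ alone. -/
theorem contDiffOn_radialPrimitive_and_deriv [FiniteDimensional ℝ V] {k r : ℝ} {η : V × ℝ → V →L[ℝ] V}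
    (hη : ContDiffOn ℝ ∞ η (halfSpace (lastForm V k) ∩ ball 0 r))
    (hclosed : ∀ q ∈ halfSpace (lastForm V k) ∩ ball 0 r, ∀ a b : V,
      fderivWithin ℝ η (halfSpace (lastForm V k) ∩ ball 0 r) q (a, 0) b =
        fderivWithin ℝ η (halfSpace (lastForm V k) ∩ ball 0 r) q (b, 0) a) :
    ContDiffOn ℝ ∞ (radialPrimitive η) (halfSpace (lastForm V k) ∩ ball 0 r) ∧
    ∀ q ∈ halfSpace (lastForm V k) ∩ ball 0 r, ∃ f' : V × ℝ →L[ℝ] V,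
      HasFDerivWithinAt (radialPrimitive η) f' (halfSpace (lastForm V k) ∩ ball 0 r) q ∧
      ∀ w, f' (w, 0) = η q w := by
  set D := halfSpace (lastForm V k) ∩ ball (0 : V × ℝ) r with hD
  have hDc : Convex ℝ D := (convex_halfSpace _).inter (convex_ball _ _)
  have hDu : UniqueDiffOn ℝ D := (uniqueDiffOn_halfSpace _).inter isOpen_ball
  have : CompleteSpace V := FiniteDimensional.complete ℝ V
  set h : ℝ × (V × ℝ) → V := fun z => η (z.1 • z.2.1, z.2.2) z.2.1 with hh
  have hmaps : MapsTo (fun z : ℝ × (V × ℝ) => (z.1 • z.2.1, z.2.2)) (Icc 0 1 ×ˢ D) D :=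
    fun z hz => radial_mem hz.1 hz.2
  have hin : ContDiff ℝ ∞ (fun z : ℝ × (V × ℝ) => (z.1 • z.2.1, z.2.2)) := by fun_prop
  have hhc : ContDiffOn ℝ ∞ h (Icc 0 1 ×ˢ D) :=
    (hη.comp hin.contDiffOn hmaps).clm_apply (by fun_prop)
  refine ⟨contDiffOn_integral_unitInterval hDc hDu hhc, fun q hq => ?_⟩
  set η' : V × ℝ → V × ℝ →L[ℝ] V →L[ℝ] V := fderivWithin ℝ η D with hη'
  have hη'd : ∀ q ∈ D, HasFDerivWithinAt η (η' q) D q := fun q hq =>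
    ((hη.differentiableOn (by simp)) q hq).hasFDerivWithinAt
  have hη'c : ContDiffOn ℝ ∞ η' D := hη.fderivWithin hDu (by simp)
  -- derivative of the integrand with respect to the parameter
  set A : ℝ → V × ℝ →L[ℝ] V × ℝ := fun t =>
    (t • ContinuousLinearMap.fst ℝ V ℝ).prod (ContinuousLinearMap.snd ℝ V ℝ) with hA
  have hAapp : ∀ t (q : V × ℝ), A t q = (t • q.1, q.2) := fun t q => rfl
  have hAc : Continuous A := by
    have : A = fun t => t • (ContinuousLinearMap.inl ℝ V ℝ).comp (ContinuousLinearMap.fst ℝ V ℝ) +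
        (ContinuousLinearMap.inr ℝ V ℝ).comp (ContinuousLinearMap.snd ℝ V ℝ) := by
      funext t; ext <;> simp [hA]
    rw [this]
    fun_prop
  set h' : ℝ × (V × ℝ) → V × ℝ →L[ℝ] V := fun z =>
    (η (A z.1 z.2)).comp (ContinuousLinearMap.fst ℝ V ℝ) +
      ((η' (A z.1 z.2)).comp (A z.1)).flip z.2.1 with hh'
  have hAm : ContinuousOn (fun z : ℝ × (V × ℝ) => A z.1 z.2) (Icc 0 1 ×ˢ D) :=
    hin.continuous.continuousOn
  have hh'c : ContinuousOn h' (Icc 0 1 ×ˢ D) := by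
    have c1 : ContinuousOn (fun z : ℝ × (V × ℝ) => η (A z.1 z.2)) (Icc 0 1 ×ˢ D) :=
      hη.continuousOn.comp hAm hmaps
    have c2 : ContinuousOn (fun z : ℝ × (V × ℝ) => η' (A z.1 z.2)) (Icc 0 1 ×ˢ D) :=
      hη'c.continuousOn.comp hAm hmaps
    have c3 : ContinuousOn (fun z : ℝ × (V × ℝ) => A z.1) (Icc 0 1 ×ˢ D) :=
      (hAc.comp continuous_fst).continuousOn
    refine (c1.clm_comp continuousOn_const).add ?_
    have c4 := c2.clm_comp c3
    have c5 : ContinuousOn (fun z : ℝ × (V × ℝ) => ((η' (A z.1 z.2)).comp (A z.1)).flip)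
        (Icc 0 1 ×ˢ D) :=
      (ContinuousLinearMap.flipₗᵢ ℝ (V × ℝ) V V).continuous.comp_continuousOn c4
    exact c5.clm_apply (by fun_prop)
  have hder := hasFDerivWithinAt_integral_unitInterval hDc hhc.continuousOn hh'c
    (fun t ht x hx => by
      have h1 : HasFDerivWithinAt (fun y : V × ℝ => η (A t y)) ((η' (A t x)).comp (A t)) D x :=
        (hη'd (A t x) (hmaps (show (t, x) ∈ Icc (0 : ℝ) 1 ×ˢ D from ⟨ht, hx⟩))).comp x
          (A t).hasFDerivWithinAt fun y hy => hmaps (show (t, y) ∈ Icc (0 : ℝ) 1 ×ˢ D from ⟨ht, hy⟩)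
      exact h1.clm_apply (ContinuousLinearMap.fst ℝ V ℝ).hasFDerivWithinAt) hq
  refine ⟨_, hder, fun w => ?_⟩
  have hslice : ContinuousOn (fun t : ℝ => h' (t, q)) (Icc 0 1) :=
    hh'c.comp (by fun_prop) fun t ht => ⟨ht, hq⟩
  have hint : IntervalIntegrable (fun t => h' (t, q)) MeasureTheory.volume 0 1 :=
    ContinuousOn.intervalIntegrable (by rwa [uIcc_of_le zero_le_one])
  rw [ContinuousLinearMap.intervalIntegral_apply hint]
  -- By closedness, the derivative of the integrand in the direction $(w,0)$ is
  -- $\frac{d}{dt}\bigl(t\,\eta_{(tv,z)}(w)\bigr)$, where $q=(v,z)$; integrating leaves $\eta_q(w)$.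
  set g : ℝ → V := fun t => t • η (t • q.1, q.2) w with hg
  have hpath : ∀ t ∈ Icc (0 : ℝ) 1, HasDerivWithinAt (fun t : ℝ => ((t • q.1, q.2) : V × ℝ))
      ((q.1, 0) : V × ℝ) (Icc 0 1) t := by
    intro t ht
    have h1 : HasDerivAt (fun t : ℝ => t • q.1) q.1 t := by
      simpa using! (hasDerivAt_id t).smul_const q.1
    exact (h1.prodMk (hasDerivAt_const t q.2)).hasDerivWithinAt
  have hgd : ∀ t ∈ Icc (0 : ℝ) 1, HasDerivWithinAt g (h' (t, q) (w, 0)) (Icc 0 1) t := by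
    intro t ht
    have hm := radial_mem ht hq
    have h1 := (hη'd _ hm).comp_hasDerivWithinAt t (hpath t ht)
      (fun s hs => radial_mem hs hq)
    have h2 : HasDerivWithinAt (fun s : ℝ => η (s • q.1, q.2) w)
        (η' (t • q.1, q.2) (q.1, 0) w) (Icc 0 1) t := by
      simpa using! h1.clm_apply (hasDerivWithinAt_const t (Icc (0 : ℝ) 1) w)
    have h3 := (hasDerivWithinAt_id t (Icc (0 : ℝ) 1)).smul h2
    convert! h3 using 1
    simp only [hh', hAapp, _root_.add_apply, ContinuousLinearMap.comp_apply,
      ContinuousLinearMap.flip_apply, ContinuousLinearMap.coe_fst', id_eq, one_smul]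
    rw [hclosed _ hm q.1 w, add_comm]
    have : ((t • w, 0) : V × ℝ) = t • (w, 0) := by simp
    rw [this, map_smul]
    rfl
  have hFTC := intervalIntegral.integral_eq_sub_of_hasDerivAt_of_le zero_le_one
    (f := g) (f' := fun t => h' (t, q) (w, 0))
    (fun t ht => (hgd t ht).continuousWithinAt)
    (fun t ht => (hgd t ⟨ht.1.le, ht.2.le⟩).hasDerivAt (Icc_mem_nhds ht.1 ht.2))
    (ContinuousOn.intervalIntegrable (by
      rw [uIcc_of_le zero_le_one]; exact hslice.clm_apply continuousOn_const))
  rw [hFTC]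
  simp [hg]

/-- A commuting leafwise frame is straightened to the coordinate frame. -/
theorem exists_straightening_frame [FiniteDimensional ℝ V] (k : ℝ) {N : Set (V × ℝ)} (hN : IsOpen N) (h0N : 0 ∈ N)
    {X : V × ℝ → V →L[ℝ] V} (hX : ContDiffOn ℝ ∞ X (halfSpace (lastForm V k) ∩ N))
    (hinv : ∀ q ∈ halfSpace (lastForm V k) ∩ N, ∃ e : V ≃L[ℝ] V, (e : V →L[ℝ] V) = X q)
    (hcomm : ∀ q ∈ halfSpace (lastForm V k) ∩ N, ∀ c d : V,
      fderivWithin ℝ X (halfSpace (lastForm V k)) q (X q c, 0) d =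
        fderivWithin ℝ X (halfSpace (lastForm V k)) q (X q d, 0) c) :
    ∃ G : OpenPartialHomeomorph (V × ℝ) (V × ℝ), 0 ∈ G.source ∧ G.source ⊆ N ∧ G 0 = 0 ∧
      (∀ q ∈ G.source, q ∈ halfSpace (lastForm V k) ↔ G q ∈ halfSpace (lastForm V k)) ∧
      ContDiffOn ℝ ∞ G (halfSpace (lastForm V k) ∩ G.source) ∧
      ContDiffOn ℝ ∞ G.symm (halfSpace (lastForm V k) ∩ G.target) ∧
      ∀ q ∈ halfSpace (lastForm V k) ∩ G.source, ∃ G' : V × ℝ →L[ℝ] V × ℝ,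
        HasFDerivWithinAt G G' (halfSpace (lastForm V k)) q ∧
        (∀ c, G' (X q c, 0) = (c, 0)) ∧ ∀ w, (G' w).2 = w.2 := by
  obtain ⟨r, hr, hrN⟩ := Metric.isOpen_iff.1 hN 0 h0N
  set D := halfSpace (lastForm V k) ∩ ball (0 : V × ℝ) r with hD
  have hDN : D ⊆ halfSpace (lastForm V k) ∩ N := inter_subset_inter_right _ hrN
  have hDu : UniqueDiffOn ℝ D := (uniqueDiffOn_halfSpace _).inter isOpen_ball
  have : CompleteSpace V := FiniteDimensional.complete ℝ V
  set η : V × ℝ → V →L[ℝ] V := fun q => ContinuousLinearMap.inverse (X q) with hη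
  have hηc : ContDiffOn ℝ ∞ η D := by
    intro q hq
    obtain ⟨e, he⟩ := hinv q (hDN hq)
    have : ContDiffAt ℝ ∞ ContinuousLinearMap.inverse (X q) := by
      rw [← he]; exact contDiffAt_map_inverse e
    exact this.comp_contDiffWithinAt q ((hX.mono hDN) q hq)
  have hηX : ∀ q ∈ D, ∀ c, η q (X q c) = c := by
    intro q hq c
    obtain ⟨e, he⟩ := hinv q (hDN hq)
    simp [hη, ← he]
  have hXη : ∀ q ∈ D, ∀ c, X q (η q c) = c := by
    intro q hq c
    obtain ⟨e, he⟩ := hinv q (hDN hq)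
    simp [hη, ← he]
  -- Differentiating $\eta X=\mathrm{id}$ gives $d\eta(v)\,Xc=-\eta\,(dX(v)\,c)$, so the commutation
  -- of the frame becomes closedness of the dual coframe along the leaves.
  have hclosed : ∀ q ∈ D, ∀ a b : V,
      fderivWithin ℝ η D q (a, 0) b = fderivWithin ℝ η D q (b, 0) a := by
    intro q hq
    have hX' : fderivWithin ℝ X D q = fderivWithin ℝ X (halfSpace (lastForm V k)) q :=
      fderivWithin_inter (isOpen_ball.mem_nhds hq.2)
    have d1 : HasFDerivWithinAt η (fderivWithin ℝ η D q) D q :=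
      ((hηc.differentiableOn (by simp)) q hq).hasFDerivWithinAt
    have d2 : HasFDerivWithinAt X (fderivWithin ℝ X D q) D q :=
      (((hX.mono hDN).differentiableOn (by simp)) q hq).hasFDerivWithinAt
    have key : ∀ v : V × ℝ, ∀ c, fderivWithin ℝ η D q v (X q c) =
        - η q (fderivWithin ℝ X D q v c) := by
      intro v c
      have h1 : HasFDerivWithinAt (fun q => X q c)
          ((fderivWithin ℝ X D q).flip c) D q := by
        simpa using! d2.clm_apply (hasFDerivWithinAt_const c q D)
      have h2 := d1.clm_apply h1
      have h3 : HasFDerivWithinAt (fun q => η q (X q c)) (0 : V × ℝ →L[ℝ] V) D q :=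
        (hasFDerivWithinAt_const c q D).congr (fun x hx => hηX x hx c) (hηX q hq c)
      have h4 := (hDu q hq).eq h2 h3
      have h5 := congrArg (fun T => T v) h4
      simp only [_root_.add_apply, ContinuousLinearMap.comp_apply,
        ContinuousLinearMap.flip_apply, _root_.zero_apply] at h5
      rw [add_comm] at h5
      exact eq_neg_of_add_eq_zero_left h5
    intro a b
    have ha := hXη q hq a
    have hb := hXη q hq b
    have e1 := key (X q (η q a), 0) (η q b)
    have e2 := key (X q (η q b), 0) (η q a)
    rw [hX', hcomm q (hDN hq)] at e1
    rw [hX'] at e2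
    rw [ha, hb] at e1 e2
    rw [e1, e2]
  obtain ⟨hfc, hfd⟩ := contDiffOn_radialPrimitive_and_deriv hηc hclosed
  set F : V × ℝ → V × ℝ := fun q => (radialPrimitive η q, q.2) with hF
  have hFc : ContDiffOn ℝ ∞ F (halfSpace (lastForm V k) ∩ ball 0 r) :=
    hfc.prodMk contDiff_snd.contDiffOn
  have hFd : ∀ q ∈ D, ∃ G' : V × ℝ →L[ℝ] V × ℝ,
        HasFDerivWithinAt F G' (halfSpace (lastForm V k)) q ∧
        (∀ w, G' (w, 0) = (η q w, 0)) ∧ ∀ w, (G' w).2 = w.2 := by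
    intro q hq
    obtain ⟨f', hf', hw⟩ := hfd q hq
    refine ⟨f'.prod (ContinuousLinearMap.snd ℝ V ℝ), ?_, fun w => ?_, fun w => rfl⟩
    · exact (HasFDerivWithinAt.of_inter_isOpen isOpen_ball hq.2 hf').prodMk
        hasFDerivWithinAt_snd
    · simp [hw]
  have h0 : (0 : V × ℝ) ∈ D := ⟨zero_mem_halfSpace _, mem_ball_self hr⟩
  obtain ⟨L', hL', hLw, hL2⟩ := hFd 0 h0
  have hLinj : Function.Injective L'.toLinearMap := by
    rw [injective_iff_map_eq_zero]
    rintro ⟨w, z⟩ hv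
    change L' (w, z) = 0 at hv
    have hz : z = 0 := by simpa [hv] using (hL2 (w, z)).symm
    subst hz
    rw [hLw, Prod.mk_eq_zero] at hv
    have := hXη 0 h0 w
    rw [hv.1, map_zero] at this
    simp [← this]
  set L : (V × ℝ) ≃L[ℝ] (V × ℝ) :=
    (L'.toLinearMap.linearEquivOfInjective hLinj rfl).toContinuousLinearEquiv
  have hLL : (L : V × ℝ →L[ℝ] V × ℝ) = L' := by ext v <;> rfl
  obtain ⟨e, he⟩ : ∃ e : V × ℝ, lastForm V k = 0 ∨ lastForm V k e = 1 := by
    by_cases hk : k = 0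
    · exact ⟨0, Or.inl (by simp [lastForm, hk])⟩
    · exact ⟨(0, k⁻¹), Or.inr (by simp [hk])⟩
  obtain ⟨G, h0G, hGN, hGF, hGiff, hGs⟩ := exists_inverse_halfSpace (lastForm V k) (lastForm V k) he
    (y := 0) (by simp) (isOpen_ball (x := 0) (ε := r)) (mem_ball_self hr) hFc L (by rwa [hLL])
    (fun x _ hx => hx) (fun x _ hx => hx)
  refine ⟨G, h0G, hGN.trans hrN, ?_, hGiff, ?_, hGs, ?_⟩
  · rw [hGF ⟨h0.1, h0G⟩]
    simp [hF, radialPrimitive]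
  · exact (hFc.mono (inter_subset_inter_right _ hGN)).congr hGF
  · intro q hq
    have hqD : q ∈ D := ⟨hq.1, hGN hq.2⟩
    obtain ⟨G', h1, h2, h3⟩ := hFd q hqD
    refine ⟨G', HasFDerivWithinAt.of_inter_isOpen G.open_source hq.2
      ((h1.mono inter_subset_left).congr hGF (hGF hq)), fun c => ?_, h3⟩
    rw [h2, hηX q hqD]

end LeafStraightening
-- Simultaneous normal form of the one-form and the frame
section LocalNormalForm

universe v w

variable {E : Type w} [NormedAddCommGroup E] [NormedSpace ℝ E] [FiniteDimensional ℝ E]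
  {V : Type v} [NormedAddCommGroup V] [NormedSpace ℝ V] [FiniteDimensional ℝ V]

/-- A commuting frame of the kernel of a closed one-form and the form itself are straightened
simultaneously. -/
theorem exists_local_normal_form (l : E →L[ℝ] ℝ) {e : E} (he : l = 0 ∨ l e = 1)
    {y : E} (hy : l y = 0) {N : Set E}
    (hN : IsOpen N) (hyN : y ∈ N) {η : E → E →L[ℝ] ℝ} (hη : ContDiffOn ℝ ∞ η (halfSpace l ∩ N))
    (hsymm : ∀ a ∈ halfSpace l ∩ N, ∀ v w,
      fderivWithin ℝ η (halfSpace l) a v w = fderivWithin ℝ η (halfSpace l) a w v)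
    (hb : l ≠ 0 → ∀ a ∈ N, l a = 0 → ∀ v, l v = 0 → η a v = 0)
    (hηy : η y ≠ 0) {Y : E → V →L[ℝ] E} (hY : ContDiffOn ℝ ∞ Y (halfSpace l ∩ N))
    (hηY : ∀ a ∈ halfSpace l ∩ N, ∀ c, η a (Y a c) = 0)
    (hYinj : Function.Injective (Y y))
    (hcomm : ∀ a ∈ halfSpace l ∩ N, ∀ c d : V,
      fderivWithin ℝ Y (halfSpace l) a (Y a c) d = fderivWithin ℝ Y (halfSpace l) a (Y a d) c)
    (hrank : Module.finrank ℝ E = Module.finrank ℝ V + 1) :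
    ∃ (σ k : ℝ) (G : OpenPartialHomeomorph E (V × ℝ)), (σ = 1 ∨ σ = -1) ∧ y ∈ G.source ∧
      G.source ⊆ N ∧ G y = 0 ∧
      (∀ x ∈ G.source, x ∈ halfSpace l ↔ G x ∈ halfSpace (lastForm V k)) ∧
      ContDiffOn ℝ ∞ G (halfSpace l ∩ G.source) ∧
      ContDiffOn ℝ ∞ G.symm (halfSpace (lastForm V k) ∩ G.target) ∧
      ∀ a ∈ halfSpace l ∩ G.source, ∃ G' : E →L[ℝ] V × ℝ,
        HasFDerivWithinAt G G' (halfSpace l) a ∧ (∀ c, G' (Y a c) = (c, 0)) ∧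
        ∀ w, (G' w).2 = σ * η a w := by
  have hyl : y ∈ halfSpace l := hy.ge
  have hker : LinearMap.range (Y y).toLinearMap = LinearMap.ker (η y).toLinearMap := by
    apply Submodule.eq_of_le_of_finrank_eq
    · rintro _ ⟨c, rfl⟩
      exact hηY y ⟨hyl, hyN⟩ c
    · have h1 := LinearMap.finrank_range_add_finrank_ker (η y).toLinearMap
      have h2 : LinearMap.range (η y).toLinearMap = ⊤ := by
        apply LinearMap.range_eq_top.2
        apply LinearMap.surjective
        intro h
        exact hηy (ContinuousLinearMap.coe_injective h)
      rw [h2, finrank_top, Module.finrank_self] at h1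
      have h3 := LinearMap.finrank_range_of_inj (f := (Y y).toLinearMap) hYinj
      omega
  -- A left inverse of the frame at `y`, used as the leaf coordinates, makes the transported frame
  -- the identity at the origin and hence invertible nearby.
  obtain ⟨p₀, hp₀⟩ := (Y y).toLinearMap.exists_leftInverse_of_injective
    (LinearMap.ker_eq_bot.2 hYinj)
  set p : E →L[ℝ] V := p₀.toContinuousLinearMap with hp
  have hpY : ∀ c, p (Y y c) = c := fun c => LinearMap.congr_fun hp₀ c
  obtain ⟨σ, k, G, hσ, hyG, hGN, hGy, hGiff, hGc, hGs, hGd⟩ :=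
    exists_straightening_form l he hy hN hyN hη hsymm hb hηy p (fun v h1 h2 => by
      have : v ∈ LinearMap.range (Y y).toLinearMap := by rw [hker]; exact h2
      obtain ⟨c, rfl⟩ := this
      have := hpY c
      change p (Y y c) = 0 at h1
      rw [h1] at this
      subst this
      simp) hrank
  set H' := halfSpace (lastForm V k) with hH'
  have hmaps : MapsTo G.symm (H' ∩ G.target) (halfSpace l ∩ G.source) := by
    intro q hq
    have h1 := G.map_target hq.2
    exact ⟨(hGiff _ h1).2 (by rw [G.right_inv hq.2]; exact hq.1), h1⟩
  have hmaps' : MapsTo G (halfSpace l ∩ G.source) (H' ∩ G.target) :=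
    fun a ha => ⟨(hGiff a ha.2).1 ha.1, G.map_source ha.2⟩
  have hsub : halfSpace l ∩ G.source ⊆ halfSpace l ∩ N := inter_subset_inter_right _ hGN
  -- As the one-form kills the frame, the image of $Yc$ under the first straightening has zero last
  -- component, and `X` records the remaining one.
  set X : V × ℝ → V →L[ℝ] V := fun q => p.comp (Y (G.symm q)) with hX
  have hXc : ContDiffOn ℝ ∞ X (H' ∩ G.target) :=
    contDiffOn_const.clm_comp ((hY.mono hsub).comp hGs hmaps)
  have h0T : (0 : V × ℝ) ∈ H' ∩ G.target := by rw [← hGy]; exact hmaps' ⟨hyl, hyG⟩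
  have hG0 : G.symm 0 = y := by rw [← hGy, G.left_inv hyG]
  have hX0 : X 0 = (ContinuousLinearEquiv.refl ℝ V : V →L[ℝ] V) := by
    ext c
    simp [hX, hG0, hpY]
  have : CompleteSpace V := FiniteDimensional.complete ℝ V
  have hinv : ∀ᶠ q in 𝓝 (0 : V × ℝ), q ∈ H' ∩ G.target →
      ∃ e : V ≃L[ℝ] V, (e : V →L[ℝ] V) = X q := by
    have h1 := hXc.continuousOn 0 h0T
    rw [ContinuousWithinAt, hX0] at h1
    have h2 := h1.eventually (ContinuousLinearEquiv.nhds (ContinuousLinearEquiv.refl ℝ V))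
    rw [eventually_nhdsWithin_iff] at h2
    exact h2
  obtain ⟨O, hO, hOo, h0O⟩ := _root_.eventually_nhds_iff.1 hinv
  have hu : UniqueDiffOn ℝ (halfSpace l ∩ G.source) := (uniqueDiffOn_halfSpace l).inter G.open_source
  have hsub2 : H' ∩ (G.target ∩ O) ⊆ H' ∩ G.target := fun q hq => ⟨hq.1, hq.2.1⟩
  obtain ⟨G₂, h0G₂, hG₂N, hG₂0, hG₂iff, hG₂c, hG₂s, hG₂d⟩ := exists_straightening_frame k
    (G.open_target.inter hOo) ⟨h0T.2, h0O⟩ (hXc.mono hsub2)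
    (fun q hq => hO q hq.2.2 (hsub2 hq)) (by
      intro q hq c d
      have hqT := hsub2 hq
      have ha := hmaps hqT
      set a := G.symm q with haq
      have hGa : G a = q := G.right_inv hqT.2
      have dK : HasFDerivWithinAt G.symm (fderivWithin ℝ G.symm (H' ∩ G.target) q)
          (H' ∩ G.target) q :=
        ((hGs.differentiableOn (by simp)) q hqT).hasFDerivWithinAt
      have dY : HasFDerivWithinAt Y (fderivWithin ℝ Y (halfSpace l) a) (halfSpace l) a := by
        have h1 := ((hY.differentiableOn (by simp)) a (hsub ha)).hasFDerivWithinAt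
        rw [fderivWithin_inter (hN.mem_nhds (hsub ha).2)] at h1
        exact HasFDerivWithinAt.of_inter_isOpen hN (hsub ha).2 h1
      have dKG : ∀ v, fderivWithin ℝ G.symm (H' ∩ G.target) q ((p.prod (σ • η a)) v) = v := by
        intro v
        have h1 : HasFDerivWithinAt (fun x => G.symm (G x))
            ((fderivWithin ℝ G.symm (H' ∩ G.target) q).comp (p.prod (σ • η a)))
            (halfSpace l ∩ G.source) a := by
          have h2 := (hGd a ha).mono (inter_subset_left (t := G.source))
          rw [← hGa] at dK
          rw [← hGa]
          exact dK.comp a h2 hmaps'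
        have h3 : HasFDerivWithinAt (fun x => G.symm (G x)) (ContinuousLinearMap.id ℝ E)
            (halfSpace l ∩ G.source) a :=
          (hasFDerivWithinAt_id a _).congr (fun x hx => G.left_inv hx.2) (G.left_inv ha.2)
        exact congrArg (fun T => T v) ((hu a ha).eq h1 h3)
      have hKX : ∀ c, fderivWithin ℝ G.symm (H' ∩ G.target) q (X q c, 0) = Y a c := by
        intro c
        rw [← dKG (Y a c)]
        congr 1
        simp [hX, hηY a (hsub ha), ← haq]
      have dX : HasFDerivWithinAt X ((ContinuousLinearMap.compL ℝ V E V p).comp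
          ((fderivWithin ℝ Y (halfSpace l) a).comp (fderivWithin ℝ G.symm (H' ∩ G.target) q)))
          (H' ∩ G.target) q :=
        (ContinuousLinearMap.compL ℝ V E V p).hasFDerivAt.comp_hasFDerivWithinAt q
          (dY.comp q dK fun x hx => (hmaps hx).1)
      have dX' := (HasFDerivWithinAt.of_inter_isOpen G.open_target hqT.2 dX).fderivWithin
        (uniqueDiffOn_halfSpace _ q hqT.1)
      rw [dX']
      simp only [ContinuousLinearMap.comp_apply, ContinuousLinearMap.compL_apply, hKX]
      rw [hcomm a (hsub ha)])
  set K := G.trans G₂ with hK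
  have hKsrc : K.source = G.source ∩ G ⁻¹' G₂.source := G.trans_source G₂
  have hKtgt : K.target = G₂.target ∩ G₂.symm ⁻¹' G.target := G.trans_target G₂
  have hKm : MapsTo G (halfSpace l ∩ K.source) (H' ∩ G₂.source) := by
    intro a ha
    rw [hKsrc] at ha
    exact ⟨(hGiff a ha.2.1).1 ha.1, ha.2.2⟩
  have hKs : halfSpace l ∩ K.source ⊆ halfSpace l ∩ G.source := by
    intro a ha
    rw [hKsrc] at ha
    exact ⟨ha.1, ha.2.1⟩
  refine ⟨σ, k, K, hσ, ?_, ?_, ?_, ?_, ?_, ?_, ?_⟩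
  · rw [hKsrc]; exact ⟨hyG, by rw [mem_preimage, hGy]; exact h0G₂⟩
  · rw [hKsrc]; exact inter_subset_left.trans hGN
  · simp [hK, hGy, hG₂0]
  · intro x hx
    rw [hKsrc] at hx
    rw [hGiff x hx.1, hG₂iff _ hx.2]
    rfl
  · exact hG₂c.comp (hGc.mono hKs) hKm
  · have hm : MapsTo G₂.symm (H' ∩ K.target) (H' ∩ G.target) := by
      intro q hq
      rw [hKtgt] at hq
      refine ⟨(hG₂iff _ (G₂.map_target hq.2.1)).2 ?_, hq.2.2⟩
      rw [G₂.right_inv hq.2.1]; exact hq.1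
    exact hGs.comp (hG₂s.mono fun q hq => ⟨hq.1, by rw [hKtgt] at hq; exact hq.2.1⟩) hm
  · intro a ha
    obtain ⟨G', h1, h2, h3⟩ := hG₂d _ (hKm ha)
    have haG := hKs ha
    refine ⟨G'.comp (p.prod (σ • η a)), ?_, fun c => ?_, fun w => ?_⟩
    · refine HasFDerivWithinAt.of_inter_isOpen K.open_source ha.2 ?_
      exact h1.comp a ((hGd a haG).mono inter_subset_left) fun x hx => (hKm hx).1
    · have h4 := h2 c
      have h5 : (p.prod (σ • η a)) (Y a c) = (X (G a) c, 0) := by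
        simp [hX, hηY a (hsub haG), G.left_inv haG.2]
      rw [ContinuousLinearMap.comp_apply, h5, h4]
    · rw [ContinuousLinearMap.comp_apply, h3]
      rfl

end LocalNormalForm
-- Differential forms in charts
section ChartTransfer

universe u

variable {M : Type u} [TopologicalSpace M] [ChartedSpace (EuclideanHalfSpace 3) M]

/-- The representative of a vector field in the chart around `x₀`. -/
noncomputable def fieldInChart (X : VField M) (x₀ : M) : E3 → E3 :=
  mpullbackWithin 𝓘(ℝ, E3) (𝓡∂ 3) (extChartAt (𝓡∂ 3) x₀).symm X (range (𝓡∂ 3))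

/-- The representative of a one-form in the chart around `x₀`, as a covector field. -/
noncomputable def covectorInChart (α : DForm 1 M) (x₀ : M) (y : E3) : E3 →L[ℝ] ℝ :=
  (ContinuousAlternatingMap.ofSubsingletonLIE (𝕜 := ℝ) (E := E3) (F := ℝ) (0 : Fin 1)).symm
    (formInChart α x₀ y)

theorem covectorInChart_apply (α : DForm 1 M) (x₀ : M) (y v : E3) :
    covectorInChart α x₀ y v = formInChart α x₀ y ![v] := by
  obtain ⟨f, hf⟩ := (ContinuousAlternatingMap.ofSubsingletonLIE (𝕜 := ℝ) (E := E3) (F := ℝ)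
    (0 : Fin 1)).surjective (formInChart α x₀ y)
  rw [covectorInChart, ← hf, LinearIsometryEquiv.symm_apply_apply]
  rfl

theorem SmoothForm.differentiableWithinAt {k : ℕ} {α : DForm k M} (hα : SmoothForm α) (x₀ : M)
    {y : E3} (hy : y ∈ (extChartAt (𝓡∂ 3) x₀).target) :
    DifferentiableWithinAt ℝ (formInChart α x₀) (range (𝓡∂ 3)) y :=
  (((hα x₀).differentiableOn (by simp)) y hy).mono_of_mem_nhdsWithin
    (extChartAt_target_mem_nhdsWithin_of_mem hy)

theorem SmoothForm.contDiffOn_covectorInChart {α : DForm 1 M} (hα : SmoothForm α) (x₀ : M) :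
    ContDiffOn ℝ ∞ (covectorInChart α x₀) (extChartAt (𝓡∂ 3) x₀).target :=
  (ContinuousAlternatingMap.ofSubsingletonLIE (𝕜 := ℝ) (E := E3) (F := ℝ)
    (0 : Fin 1)).symm.contDiff.comp_contDiffOn (hα x₀)

variable [IsManifold (𝓡∂ 3) ∞ M]

theorem two_le_infty : minSmoothness ℝ 2 ≤ (∞ : ℕ∞ω) := by
  rw [minSmoothness_of_isRCLikeNormedField]
  exact WithTop.coe_le_coe.2 (le_top : (2 : ℕ∞) ≤ ⊤)

theorem uniqueDiffOn_range_model : UniqueDiffOn ℝ (range (𝓡∂ 3)) := (𝓡∂ 3).uniqueDiffOn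

theorem mem_closure_interior_range_model {y : E3} (hy : y ∈ range (𝓡∂ 3)) :
    y ∈ closure (interior (range (𝓡∂ 3))) := (𝓡∂ 3).range_subset_closure_interior hy

theorem contMDiffWithinAt_transition (x₀ x : M) {y : E3}
    (hy : y ∈ (extChartAt (𝓡∂ 3) x₀).target)
    (hx : (extChartAt (𝓡∂ 3) x₀).symm y ∈ (extChartAt (𝓡∂ 3) x).source) :
    ContDiffWithinAt ℝ ∞ (extChartAt (𝓡∂ 3) x ∘ (extChartAt (𝓡∂ 3) x₀).symm)
      (range (𝓡∂ 3)) y :=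
  contDiffWithinAt_ext_coord_change x x₀ (by
    rw [PartialEquiv.trans_source, PartialEquiv.symm_source]; exact ⟨hy, hx⟩)

/-- The inverse chart factors through the other one near `y` within the model range. Uniqueness of
derivatives within this range turns the factorization into the pullback formula. -/
theorem formInChart_transition {k : ℕ} (α : DForm k M) (x₀ x : M) {y : E3}
    (hy : y ∈ (extChartAt (𝓡∂ 3) x₀).target)
    (hx : (extChartAt (𝓡∂ 3) x₀).symm y ∈ (extChartAt (𝓡∂ 3) x).source) :
    formInChart α x₀ y = (formInChart α x (extChartAt (𝓡∂ 3) x ((extChartAt (𝓡∂ 3) x₀).symm y))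
      ).compContinuousLinearMap (fderivWithin ℝ
        (extChartAt (𝓡∂ 3) x ∘ (extChartAt (𝓡∂ 3) x₀).symm) (range (𝓡∂ 3)) y) := by
  set φ := extChartAt (𝓡∂ 3) x₀
  set φ' := extChartAt (𝓡∂ 3) x
  set τ : E3 → E3 := φ' ∘ φ.symm with hτ
  have h1 : φ'.symm (τ y) = φ.symm y := φ'.left_inv hx
  have hyr : y ∈ range (𝓡∂ 3) := extChartAt_target_subset_range x₀ hy
  have hτT : τ y ∈ φ'.target := φ'.map_source hx
  have d1 : HasMFDerivWithinAt 𝓘(ℝ, E3) 𝓘(ℝ, E3) τ (range (𝓡∂ 3)) y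
      (fderivWithin ℝ τ (range (𝓡∂ 3)) y) :=
    ((contMDiffWithinAt_transition x₀ x hy hx).differentiableWithinAt
      (by simp)).hasFDerivWithinAt.hasMFDerivWithinAt
  have d2 : HasMFDerivWithinAt 𝓘(ℝ, E3) (𝓡∂ 3) φ'.symm (range (𝓡∂ 3)) (τ y)
      (mfderivWithin 𝓘(ℝ, E3) (𝓡∂ 3) φ'.symm (range (𝓡∂ 3)) (τ y)) :=
    ((contMDiffWithinAt_extChartAt_symm_range (n := ∞) x hτT).mdifferentiableWithinAt
      (by simp)).hasMFDerivWithinAt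
  have d3 := d2.comp y d1 (fun z _ => mem_range_self (f := 𝓡∂ 3) _)
  have hev : φ.symm =ᶠ[𝓝[range (𝓡∂ 3)] y] φ'.symm ∘ τ := by
    have hT : φ.target ∈ 𝓝[range (𝓡∂ 3)] y := extChartAt_target_mem_nhdsWithin_of_mem hy
    have hc : ContinuousWithinAt φ.symm (range (𝓡∂ 3)) y :=
      (contMDiffWithinAt_extChartAt_symm_range (n := ∞) x₀ hy).continuousWithinAt
    filter_upwards [hc.preimage_mem_nhdsWithin ((isOpen_extChartAt_source x).mem_nhds hx)] with z hz
    exact (φ'.left_inv hz).symm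
  have d4 := d3.congr_of_eventuallyEq hev h1.symm
  have d5 := d4.mfderivWithin (uniqueDiffOn_range_model.uniqueMDiffOn y hyr)
  have e1 : (α (φ'.symm (τ y)) : E3 [⋀^Fin k]→L[ℝ] ℝ) = α (φ.symm y) := by rw [h1]
  change (α (φ.symm y)).compContinuousLinearMap _ = _
  rw [d5]
  change (α (φ.symm y) : E3 [⋀^Fin k]→L[ℝ] ℝ).compContinuousLinearMap _ =
    ((α (φ'.symm (τ y)) : E3 [⋀^Fin k]→L[ℝ] ℝ).compContinuousLinearMap _).compContinuousLinearMap _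
  rw [e1]
  rfl

/-- `extD` evaluates the exterior derivative at each point in the chart centred there. Naturality of
the exterior derivative under the change of charts carries its vanishing to a single chart around
`x₀`. -/
theorem extDerivWithin_formInChart_eq_zero {k : ℕ} {α : DForm k M} (hα : SmoothForm α)
    (hc : ∀ x, extD α x = 0) (x₀ : M) {y : E3} (hy : y ∈ (extChartAt (𝓡∂ 3) x₀).target) :
    extDerivWithin (formInChart α x₀) (range (𝓡∂ 3)) y = 0 := by
  set φ := extChartAt (𝓡∂ 3) x₀
  set x := φ.symm y with hxdef
  have hx : x ∈ (extChartAt (𝓡∂ 3) x).source := mem_extChartAt_source x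
  have hyr : y ∈ range (𝓡∂ 3) := extChartAt_target_subset_range x₀ hy
  have key : extDerivWithin (formInChart α x) (range (𝓡∂ 3)) (extChartAt (𝓡∂ 3) x x) = 0 := by
    have h1 := hc x
    ext v
    have h2 := isInvertible_mfderiv_extChartAt (I := 𝓡∂ 3) hx
    obtain ⟨e, he⟩ := h2
    have h3 := congrArg (fun T => T (fun i => e.symm (v i))) h1
    simp only [extD] at h3
    rw [← he] at h3
    have h4 : extDerivWithin (formInChart α x) (range (𝓡∂ 3)) (extChartAt (𝓡∂ 3) x x)
        (fun i => e (e.symm (v i))) = 0 := h3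
    have h5 : (fun i => e (e.symm (v i))) = v := funext fun i => e.apply_symm_apply (v i)
    exact (congrArg (extDerivWithin (formInChart α x) (range (𝓡∂ 3))
      (extChartAt (𝓡∂ 3) x x)) h5).symm.trans h4
  have hev : formInChart α x₀ =ᶠ[𝓝[range (𝓡∂ 3)] y] fun y' =>
      (formInChart α x ((extChartAt (𝓡∂ 3) x ∘ φ.symm) y')).compContinuousLinearMap
        (fderivWithin ℝ (extChartAt (𝓡∂ 3) x ∘ φ.symm) (range (𝓡∂ 3)) y') := by
    have hc : ContinuousWithinAt φ.symm (range (𝓡∂ 3)) y :=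
      (contMDiffWithinAt_extChartAt_symm_range (n := ∞) x₀ hy).continuousWithinAt
    filter_upwards [hc.preimage_mem_nhdsWithin ((isOpen_extChartAt_source x).mem_nhds hx),
      extChartAt_target_mem_nhdsWithin_of_mem hy] with z hz hzT
    exact formInChart_transition α x₀ x hzT hz
  rw [hev.extDerivWithin_eq_of_mem hyr, extDerivWithin_pullback (r := ∞) (t := range (𝓡∂ 3))
    (f := extChartAt (𝓡∂ 3) x ∘ φ.symm) (hα.differentiableWithinAt x (mem_extChartAt_target x))
    (contMDiffWithinAt_transition x₀ x hy hx) two_le_infty uniqueDiffOn_range_model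
    (mem_closure_interior_range_model hyr) hyr (fun z _ => mem_range_self (f := 𝓡∂ 3) _)]
  change (extDerivWithin (formInChart α x) (range (𝓡∂ 3)) (extChartAt (𝓡∂ 3) x x)
    ).compContinuousLinearMap _ = 0
  rw [key]
  ext v
  rfl

/-- For a one-form the exterior derivative is the antisymmetrized derivative. Symmetry is the form
in which closedness enters the Poincaré lemma. -/
theorem covectorInChart_symmetric {α : DForm 1 M} (hα : SmoothForm α)
    (hc : ∀ x, extD α x = 0) (x₀ : M) {y : E3} (hy : y ∈ (extChartAt (𝓡∂ 3) x₀).target)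
    (v w : E3) : fderivWithin ℝ (covectorInChart α x₀) (range (𝓡∂ 3)) y v w =
      fderivWithin ℝ (covectorInChart α x₀) (range (𝓡∂ 3)) y w v := by
  have hyr : y ∈ range (𝓡∂ 3) := extChartAt_target_subset_range x₀ hy
  have h1 := extDerivWithin_formInChart_eq_zero hα hc x₀ hy
  have hd := hα.differentiableWithinAt x₀ hy
  set J := (ContinuousAlternatingMap.ofSubsingletonLIE (𝕜 := ℝ) (E := E3) (F := ℝ) (0 : Fin 1))
  have h2 : fderivWithin ℝ (covectorInChart α x₀) (range (𝓡∂ 3)) y =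
      (J.symm.toContinuousLinearEquiv : _ →L[ℝ] _).comp
        (fderivWithin ℝ (formInChart α x₀) (range (𝓡∂ 3)) y) :=
    (J.symm.toContinuousLinearEquiv.hasFDerivAt.comp_hasFDerivWithinAt y
      hd.hasFDerivWithinAt).fderivWithin (uniqueDiffOn_range_model y hyr)
  have h3 : ∀ a b, fderivWithin ℝ (covectorInChart α x₀) (range (𝓡∂ 3)) y a b =
      fderivWithin ℝ (formInChart α x₀) (range (𝓡∂ 3)) y a ![b] := by
    intro a b
    rw [h2]
    obtain ⟨f, hf⟩ := J.surjective (fderivWithin ℝ (formInChart α x₀) (range (𝓡∂ 3)) y a)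
    have : ((J.symm.toContinuousLinearEquiv : _ →L[ℝ] _).comp
        (fderivWithin ℝ (formInChart α x₀) (range (𝓡∂ 3)) y)) a =
        J.symm (fderivWithin ℝ (formInChart α x₀) (range (𝓡∂ 3)) y a) := rfl
    rw [this, ← hf, LinearIsometryEquiv.symm_apply_apply]
    rfl
  have h4 := congrArg (fun T => T ![v, w]) h1
  simp only [extDerivWithin, ContinuousAlternatingMap.alternatizeUncurryFin_apply] at h4
  change ∑ i : Fin 2, _ = (0 : ℝ) at h4
  rw [Fin.sum_univ_two] at h4
  rw [h3, h3]
  have e1 : Fin.removeNth (0 : Fin 2) ![v, w] = ![w] := by ext i; fin_cases i; rfl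
  have e2 : Fin.removeNth (1 : Fin 2) ![v, w] = ![v] := by ext i; fin_cases i; rfl
  rw [e1, e2] at h4
  simpa [← sub_eq_add_neg, sub_eq_zero] using h4

end ChartTransfer
-- Vector fields in charts
section FieldTransfer

universe u

variable {M : Type u} [TopologicalSpace M] [ChartedSpace (EuclideanHalfSpace 3) M]
  [IsManifold (𝓡∂ 3) ∞ M]

theorem isManifold_one : IsManifold (𝓡∂ 3) 1 M := IsManifold.of_le (n := ∞) (by simp)

theorem mfderiv_extChartAt_apply_field (X : VField M) (x₀ : M) {x : M}
    (hx : x ∈ (extChartAt (𝓡∂ 3) x₀).source) :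
    mfderiv (𝓡∂ 3) 𝓘(ℝ, E3) (extChartAt (𝓡∂ 3) x₀) x (X x) =
      fieldInChart X x₀ (extChartAt (𝓡∂ 3) x₀ x) := by
  have : IsManifold (𝓡∂ 3) 1 M := isManifold_one
  set φ := extChartAt (𝓡∂ 3) x₀
  have hy : φ x ∈ φ.target := φ.map_source hx
  have h2 := mfderivWithin_extChartAt_symm_comp_mfderiv_extChartAt (I := 𝓡∂ 3) hy
  have h3 := mfderiv_extChartAt_comp_mfderivWithin_extChartAt_symm (I := 𝓡∂ 3) hy
  have hinv : ContinuousLinearMap.inverse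
      (mfderivWithin 𝓘(ℝ, E3) (𝓡∂ 3) φ.symm (range (𝓡∂ 3)) (φ x)) =
      mfderiv (𝓡∂ 3) 𝓘(ℝ, E3) φ (φ.symm (φ x)) :=
    ContinuousLinearMap.inverse_eq h2 h3
  have h4 : φ.symm (φ x) = x := φ.left_inv hx
  change _ = ContinuousLinearMap.inverse
      (mfderivWithin 𝓘(ℝ, E3) (𝓡∂ 3) φ.symm (range (𝓡∂ 3)) (φ x)) (X (φ.symm (φ x)))
  rw [hinv, h4]

theorem mfderivWithin_fieldInChart (X : VField M) (x₀ : M) {y : E3}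
    (hy : y ∈ (extChartAt (𝓡∂ 3) x₀).target) :
    mfderivWithin 𝓘(ℝ, E3) (𝓡∂ 3) (extChartAt (𝓡∂ 3) x₀).symm (range (𝓡∂ 3)) y
      (fieldInChart X x₀ y) = X ((extChartAt (𝓡∂ 3) x₀).symm y) := by
  have : IsManifold (𝓡∂ 3) 1 M := isManifold_one
  obtain ⟨e, he⟩ := isInvertible_mfderivWithin_extChartAt_symm (I := 𝓡∂ 3) hy
  change mfderivWithin 𝓘(ℝ, E3) (𝓡∂ 3) (extChartAt (𝓡∂ 3) x₀).symm (range (𝓡∂ 3)) y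
    (ContinuousLinearMap.inverse (mfderivWithin 𝓘(ℝ, E3) (𝓡∂ 3) (extChartAt (𝓡∂ 3) x₀).symm
      (range (𝓡∂ 3)) y) (X ((extChartAt (𝓡∂ 3) x₀).symm y))) = _
  rw [← he, ContinuousLinearMap.inverse_equiv]
  exact e.apply_symm_apply _

theorem covectorInChart_mfderiv (α : DForm 1 M) (x₀ : M) {x : M}
    (hx : x ∈ (extChartAt (𝓡∂ 3) x₀).source) (v : TangentSpace (𝓡∂ 3) x) :
    covectorInChart α x₀ (extChartAt (𝓡∂ 3) x₀ x)
      (mfderiv (𝓡∂ 3) 𝓘(ℝ, E3) (extChartAt (𝓡∂ 3) x₀) x v) = α x ![v] := by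
  have : IsManifold (𝓡∂ 3) 1 M := isManifold_one
  set φ := extChartAt (𝓡∂ 3) x₀
  have hy : φ x ∈ φ.target := φ.map_source hx
  have h2 := mfderivWithin_extChartAt_symm_comp_mfderiv_extChartAt' (I := 𝓡∂ 3) hx
  have h4 : φ.symm (φ x) = x := φ.left_inv hx
  refine (covectorInChart_apply α x₀ (φ x) _).trans ?_
  have e1 : (α (φ.symm (φ x)) : E3 [⋀^Fin 1]→L[ℝ] ℝ) = α x := by rw [h4]
  have h5 : mfderivWithin 𝓘(ℝ, E3) (𝓡∂ 3) φ.symm (range (𝓡∂ 3)) (φ x)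
    (mfderiv (𝓡∂ 3) 𝓘(ℝ, E3) φ x v) = v := by
    exact congrArg (fun T => T v) h2
  change (α (φ.symm (φ x)) : E3 [⋀^Fin 1]→L[ℝ] ℝ) (fun i => mfderivWithin 𝓘(ℝ, E3) (𝓡∂ 3) φ.symm
    (range (𝓡∂ 3)) (φ x) (![mfderiv (𝓡∂ 3) 𝓘(ℝ, E3) φ x v] i)) = _
  rw [e1]
  congr 1
  funext i
  fin_cases i
  exact h5

theorem covectorInChart_fieldInChart (α : DForm 1 M) (X : VField M) (x₀ : M) {y : E3}
    (hy : y ∈ (extChartAt (𝓡∂ 3) x₀).target) :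
    covectorInChart α x₀ y (fieldInChart X x₀ y) = α ((extChartAt (𝓡∂ 3) x₀).symm y)
      ![X ((extChartAt (𝓡∂ 3) x₀).symm y)] := by
  set φ := extChartAt (𝓡∂ 3) x₀
  have h1 := covectorInChart_mfderiv α x₀ (φ.map_target hy) (X (φ.symm y))
  rw [mfderiv_extChartAt_apply_field X x₀ (φ.map_target hy)] at h1
  change covectorInChart α x₀ (φ (φ.symm y)) (fieldInChart X x₀ (φ (φ.symm y))) = _ at h1
  rwa [φ.right_inv hy] at h1

theorem contDiffOn_fieldInChart {X : VField M} {U : Set M} (hU : IsOpen U)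
    (hX : SmoothVFieldOn X U) (x₀ : M) :
    ContDiffOn ℝ ∞ (fieldInChart X x₀)
      ((extChartAt (𝓡∂ 3) x₀).target ∩ (extChartAt (𝓡∂ 3) x₀).symm ⁻¹' U) := by
  have : IsManifold (𝓡∂ 3) 1 M := isManifold_one
  intro y hy
  refine contMDiffWithinAt_vectorSpace_iff_contDiffWithinAt.1 ?_
  have hyr : y ∈ range (𝓡∂ 3) := extChartAt_target_subset_range x₀ hy.1
  have h1 := contMDiffWithinAt_extChartAt_symm_range (n := ∞) x₀ hy.1
  refine (ContMDiffWithinAt.mpullbackWithin_vectorField_of_mem (n := ∞) (t := U) (s := range (𝓡∂ 3))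
    (hX _ hy.2) h1 (isInvertible_mfderivWithin_extChartAt_symm hy.1) hyr
    uniqueDiffOn_range_model.uniqueMDiffOn (by simp) ?_).mono
    (fun z hz => extChartAt_target_subset_range x₀ hz.1)
  exact h1.continuousWithinAt.preimage_mem_nhdsWithin (hU.mem_nhds hy.2)

/-- The bracket is natural under pullback by the inverse chart. -/
theorem lieBracketWithin_fieldInChart_eq_zero {X X' : VField M} {U : Set M} (hU : IsOpen U)
    (hX : SmoothVFieldOn X U) (hX' : SmoothVFieldOn X' U)
    (hbr : ∀ x ∈ U, mlieBracket (𝓡∂ 3) X X' x = 0) (x₀ : M) {y : E3}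
    (hy : y ∈ (extChartAt (𝓡∂ 3) x₀).target) (hyU : (extChartAt (𝓡∂ 3) x₀).symm y ∈ U) :
    lieBracketWithin ℝ (fieldInChart X x₀) (fieldInChart X' x₀) (range (𝓡∂ 3)) y = 0 := by
  have : IsManifold (𝓡∂ 3) 1 M := isManifold_one
  have : IsManifold (𝓡∂ 3) (minSmoothness ℝ 2) M := IsManifold.of_le (n := ∞) two_le_infty
  have : IsManifold (𝓡∂ 3) (minSmoothness ℝ 3) M := IsManifold.of_le (n := ∞) (by
    rw [minSmoothness_of_isRCLikeNormedField]
    exact WithTop.coe_le_coe.2 (le_top : (3 : ℕ∞) ≤ ⊤))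
  have hyr : y ∈ range (𝓡∂ 3) := extChartAt_target_subset_range x₀ hy
  have h1 := contMDiffWithinAt_extChartAt_symm_range (n := ∞) (I := 𝓡∂ 3) x₀ hy
  have h2 := mpullbackWithin_mlieBracketWithin (n := ∞) (I := 𝓘(ℝ, E3)) (I' := 𝓡∂ 3)
    (V := X) (W := X') (t := U) (s := range (𝓡∂ 3)) (x₀ := y)
    ((hX _ hyU).mdifferentiableWithinAt (by simp)) ((hX' _ hyU).mdifferentiableWithinAt (by simp))
    uniqueDiffOn_range_model.uniqueMDiffOn h1 hyr two_le_infty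
    (h1.continuousWithinAt.preimage_mem_nhdsWithin (hU.mem_nhds hyU))
    (mem_closure_interior_range_model hyr)
  rw [mlieBracketWithin_eq_lieBracketWithin] at h2
  refine h2.symm.trans ?_
  rw [mpullbackWithin_apply, mlieBracketWithin_of_isOpen hU hyU, hbr _ hyU]
  exact map_zero _

end FieldTransfer
-- Boundary points and the half-space model
section Boundary

universe u

variable {M : Type u} [TopologicalSpace M] [ChartedSpace (EuclideanHalfSpace 3) M]

theorem extChartAt_self_zero_of_boundary {x : M} (hx : x ∈ (𝓡∂ 3).boundary M) :
    extChartAt (𝓡∂ 3) x x 0 = 0 := by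
  have h1 : extChartAt (𝓡∂ 3) x x ∈ frontier (range (𝓡∂ 3)) := hx
  rw [frontier_range_modelWithCornersEuclideanHalfSpace] at h1
  exact Eq.symm h1

variable [IsManifold (𝓡∂ 3) ∞ M]

theorem mem_range_model {y : E3} : y ∈ range (𝓡∂ 3) ↔ 0 ≤ y 0 := by
  rw [range_modelWithCornersEuclideanHalfSpace]; rfl

theorem isBoundaryPoint_of_extChartAt_zero (x₀ : M) {y : E3}
    (hy : y ∈ (extChartAt (𝓡∂ 3) x₀).target) (hy0 : y 0 = 0) :
    (extChartAt (𝓡∂ 3) x₀).symm y ∈ (𝓡∂ 3).boundary M := by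
  change (𝓡∂ 3).IsBoundaryPoint _
  rw [ModelWithCorners.isBoundaryPoint_iff_of_mem_atlas (n := ∞) (I := 𝓡∂ 3) (by simp)
    (chart_mem_atlas _ x₀) (by
      rw [← extChartAt_source (𝓡∂ 3)]; exact (extChartAt (𝓡∂ 3) x₀).map_target hy)]
  change extChartAt (𝓡∂ 3) x₀ ((extChartAt (𝓡∂ 3) x₀).symm y) ∈
    frontier (extChartAt (𝓡∂ 3) x₀).target
  rw [(extChartAt (𝓡∂ 3) x₀).right_inv hy, frontier, Set.mem_sdiff]
  refine ⟨subset_closure hy, fun h => ?_⟩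
  have h1 := interior_mono (extChartAt_target_subset_range (I := 𝓡∂ 3) x₀) h
  rw [interior_range_modelWithCornersEuclideanHalfSpace] at h1
  exact absurd hy0 (ne_of_gt h1)

/-- The coordinate of the chart at $x$ which defines tangency is nonnegative and vanishes at the
boundary point $x$. Along a line in the wall of the chart around `x₀` it has a minimum at $x$, so
its derivative there is zero. -/
theorem tangentToBoundary_mfderivWithin (x₀ : M) {y : E3}
    (hy : y ∈ (extChartAt (𝓡∂ 3) x₀).target) (hy0 : y 0 = 0) {v : E3} (hv : v 0 = 0) :
    TangentToBoundary ((extChartAt (𝓡∂ 3) x₀).symm y)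
      (mfderivWithin 𝓘(ℝ, E3) (𝓡∂ 3) (extChartAt (𝓡∂ 3) x₀).symm (range (𝓡∂ 3)) y v) := by
  set φ := extChartAt (𝓡∂ 3) x₀
  set x := φ.symm y with hx
  have hyr : y ∈ range (𝓡∂ 3) := extChartAt_target_subset_range x₀ hy
  have hbd := isBoundaryPoint_of_extChartAt_zero x₀ hy hy0
  have h0 : extChartAt (𝓡∂ 3) x x 0 = 0 := extChartAt_self_zero_of_boundary hbd
  set h : M → ℝ := fun z => extChartAt (𝓡∂ 3) x z 0 with hh
  have hmd : MDifferentiableAt (𝓡∂ 3) 𝓘(ℝ, ℝ) h x := by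
    have h1 : MDifferentiableAt (𝓡∂ 3) 𝓘(ℝ, E3) (extChartAt (𝓡∂ 3) x) x :=
      (contMDiffAt_extChartAt (n := ∞)).mdifferentiableAt (by simp)
    exact ((EuclideanSpace.proj (𝕜 := ℝ) (0 : Fin 3)).differentiableAt.mdifferentiableAt).comp x h1
  have d1 : HasMFDerivWithinAt 𝓘(ℝ, E3) (𝓡∂ 3) φ.symm (range (𝓡∂ 3)) y
      (mfderivWithin 𝓘(ℝ, E3) (𝓡∂ 3) φ.symm (range (𝓡∂ 3)) y) :=
    ((contMDiffWithinAt_extChartAt_symm_range (n := ∞) x₀ hy).mdifferentiableWithinAt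
      (by simp)).hasMFDerivWithinAt
  have d2 := hmd.hasMFDerivAt.comp_hasMFDerivWithinAt y d1
  have d3 := d2.hasFDerivWithinAt
  set T : E3 →L[ℝ] ℝ := (mfderiv (𝓡∂ 3) 𝓘(ℝ, ℝ) h x).comp
    (mfderivWithin 𝓘(ℝ, E3) (𝓡∂ 3) φ.symm (range (𝓡∂ 3)) y) with hT
  have d4 : HasDerivAt (fun t : ℝ => y + t • v) v 0 := by
    have := ((hasDerivAt_id (0 : ℝ)).smul_const v).const_add y
    rwa [one_smul] at this
  have hm : MapsTo (fun t : ℝ => y + t • v) univ (range (𝓡∂ 3)) := by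
    intro t _
    rw [mem_range_model]
    simp [hy0, hv]
  have d5 : HasDerivWithinAt (fun t : ℝ => h (φ.symm (y + t • v))) (T v) univ 0 := by
    have e0 : y + (0 : ℝ) • v = y := by simp
    have d3' : HasFDerivWithinAt (h ∘ φ.symm) T (range (𝓡∂ 3)) (y + (0 : ℝ) • v) := by
      rw [e0]; exact d3
    exact d3'.comp_hasDerivWithinAt 0 d4.hasDerivWithinAt hm
  rw [hasDerivWithinAt_univ] at d5
  have hmin : IsLocalMin (fun t : ℝ => h (φ.symm (y + t • v))) 0 := by
    refine Eventually.of_forall fun t => ?_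
    simp only [zero_smul, add_zero]
    have e1 : h (φ.symm y) = 0 := h0
    rw [e1]
    exact mem_range_model.1 (mem_range_self (f := 𝓡∂ 3) _)
  have d6 := hmin.hasDerivAt_eq_zero d5
  exact d6

theorem covectorInChart_eq_zero_of_boundary {B : VField M} {ν : DForm 1 M} {μ : DForm 3 M}
    (hflux : IsTangentialFluxSystem B ν μ) (x₀ : M) {y : E3}
    (hy : y ∈ (extChartAt (𝓡∂ 3) x₀).target) (hy0 : y 0 = 0) {v : E3} (hv : v 0 = 0) :
    covectorInChart ν x₀ y v = 0 := by
  have h1 := hflux.tangent_ν _ (isBoundaryPoint_of_extChartAt_zero x₀ hy hy0) _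
    (tangentToBoundary_mfderivWithin x₀ hy hy0 hv)
  rw [covectorInChart_apply, ← h1]
  change (ν ((extChartAt (𝓡∂ 3) x₀).symm y) : E3 [⋀^Fin 1]→L[ℝ] ℝ) _ =
    (ν ((extChartAt (𝓡∂ 3) x₀).symm y) : E3 [⋀^Fin 1]→L[ℝ] ℝ) _
  congr 1
  funext i
  fin_cases i
  rfl

/-- Interior and boundary points become one case: near `y` the model is a half-space with `y` on its
wall, where the zero form stands for the absence of a wall. -/
theorem exists_halfSpace_model {y : E3} (hy : y ∈ range (𝓡∂ 3)) :
    ∃ (l : E3 →L[ℝ] ℝ) (e : E3), (l = 0 ∨ l e = 1) ∧ l y = 0 ∧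
      (l ≠ 0 → ∀ v, l v = 0 → v 0 = 0) ∧
      ∃ N : Set E3, IsOpen N ∧ y ∈ N ∧ halfSpace l ∩ N = range (𝓡∂ 3) ∩ N := by
  rcases (mem_range_model.1 hy).eq_or_lt with h | h
  · refine ⟨EuclideanSpace.proj 0, EuclideanSpace.single 0 1, Or.inr (by simp), h.symm,
      fun _ v hv => hv, univ, isOpen_univ, mem_univ _, ?_⟩
    ext z
    simp only [inter_univ, mem_range_model]
    rfl
  · refine ⟨0, 0, Or.inl rfl, rfl, fun h => absurd rfl h, {z | 0 < z 0},
      isOpen_lt continuous_const (by fun_prop), h, ?_⟩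
    ext z
    simp only [mem_inter_iff, mem_range_model, mem_halfSpace]
    exact ⟨fun hz => ⟨(show 0 < z 0 from hz.2).le, hz.2⟩, fun hz => ⟨le_rfl, hz.2⟩⟩

end Boundary

/-! ### Pointwise consequences of the flux equation -/

section FluxAlgebra

universe u

variable {M : Type u} [TopologicalSpace M] [ChartedSpace (EuclideanHalfSpace 3) M]
  {B u : VField M} {ν : DForm 1 M} {μ : DForm 3 M} {x : M}

theorem flux_apply (h : interiorProd u (interiorProd B μ) x = ν x)
    (v : TangentSpace (𝓡∂ 3) x) : ν x ![v] = μ x ![B x, u x, v] := by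
  rw [← h]; rfl

theorem flux_u (h : interiorProd u (interiorProd B μ) x = ν x) : ν x ![u x] = 0 := by
  rw [flux_apply h]
  exact (μ x).map_eq_zero_of_eq ![B x, u x, u x] (i := 1) (j := 2) rfl (by decide)

/-- Choose $v$ with $\mu(B,u,v)=\nu(v)\neq 0$. Putting the vanishing combination in place of $B$,
respectively of $u$, isolates one coefficient at a time. -/
theorem linearIndependent_of_flux (h : interiorProd u (interiorProd B μ) x = ν x) (hν : ν x ≠ 0)
    {s t : ℝ} (hst : s • B x + t • u x = 0) : s = 0 ∧ t = 0 := by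
  obtain ⟨v, hv⟩ : ∃ v : TangentSpace (𝓡∂ 3) x, ν x ![v] ≠ 0 := by
    by_contra! hc
    apply hν
    ext w
    have : w = ![w 0] := by ext i; fin_cases i; rfl
    rw [this]
    exact hc _
  rw [flux_apply h] at hv
  have hzero : ∀ a : TangentSpace (𝓡∂ 3) x, μ x ![0, a, v] = 0 := fun a =>
    (μ x).map_coord_zero (m := ![0, a, v]) 0 rfl
  have hzero' : ∀ a : TangentSpace (𝓡∂ 3) x, μ x ![a, 0, v] = 0 := fun a =>
    (μ x).map_coord_zero (m := ![a, 0, v]) 1 rfl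
  have huu : μ x ![u x, u x, v] = 0 :=
    (μ x).map_eq_zero_of_eq ![u x, u x, v] (i := 0) (j := 1) rfl (by decide)
  have hBB : μ x ![B x, B x, v] = 0 :=
    (μ x).map_eq_zero_of_eq ![B x, B x, v] (i := 0) (j := 1) rfl (by decide)
  constructor
  · have h1 := hzero (u x)
    rw [← hst] at h1
    have e1 : μ x ![s • B x + t • u x, u x, v] = s * μ x ![B x, u x, v] +
        t * μ x ![u x, u x, v] := by
      have a1 := (μ x).cons_add ![u x, v] (s • B x) (t • u x)
      have a2 := (μ x).cons_smul ![u x, v] s (B x)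
      have a3 := (μ x).cons_smul ![u x, v] t (u x)
      exact a1.trans (congrArg₂ (· + ·) a2 a3)
    rw [e1, huu, mul_zero, add_zero] at h1
    exact (mul_eq_zero.1 h1).resolve_right hv
  · have h1 := hzero' (B x)
    rw [← hst] at h1
    have e1 : μ x ![B x, s • B x + t • u x, v] = s * μ x ![B x, B x, v] +
        t * μ x ![B x, u x, v] := by
      have hup : ∀ a : TangentSpace (𝓡∂ 3) x,
          ![B x, a, v] = Function.update ![B x, 0, v] 1 a := by
        intro a
        ext i
        fin_cases i <;> rfl
      have a1 := (μ x).map_update_add ![B x, 0, v] 1 (s • B x) (t • u x)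
      have a2 := (μ x).map_update_smul ![B x, 0, v] 1 s (B x)
      have a3 := (μ x).map_update_smul ![B x, 0, v] 1 t (u x)
      rw [hup, hup (B x), hup (u x)]
      exact a1.trans (congrArg₂ (· + ·) a2 a3)
    rw [e1, hBB, mul_zero, zero_add] at h1
    exact (mul_eq_zero.1 h1).resolve_right hv

end FluxAlgebra
-- Flow boxes
/-- The plane of the leaf directions. -/
abbrev V2 : Type := ℝ × ℝ

/-- The domain of a flow box. -/
def boxDomain (k r : ℝ) : Set (V2 × ℝ) := halfSpace (lastForm V2 k) ∩ ball 0 r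

section FlowBox

universe u

variable {M : Type u} [TopologicalSpace M] [ChartedSpace (EuclideanHalfSpace 3) M]

/-- A chart centred at `x`, onto a box in a half-space of `ℝ² × ℝ`, in which `B` and `u` are the
first two coordinate fields and `ν` is, up to sign, the differential of the last coordinate. -/
structure FlowBox (B u : VField M) (ν : DForm 1 M) (x : M) where
  /-- The sign relating `ν` and the last coordinate. -/
  σ : ℝ
  /-- The domain is contained in the half-space `0 ≤ k z`. -/
  k : ℝ
  /-- The radius. -/
  r : ℝ
  /-- The neighbourhood. -/
  W : Set M
  /-- The chart. -/
  χ : M → V2 × ℝ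
  /-- The inverse of the chart. -/
  c : V2 × ℝ → M
  sign : σ = 1 ∨ σ = -1
  r_pos : 0 < r
  isOpen : IsOpen W
  mem : x ∈ W
  χ_self : χ x = 0
  χ_mem : ∀ y ∈ W, χ y ∈ boxDomain k r
  c_mem : ∀ q ∈ boxDomain k r, c q ∈ W
  c_χ : ∀ y ∈ W, c (χ y) = y
  χ_c : ∀ q ∈ boxDomain k r, χ (c q) = q
  smooth_χ : ContMDiffOn (𝓡∂ 3) 𝓘(ℝ, V2 × ℝ) ∞ χ W
  smooth_c : ContMDiffOn 𝓘(ℝ, V2 × ℝ) (𝓡∂ 3) ∞ c (boxDomain k r)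
  deriv_B : ∀ y ∈ W, mfderiv (𝓡∂ 3) 𝓘(ℝ, V2 × ℝ) χ y (B y) = (((1, 0), 0) : V2 × ℝ)
  deriv_u : ∀ y ∈ W, mfderiv (𝓡∂ 3) 𝓘(ℝ, V2 × ℝ) χ y (u y) = (((0, 1), 0) : V2 × ℝ)
  deriv_z : ∀ y ∈ W, ∀ v : TangentSpace (𝓡∂ 3) y,
    (show V2 × ℝ from mfderiv (𝓡∂ 3) 𝓘(ℝ, V2 × ℝ) χ y v).2 = σ * ν y ![v]

/-- The linear map of the leaf plane determined by two vectors. -/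
noncomputable def frameMap {E : Type*} [NormedAddCommGroup E] [NormedSpace ℝ E] (X Y : E → E)
    (y : E) : V2 →L[ℝ] E :=
  ContinuousLinearMap.smulRightL ℝ V2 E (ContinuousLinearMap.fst ℝ ℝ ℝ) (X y) +
    ContinuousLinearMap.smulRightL ℝ V2 E (ContinuousLinearMap.snd ℝ ℝ ℝ) (Y y)

theorem frameMap_apply {E : Type*} [NormedAddCommGroup E] [NormedSpace ℝ E] (X Y : E → E)
    (y : E) (c : V2) : frameMap X Y y c = c.1 • X y + c.2 • Y y := by
  simp [frameMap]

/-- The left side is $\sum_{i,j}c_id_j\,DX_j(X_i)$ for $X_1=X$ and $X_2=Y$. The vanishing bracket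
makes $DX_j(X_i)$ symmetric in $i$ and $j$. -/
theorem fderivWithin_frameMap_comm {E : Type*} [NormedAddCommGroup E] [NormedSpace ℝ E]
    {X Y : E → E} {s : Set E} {y : E} (hs : UniqueDiffWithinAt ℝ s y)
    (hX : DifferentiableWithinAt ℝ X s y) (hY : DifferentiableWithinAt ℝ Y s y)
    (hbr : lieBracketWithin ℝ Y X s y = 0) (c d : V2) :
    fderivWithin ℝ (frameMap X Y) s y (frameMap X Y y c) d =
      fderivWithin ℝ (frameMap X Y) s y (frameMap X Y y d) c := by
  have h1 : HasFDerivWithinAt (frameMap X Y)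
      ((ContinuousLinearMap.smulRightL ℝ V2 E (ContinuousLinearMap.fst ℝ ℝ ℝ)).comp
        (fderivWithin ℝ X s y) +
      (ContinuousLinearMap.smulRightL ℝ V2 E (ContinuousLinearMap.snd ℝ ℝ ℝ)).comp
        (fderivWithin ℝ Y s y)) s y :=
    ((ContinuousLinearMap.smulRightL ℝ V2 E
      (ContinuousLinearMap.fst ℝ ℝ ℝ)).hasFDerivAt.comp_hasFDerivWithinAt y
        hX.hasFDerivWithinAt).add
      ((ContinuousLinearMap.smulRightL ℝ V2 E
        (ContinuousLinearMap.snd ℝ ℝ ℝ)).hasFDerivAt.comp_hasFDerivWithinAt y hY.hasFDerivWithinAt)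
  have h2 : fderivWithin ℝ X s y (Y y) = fderivWithin ℝ Y s y (X y) := sub_eq_zero.1 hbr
  rw [h1.fderivWithin hs]
  simp only [frameMap_apply, _root_.add_apply, ContinuousLinearMap.comp_apply, map_add, map_smul,
    ContinuousLinearMap.smulRightL_apply_apply, ContinuousLinearMap.smulRight_apply,
    _root_.smul_apply, ContinuousLinearMap.coe_fst', ContinuousLinearMap.coe_snd', h2]
  module

variable [IsManifold (𝓡∂ 3) ∞ M]

/-- `exists_local_normal_form` applied in a manifold chart, with the half-space replacing the model
range near the point. Closedness of $\nu$, its vanishing along the boundary and the commutation of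
$u$ and $B$ supply the hypotheses. -/
theorem exists_flowBox {B u : VField M} {ν : DForm 1 M} {μ : DForm 3 M}
    (hflux : IsTangentialFluxSystem B ν μ) {S U : Set M} (hu : IsFluxFieldOn B ν μ S U u)
    (hbr : ∀ x ∈ U, mlieBracket (𝓡∂ 3) u B x = 0) {x₀ : M} (hx₀ : x₀ ∈ U) (hν : ν x₀ ≠ 0)
    {U' : Set M} (hU' : IsOpen U') (hx₀' : x₀ ∈ U') :
    ∃ b : FlowBox B u ν x₀, b.W ⊆ U' := by
  have : IsManifold (𝓡∂ 3) 1 M := isManifold_one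
  set φ := extChartAt (𝓡∂ 3) x₀ with hφ
  set y := φ x₀ with hy
  have hyT : y ∈ φ.target := mem_extChartAt_target x₀
  have hyr : y ∈ range (𝓡∂ 3) := extChartAt_target_subset_range x₀ hyT
  obtain ⟨l, e, he, hly, hlv, N₁, hN₁, hyN₁, hlN⟩ := exists_halfSpace_model hyr
  obtain ⟨N, hN, hyN, hNN₁, hNT, hNU⟩ : ∃ N : Set E3, IsOpen N ∧ y ∈ N ∧ N ⊆ N₁ ∧
      (∀ a ∈ range (𝓡∂ 3) ∩ N, a ∈ φ.target) ∧
      (∀ a ∈ range (𝓡∂ 3) ∩ N, φ.symm a ∈ U ∩ U') := by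
    have h1 : φ.target ∈ 𝓝[range (𝓡∂ 3)] y := extChartAt_target_mem_nhdsWithin x₀
    have h2 : φ.symm ⁻¹' (U ∩ U') ∈ 𝓝[range (𝓡∂ 3)] y := by
      have hc := (contMDiffWithinAt_extChartAt_symm_range (n := ∞) (I := 𝓡∂ 3) x₀
        hyT).continuousWithinAt
      refine hc.preimage_mem_nhdsWithin ((hu.isOpen.inter hU').mem_nhds ?_)
      change φ.symm (φ x₀) ∈ _
      rw [extChartAt_to_inv]
      exact ⟨hx₀, hx₀'⟩
    obtain ⟨O, hO, hyO, hOs⟩ := mem_nhdsWithin.1 (inter_mem h1 h2)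
    exact ⟨N₁ ∩ O, hN₁.inter hO, ⟨hyN₁, hyO⟩, inter_subset_left,
      fun a ha => (hOs ⟨ha.2.2, ha.1⟩).1, fun a ha => (hOs ⟨ha.2.2, ha.1⟩).2⟩
  have hlN' : ∀ a ∈ halfSpace l ∩ N, a ∈ range (𝓡∂ 3) ∩ N := fun a ha => by
    have : a ∈ range (𝓡∂ 3) ∩ N₁ := hlN ▸ ⟨ha.1, hNN₁ ha.2⟩
    exact ⟨this.1, ha.2⟩
  -- The half-space and the model range agree near each point of `N`, so derivatives within the two
  -- sets are the same.
  have hset : ∀ a ∈ N, (halfSpace l : Set E3) =ᶠ[𝓝 a] range (𝓡∂ 3) := fun a ha => by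
    filter_upwards [hN₁.mem_nhds (hNN₁ ha)] with z hz
    apply propext
    constructor
    · intro h
      have : z ∈ range (𝓡∂ 3) ∩ N₁ := hlN ▸ ⟨h, hz⟩
      exact this.1
    · intro h
      have : z ∈ halfSpace l ∩ N₁ := hlN ▸ ⟨h, hz⟩
      exact this.1
  have hfd : ∀ {F : Type} [NormedAddCommGroup F] [NormedSpace ℝ F] (f : E3 → F), ∀ a ∈ N,
      fderivWithin ℝ f (halfSpace l) a = fderivWithin ℝ f (range (𝓡∂ 3)) a :=
    fun f a ha => fderivWithin_congr_set (hset a ha)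
  have hsubT : halfSpace l ∩ N ⊆ φ.target := fun a ha => hNT a (hlN' a ha)
  have hsubTU : halfSpace l ∩ N ⊆ φ.target ∩ φ.symm ⁻¹' U :=
    fun a ha => ⟨hsubT ha, (hNU a (hlN' a ha)).1⟩
  have hBs : SmoothVFieldOn B U := hflux.smooth_B.mono (subset_univ _)
  set Y := frameMap (fieldInChart B x₀) (fieldInChart u x₀) with hY
  have hBc := (contDiffOn_fieldInChart hu.isOpen hBs x₀).mono hsubTU
  have huc := (contDiffOn_fieldInChart hu.isOpen hu.smooth x₀).mono hsubTU
  have hYc : ContDiffOn ℝ ∞ Y (halfSpace l ∩ N) :=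
    ((ContinuousLinearMap.smulRightL ℝ V2 E3 _).contDiff.comp_contDiffOn hBc).add
      ((ContinuousLinearMap.smulRightL ℝ V2 E3 _).contDiff.comp_contDiffOn huc)
  have hηY : ∀ a ∈ halfSpace l ∩ N, ∀ c, covectorInChart ν x₀ a (Y a c) = 0 := by
    intro a ha c
    rw [hY, frameMap_apply, map_add, map_smul, map_smul,
      covectorInChart_fieldInChart ν B x₀ (hsubT ha),
      covectorInChart_fieldInChart ν u x₀ (hsubT ha), hflux.ν_B, flux_u (hu.flux _ (hsubTU ha).2)]
    simp
  have hyl : y ∈ halfSpace l ∩ N := ⟨hly.ge, hyN⟩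
  have hsrc : x₀ ∈ φ.source := mem_extChartAt_source x₀
  have hYinj : Function.Injective (Y y) := by
    rw [injective_iff_map_eq_zero]
    intro c hc
    rw [hY, frameMap_apply] at hc
    have h1 := congrArg (mfderivWithin 𝓘(ℝ, E3) (𝓡∂ 3) φ.symm (range (𝓡∂ 3)) y) hc
    have h2 : c.1 • B (φ.symm y) + c.2 • u (φ.symm y) = 0 := by
      rw [← mfderivWithin_fieldInChart B x₀ hyT, ← mfderivWithin_fieldInChart u x₀ hyT]
      refine Eq.trans ?_ (h1.trans (map_zero _))
      refine Eq.symm ((map_add (mfderivWithin 𝓘(ℝ, E3) (𝓡∂ 3) φ.symm (range (𝓡∂ 3)) y)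
        (c.1 • fieldInChart B x₀ y) (c.2 • fieldInChart u x₀ y)).trans ?_)
      exact congrArg₂ (· + ·) (map_smul (mfderivWithin 𝓘(ℝ, E3) (𝓡∂ 3) φ.symm (range (𝓡∂ 3)) y)
        c.1 (fieldInChart B x₀ y)) (map_smul (mfderivWithin 𝓘(ℝ, E3) (𝓡∂ 3) φ.symm
        (range (𝓡∂ 3)) y) c.2 (fieldInChart u x₀ y))
    have e0 : φ.symm y = x₀ := extChartAt_to_inv x₀
    rw [e0] at h2
    have h3 := linearIndependent_of_flux (hu.flux x₀ hx₀) hν h2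
    exact Prod.ext h3.1 h3.2
  have hηy : covectorInChart ν x₀ y ≠ 0 := by
    intro h
    apply hν
    ext w
    have e1 : w = ![w 0] := by ext i; fin_cases i; rfl
    rw [e1, ← covectorInChart_mfderiv ν x₀ hsrc]
    change covectorInChart ν x₀ y _ = _
    rw [h]
    rfl
  obtain ⟨σ, k, G, hσ, hyG, hGN, hGy, hGiff, hGc, hGs, hGd⟩ :=
    exists_local_normal_form (V := V2) l he hly hN hyN
      ((hflux.smooth_ν.contDiffOn_covectorInChart x₀).mono hsubT)
      (fun a ha v w => by
        rw [hfd _ a ha.2]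
        exact covectorInChart_symmetric hflux.smooth_ν hflux.closed x₀ (hsubT ha) v w)
      (fun hl a ha hla v hv => covectorInChart_eq_zero_of_boundary hflux x₀ (hsubT ⟨hla.ge, ha⟩)
        (hlv hl a hla) (hlv hl v hv)) hηy hYc hηY hYinj
      (fun a ha c d => by
        rw [hfd _ a ha.2]
        have hd : ∀ {f : E3 → E3}, ContDiffOn ℝ ∞ f (halfSpace l ∩ N) →
            DifferentiableWithinAt ℝ f (range (𝓡∂ 3)) a := fun hf => by
          have h1 := (hf.differentiableOn (by simp)) a ha
          rw [differentiableWithinAt_inter (hN.mem_nhds ha.2)] at h1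
          exact (differentiableWithinAt_congr_set (hset a ha.2)).1 h1
        exact fderivWithin_frameMap_comm (uniqueDiffOn_range_model a (hlN' a ha).1) (hd hBc) (hd huc)
          (lieBracketWithin_fieldInChart_eq_zero hu.isOpen hu.smooth hBs hbr x₀ (hsubT ha)
            (hsubTU ha).2) c d)
      (by simp [E3, V2])
  have h0T : (0 : V2 × ℝ) ∈ G.target := by rw [← hGy]; exact G.map_source hyG
  obtain ⟨r, hr, hrT⟩ := Metric.isOpen_iff.1 G.open_target 0 h0T
  -- Cutting the source down to the preimage of a ball inside the target makes the image exactly a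
  -- box.
  set O : Set E3 := G.source ∩ G ⁻¹' ball 0 r with hO
  have hOo : IsOpen O := G.isOpen_inter_preimage isOpen_ball
  have hON : O ⊆ N := inter_subset_left.trans hGN
  have hφO : ∀ z ∈ φ.source, φ z ∈ O → φ z ∈ halfSpace l ∩ O := by
    intro z hz hzO
    have : φ z ∈ halfSpace l ∩ N₁ := hlN ▸ ⟨mem_range_self (f := 𝓡∂ 3) _, hNN₁ (hON hzO)⟩
    exact ⟨this.1, hzO⟩
  set W : Set M := φ.source ∩ φ ⁻¹' O with hW
  have hWo : IsOpen W := (continuousOn_extChartAt x₀).isOpen_inter_preimage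
    (isOpen_extChartAt_source x₀) hOo
  have hcmem : ∀ q ∈ boxDomain k r, G.symm q ∈ halfSpace l ∩ O := by
    intro q hq
    have h1 := G.map_target (hrT hq.2)
    refine ⟨(hGiff _ h1).2 ?_, h1, ?_⟩
    · rw [G.right_inv (hrT hq.2)]; exact hq.1
    · rw [mem_preimage, G.right_inv (hrT hq.2)]; exact hq.2
  have hcT : ∀ q ∈ boxDomain k r, G.symm q ∈ φ.target := fun q hq =>
    hsubT ⟨(hcmem q hq).1, hON (hcmem q hq).2⟩
  have hder : ∀ z ∈ W, ∃ G' : E3 →L[ℝ] V2 × ℝ,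
      HasMFDerivAt (𝓡∂ 3) 𝓘(ℝ, V2 × ℝ) (G ∘ φ) z
        (G'.comp (mfderiv (𝓡∂ 3) 𝓘(ℝ, E3) φ z)) ∧
      (∀ c, G' (Y (φ z) c) = (c, 0)) ∧ ∀ w, (G' w).2 = σ * covectorInChart ν x₀ (φ z) w := by
    intro z hz
    have hz2 := hφO z hz.1 hz.2
    obtain ⟨G', h1, h2, h3⟩ := hGd (φ z) ⟨hz2.1, hz.2.1⟩
    refine ⟨G', ?_, h2, h3⟩
    have d1 : HasMFDerivWithinAt (𝓡∂ 3) 𝓘(ℝ, E3) φ W z (mfderiv (𝓡∂ 3) 𝓘(ℝ, E3) φ z) :=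
      ((contMDiffAt_extChartAt' (n := ∞) (by
        rw [← extChartAt_source (𝓡∂ 3)]; exact hz.1)).mdifferentiableAt
          (by simp)).hasMFDerivAt.hasMFDerivWithinAt
    have d2 := h1.hasMFDerivWithinAt.comp z d1 (fun a ha => (hφO a ha.1 ha.2).1)
    exact d2.hasMFDerivAt (hWo.mem_nhds hz)
  refine ⟨{ σ := σ, k := k, r := r, W := W, χ := G ∘ φ, c := φ.symm ∘ G.symm, sign := hσ,
            r_pos := hr, isOpen := hWo, mem := ⟨hsrc, hyG, ?_⟩, χ_self := hGy,
            χ_mem := ?_, c_mem := ?_, c_χ := ?_, χ_c := ?_, smooth_χ := ?_, smooth_c := ?_,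
            deriv_B := ?_, deriv_u := ?_, deriv_z := ?_ }, ?_⟩
  · rw [mem_preimage]
    change G y ∈ _
    rw [hGy]; exact mem_ball_self hr
  · intro z hz
    exact ⟨(hGiff _ hz.2.1).1 (hφO z hz.1 hz.2).1, hz.2.2⟩
  · intro q hq
    refine ⟨φ.map_target (hcT q hq), ?_⟩
    rw [mem_preimage, Function.comp_apply, φ.right_inv (hcT q hq)]
    exact (hcmem q hq).2
  · intro z hz
    simp only [Function.comp_apply]
    rw [G.left_inv hz.2.1, φ.left_inv hz.1]
  · intro q hq
    simp only [Function.comp_apply]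
    rw [φ.right_inv (hcT q hq), G.right_inv (hrT hq.2)]
  · refine (hGc.contMDiffOn).comp (t := halfSpace l ∩ G.source) ((contMDiffOn_extChartAt).mono
      (fun z hz => ?_)) (fun z hz => ⟨(hφO z hz.1 hz.2).1, hz.2.1⟩)
    rw [← extChartAt_source (𝓡∂ 3)]; exact hz.1
  · exact (contMDiffOn_extChartAt_symm x₀).comp (hGs.mono fun q hq => ⟨hq.1, hrT hq.2⟩).contMDiffOn
      hcT
  · intro z hz
    obtain ⟨G', h1, h2, -⟩ := hder z hz
    rw [h1.mfderiv]
    have h3 := h2 (1, 0)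
    rw [hY, frameMap_apply, one_smul, zero_smul, add_zero,
      ← mfderiv_extChartAt_apply_field B x₀ hz.1] at h3
    exact h3
  · intro z hz
    obtain ⟨G', h1, h2, -⟩ := hder z hz
    rw [h1.mfderiv]
    have h3 := h2 (0, 1)
    rw [hY, frameMap_apply, one_smul, zero_smul, zero_add,
      ← mfderiv_extChartAt_apply_field u x₀ hz.1] at h3
    exact h3
  · intro z hz v
    obtain ⟨G', h1, -, h3⟩ := hder z hz
    rw [h1.mfderiv, ← covectorInChart_mfderiv ν x₀ hz.1]
    exact h3 _
  · intro z hz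
    have h1 := hNU (φ z) ⟨mem_range_self (f := 𝓡∂ 3) _, hON hz.2⟩
    rw [φ.left_inv hz.1] at h1
    exact h1.2

end FlowBox
-- Calculus in a flow box
section FlowBoxLemmas

universe u

variable {M : Type u} [TopologicalSpace M] [ChartedSpace (EuclideanHalfSpace 3) M]
  {B u : VField M} {ν : DForm 1 M} {x : M}

theorem uniqueDiffOn_boxDomain (k r : ℝ) : UniqueDiffOn ℝ (boxDomain k r) :=
  (uniqueDiffOn_halfSpace _).inter isOpen_ball

theorem convex_boxDomain (k r : ℝ) : Convex ℝ (boxDomain k r) :=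
  (convex_halfSpace _).inter (convex_ball _ _)

theorem zero_mem_boxDomain (k : ℝ) {r : ℝ} (hr : 0 < r) : (0 : V2 × ℝ) ∈ boxDomain k r :=
  ⟨zero_mem_halfSpace _, mem_ball_self hr⟩

theorem boxDomain_mono (k : ℝ) {r r' : ℝ} (h : r' ≤ r) : boxDomain k r' ⊆ boxDomain k r :=
  inter_subset_inter_right _ (ball_subset_ball h)

namespace FlowBox

theorem c_zero (b : FlowBox B u ν x) : b.c 0 = x := by
  rw [← b.χ_self, b.c_χ x b.mem]

theorem hasMFDerivAt_χ (b : FlowBox B u ν x) {y : M} (hy : y ∈ b.W) :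
    HasMFDerivAt (𝓡∂ 3) 𝓘(ℝ, V2 × ℝ) b.χ y (mfderiv (𝓡∂ 3) 𝓘(ℝ, V2 × ℝ) b.χ y) :=
  ((b.smooth_χ.contMDiffAt (b.isOpen.mem_nhds hy)).mdifferentiableAt (by simp)).hasMFDerivAt

theorem hasMFDerivWithinAt_c (b : FlowBox B u ν x) {q : V2 × ℝ} (hq : q ∈ boxDomain b.k b.r) :
    HasMFDerivWithinAt 𝓘(ℝ, V2 × ℝ) (𝓡∂ 3) b.c (boxDomain b.k b.r) q
      (mfderivWithin 𝓘(ℝ, V2 × ℝ) (𝓡∂ 3) b.c (boxDomain b.k b.r) q) :=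
  ((b.smooth_c q hq).mdifferentiableWithinAt (by simp)).hasMFDerivWithinAt

theorem mfderiv_χ_injective (b : FlowBox B u ν x) {y : M} (hy : y ∈ b.W) :
    Function.Injective (mfderiv (𝓡∂ 3) 𝓘(ℝ, V2 × ℝ) b.χ y) := by
  have h1 := (b.hasMFDerivWithinAt_c (b.χ_mem y hy)).comp y
    ((b.hasMFDerivAt_χ hy).hasMFDerivWithinAt (s := b.W)) b.χ_mem
  have h2 := h1.hasMFDerivAt (b.isOpen.mem_nhds hy)
  have h3 : HasMFDerivAt (𝓡∂ 3) (𝓡∂ 3) (b.c ∘ b.χ) y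
      (ContinuousLinearMap.id ℝ (TangentSpace (𝓡∂ 3) y)) := by
    refine (hasMFDerivAt_id y).congr_of_eventuallyEq ?_
    filter_upwards [b.isOpen.mem_nhds hy] with z hz
    exact b.c_χ z hz
  have h4 := hasMFDerivAt_unique h2 h3
  intro v w hvw
  have h5 : ∀ v, (mfderivWithin 𝓘(ℝ, V2 × ℝ) (𝓡∂ 3) b.c (boxDomain b.k b.r) (b.χ y))
    (mfderiv (𝓡∂ 3) 𝓘(ℝ, V2 × ℝ) b.χ y v) = v := fun v => congrArg (fun T => T v) h4
  have h6 := congrArg (mfderivWithin 𝓘(ℝ, V2 × ℝ) (𝓡∂ 3) b.c (boxDomain b.k b.r) (b.χ y)) hvw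
  exact (h5 v).symm.trans (h6.trans (h5 w))

theorem mfderiv_χ_mfderivWithin_c (b : FlowBox B u ν x) {q : V2 × ℝ}
    (hq : q ∈ boxDomain b.k b.r) (v : V2 × ℝ) :
    mfderiv (𝓡∂ 3) 𝓘(ℝ, V2 × ℝ) b.χ (b.c q)
      (mfderivWithin 𝓘(ℝ, V2 × ℝ) (𝓡∂ 3) b.c (boxDomain b.k b.r) q v) = v := by
  have h1 : HasMFDerivWithinAt 𝓘(ℝ, V2 × ℝ) 𝓘(ℝ, V2 × ℝ) (b.χ ∘ b.c) (boxDomain b.k b.r) q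
      ((mfderiv (𝓡∂ 3) 𝓘(ℝ, V2 × ℝ) b.χ (b.c q)).comp
        (mfderivWithin 𝓘(ℝ, V2 × ℝ) (𝓡∂ 3) b.c (boxDomain b.k b.r) q)) :=
    (b.hasMFDerivAt_χ (b.c_mem q hq)).comp_hasMFDerivWithinAt q (b.hasMFDerivWithinAt_c hq)
  have h2 : HasFDerivWithinAt (b.χ ∘ b.c) (ContinuousLinearMap.id ℝ (V2 × ℝ))
      (boxDomain b.k b.r) q :=
    (hasFDerivWithinAt_id q _).congr (fun z hz => b.χ_c z hz) (b.χ_c q hq)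
  have h3 : ∀ T : V2 × ℝ →L[ℝ] V2 × ℝ,
      HasFDerivWithinAt (b.χ ∘ b.c) T (boxDomain b.k b.r) q → T v = v := by
    intro T hT
    rw [(uniqueDiffOn_boxDomain b.k b.r q hq).eq hT h2]
    rfl
  exact h3 _ h1.hasFDerivWithinAt

/-- The derivative of the inverse chart is the frame `(B, u)` in the leaf directions. -/
theorem mfderivWithin_c_apply (b : FlowBox B u ν x) {q : V2 × ℝ} (hq : q ∈ boxDomain b.k b.r)
    (w : V2) : (mfderivWithin 𝓘(ℝ, V2 × ℝ) (𝓡∂ 3) b.c (boxDomain b.k b.r) q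
      ((w, 0) : V2 × ℝ)) = w.1 • B (b.c q) + w.2 • u (b.c q) := by
  have hy := b.c_mem q hq
  apply b.mfderiv_χ_injective hy
  have h4 := b.mfderiv_χ_mfderivWithin_c hq (w, 0)
  refine Eq.trans h4 (Eq.symm ?_)
  refine (map_add (mfderiv (𝓡∂ 3) 𝓘(ℝ, V2 × ℝ) b.χ (b.c q)) (w.1 • B (b.c q))
    (w.2 • u (b.c q))).trans ((congrArg₂ (· + ·)
      ((map_smul _ _ _).trans (congrArg (w.1 • ·) (b.deriv_B _ hy)))
      ((map_smul _ _ _).trans (congrArg (w.2 • ·) (b.deriv_u _ hy)))).trans ?_)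
  change w.1 • (((1, 0), 0) : V2 × ℝ) + w.2 • (((0, 1), 0) : V2 × ℝ) = ((w, 0) : V2 × ℝ)
  ext <;> simp

/-- Shrinking a flow box. -/
def shrink (b : FlowBox B u ν x) (r' : ℝ) (h0 : 0 < r') (hr : r' ≤ b.r) : FlowBox B u ν x where
  σ := b.σ
  k := b.k
  r := r'
  W := b.W ∩ b.χ ⁻¹' ball 0 r'
  χ := b.χ
  c := b.c
  sign := b.sign
  r_pos := h0
  isOpen := b.smooth_χ.continuousOn.isOpen_inter_preimage b.isOpen isOpen_ball
  mem := ⟨b.mem, by rw [mem_preimage, b.χ_self]; exact mem_ball_self h0⟩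
  χ_self := b.χ_self
  χ_mem y hy := ⟨(b.χ_mem y hy.1).1, hy.2⟩
  c_mem q hq := ⟨b.c_mem q (boxDomain_mono _ hr hq), by
    rw [mem_preimage, b.χ_c q (boxDomain_mono _ hr hq)]; exact hq.2⟩
  c_χ y hy := b.c_χ y hy.1
  χ_c q hq := b.χ_c q (boxDomain_mono _ hr hq)
  smooth_χ := b.smooth_χ.mono inter_subset_left
  smooth_c := b.smooth_c.mono (boxDomain_mono _ hr)
  deriv_B y hy := b.deriv_B y hy.1
  deriv_u y hy := b.deriv_u y hy.1
  deriv_z y hy := b.deriv_z y hy.1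

theorem exists_shrink (b : FlowBox B u ν x) {O : Set M} (hO : O ∈ 𝓝 x) :
    ∃ (r' : ℝ) (h0 : 0 < r') (hr : r' ≤ b.r), (b.shrink r' h0 hr).W ⊆ O := by
  have h0 := zero_mem_boxDomain b.k b.r_pos
  have h1 : b.c ⁻¹' O ∈ 𝓝[boxDomain b.k b.r] 0 :=
    (b.smooth_c.continuousOn 0 h0).preimage_mem_nhdsWithin (by rwa [b.c_zero])
  obtain ⟨ε, hε, hs⟩ := Metric.mem_nhdsWithin_iff.1 h1
  refine ⟨min ε b.r, lt_min hε b.r_pos, min_le_right _ _, fun y hy => ?_⟩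
  have h2 := hs ⟨ball_subset_ball (min_le_left _ _) hy.2, b.χ_mem y hy.1⟩
  rw [mem_preimage, b.c_χ y hy.1] at h2
  exact h2

end FlowBox

end FlowBoxLemmas

/-! ### The compact leaf inside a flow box -/

section Leaf

universe u

variable {M : Type u} [TopologicalSpace M] [T2Space M] [ChartedSpace (EuclideanHalfSpace 3) M]
  {B u : VField M} {ν : DForm 1 M}

/-- Near each of its points, a compact leaf is a level set of the last coordinate. -/
theorem FlowBox.exists_nhds_leaf {S : Set M} (hS : IsRegularClosedLeaf ν S) {x : M} (hx : x ∈ S)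
    (b : FlowBox B u ν x) : ∃ O ∈ 𝓝 x, O ⊆ b.W ∧ ∀ y ∈ O, y ∈ S ↔ (b.χ y).2 = 0 := by
  obtain ⟨N, _, _, _, _, _, f, hf, rfl⟩ := hS
  obtain ⟨n, rfl⟩ := hx
  have hfc : Continuous f := hf.smooth.continuous
  -- Compactness enters here: the immersion is an embedding, so no other part of the leaf
  -- accumulates at the point.
  have hemb : Topology.IsClosedEmbedding f := hfc.isClosedEmbedding hf.injective
  set κ := extChartAt (𝓡 2) n with hκ
  have hκT : IsOpen κ.target := isOpen_extChartAt_target n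
  have hκc : ContinuousOn κ.symm κ.target := continuousOn_extChartAt_symm n
  have hO₁ : IsOpen (κ.target ∩ κ.symm ⁻¹' (f ⁻¹' b.W)) :=
    hκc.isOpen_inter_preimage hκT (b.isOpen.preimage hfc)
  have hn1 : κ n ∈ κ.target ∩ κ.symm ⁻¹' (f ⁻¹' b.W) := by
    refine ⟨mem_extChartAt_target n, ?_⟩
    rw [mem_preimage, extChartAt_to_inv]
    exact b.mem
  obtain ⟨δ, hδ, hδs⟩ := Metric.isOpen_iff.1 hO₁ _ hn1
  set g : EuclideanSpace ℝ (Fin 2) → V2 × ℝ := b.χ ∘ f ∘ κ.symm with hg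
  have hgn : g (κ n) = 0 := by
    simp only [hg, Function.comp_apply]
    rw [extChartAt_to_inv, b.χ_self]
  have hgc : ContDiffOn ℝ ∞ g (ball (κ n) δ) := by
    rw [← contMDiffOn_iff_contDiffOn]
    exact b.smooth_χ.comp ((hf.smooth.contMDiffOn (s := univ)).comp
      ((contMDiffOn_extChartAt_symm n).mono fun z hz => (hδs hz).1) fun _ _ => mem_univ _)
      fun z hz => (hδs hz).2
  have hder : ∀ z ∈ ball (κ n) δ, ∃ g' : EuclideanSpace ℝ (Fin 2) →L[ℝ] V2 × ℝ,
      HasFDerivAt g g' z ∧ (∀ v, (g' v).2 = 0) ∧ ∀ v, g' v = 0 → v = 0 := by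
    intro z hz
    obtain ⟨hzT, hzW⟩ := hδs hz
    have d1 : HasMFDerivAt 𝓘(ℝ, EuclideanSpace ℝ (Fin 2)) (𝓡 2) κ.symm z
        (mfderiv 𝓘(ℝ, EuclideanSpace ℝ (Fin 2)) (𝓡 2) κ.symm z) :=
      (((contMDiffOn_extChartAt_symm (n := ∞) n).contMDiffAt
        (hκT.mem_nhds hzT)).mdifferentiableAt (by simp)).hasMFDerivAt
    have d2 : HasMFDerivAt (𝓡 2) (𝓡∂ 3) f (κ.symm z) (mfderiv (𝓡 2) (𝓡∂ 3) f (κ.symm z)) :=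
      ((hf.smooth (κ.symm z)).mdifferentiableAt (by simp)).hasMFDerivAt
    have d3 := (b.hasMFDerivAt_χ hzW).comp z (d2.comp z d1)
    refine ⟨_, d3.hasFDerivAt, fun v => ?_, fun v hv => ?_⟩
    · refine (b.deriv_z _ hzW (mfderiv (𝓡 2) (𝓡∂ 3) f (κ.symm z) (mfderiv
        𝓘(ℝ, EuclideanSpace ℝ (Fin 2)) (𝓡 2) κ.symm z v))).trans ?_
      rw [(hf.tangent _ _).1 (mem_range_self _), mul_zero]
    · have e1 := b.mfderiv_χ_injective hzW (hv.trans (map_zero _).symm)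
      have e2 := hf.immersion _ (e1.trans (map_zero _).symm)
      have hinj : Function.Injective (mfderiv 𝓘(ℝ, EuclideanSpace ℝ (Fin 2)) (𝓡 2) κ.symm z) := by
        have : IsManifold (𝓡 2) 1 N := IsManifold.of_le (n := ∞) (by simp)
        have h1 := isInvertible_mfderivWithin_extChartAt_symm (I := 𝓡 2) hzT
        rw [ModelWithCorners.range_eq_univ, mfderivWithin_univ] at h1
        exact h1.bijective.1
      exact hinj (e2.trans (map_zero _).symm)
  -- The leaf is tangent to $\ker\nu=\ker dz$, so the last coordinate is constant on the connected
  -- patch.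
  have hz0 : ∀ z ∈ ball (κ n) δ, (g z).2 = 0 := by
    intro z hz
    have h1 : ∀ z ∈ ball (κ n) δ, HasFDerivWithinAt (fun z => (g z).2)
        (0 : EuclideanSpace ℝ (Fin 2) →L[ℝ] ℝ) (ball (κ n) δ) z := by
      intro z hz
      obtain ⟨g', h1, h2, -⟩ := hder z hz
      have h3 : (ContinuousLinearMap.snd ℝ V2 ℝ).comp g' = 0 := by ext v; exact h2 _
      rw [← h3]
      exact (hasFDerivAt_snd.comp z h1).hasFDerivWithinAt
    have h2 := (convex_ball (κ n) δ).is_const_of_fderivWithin_eq_zero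
      (fun z hz => (h1 z hz).differentiableWithinAt)
      (fun z hz => (h1 z hz).fderivWithin (isOpen_ball.uniqueDiffOn z hz)) hz (mem_ball_self hδ)
    rw [h2, hgn]
    rfl
  -- the leaf is locally contained in the level set
  have hNn : κ.source ∩ κ ⁻¹' ball (κ n) δ ∈ 𝓝 n :=
    inter_mem (extChartAt_source_mem_nhds n) ((continuousAt_extChartAt n).preimage_mem_nhds
      (ball_mem_nhds _ hδ))
  rw [hemb.isInducing.nhds_eq_comap] at hNn
  obtain ⟨O', hO', hO's⟩ := hNn
  -- the level set is locally contained in the leaf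
  have hev : ∀ᶠ v in 𝓝 (0 : V2), ∃ z ∈ ball (κ n) δ, (g z).1 = v := by
    obtain ⟨g', h1, h2, h3⟩ := hder (κ n) (mem_ball_self hδ)
    have hstr : HasStrictFDerivAt (fun z => (g z).1)
        ((ContinuousLinearMap.fst ℝ V2 ℝ).comp g') (κ n) := by
      have := (hgc.contDiffAt (ball_mem_nhds _ hδ)).hasStrictFDerivAt (by simp)
      rw [h1.fderiv] at this
      exact hasStrictFDerivAt_fst.comp (κ n) this
    have hinj : Function.Injective ((ContinuousLinearMap.fst ℝ V2 ℝ).comp g').toLinearMap := by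
      rw [injective_iff_map_eq_zero]
      intro v hv
      exact h3 v (Prod.ext hv (h2 v))
    have hsurj := (LinearMap.injective_iff_surjective_of_finrank_eq_finrank (by simp [V2])).1 hinj
    -- The patch and the level set both have dimension two, so the injective derivative is onto and
    -- the patch covers a full neighbourhood in the level set.
    have hmap := hstr.map_nhds_eq_of_surj (LinearMap.range_eq_top.2 hsurj)
    rw [hgn] at hmap
    have h4 : (fun z => (g z).1) '' ball (κ n) δ ∈ 𝓝 ((0 : V2 × ℝ).1) := by
      rw [← hmap]
      exact image_mem_map (ball_mem_nhds _ hδ)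
    filter_upwards [h4] with v hv
    exact hv
  have hcont : ContinuousAt (fun y => (b.χ y).1) (f n) :=
    continuous_fst.continuousAt.comp
      (b.smooth_χ.continuousOn.continuousAt (b.isOpen.mem_nhds b.mem))
  have hev2 : ∀ᶠ y in 𝓝 (f n), ∃ z ∈ ball (κ n) δ, (g z).1 = (b.χ y).1 :=
    hcont.eventually (by
      change ∀ᶠ v in 𝓝 (b.χ (f n)).1, ∃ z ∈ ball (κ n) δ, (g z).1 = v
      rw [b.χ_self]; exact hev)
  refine ⟨b.W ∩ (O' ∩ {y | ∃ z ∈ ball (κ n) δ, (g z).1 = (b.χ y).1}),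
    inter_mem (b.isOpen.mem_nhds b.mem) (inter_mem hO' hev2), inter_subset_left, ?_⟩
  rintro y ⟨hyW, hyO', z, hz, hzy⟩
  constructor
  · rintro ⟨p, rfl⟩
    obtain ⟨hp1, hp2⟩ := hO's hyO'
    have := hz0 (κ p) hp2
    simp only [hg, Function.comp_apply] at this
    rwa [κ.left_inv hp1] at this
  · intro hy0
    refine ⟨κ.symm z, ?_⟩
    have h1 : b.χ (f (κ.symm z)) = b.χ y := Prod.ext hzy ((hz0 z hz).trans hy0.symm)
    rw [← b.c_χ _ (hδs hz).2, h1, b.c_χ y hyW]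

end Leaf
-- Transitions between flow boxes
section Transition

universe u

variable {M : Type u} [TopologicalSpace M] [ChartedSpace (EuclideanHalfSpace 3) M]
  {B u : VField M} {ν : DForm 1 M} {x x' : M}

namespace FlowBox

theorem sign_mul_self (b : FlowBox B u ν x) : b.σ * b.σ = 1 := by
  rcases b.sign with h | h <;> rw [h] <;> norm_num

theorem continuousOn_c (b : FlowBox B u ν x) : ContinuousOn b.c (boxDomain b.k b.r) :=
  b.smooth_c.continuousOn

/-- `ν` in a flow box. -/
theorem ν_mfderivWithin_c (b : FlowBox B u ν x) {q : V2 × ℝ} (hq : q ∈ boxDomain b.k b.r)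
    (v : V2 × ℝ) : ν (b.c q)
      ![mfderivWithin 𝓘(ℝ, V2 × ℝ) (𝓡∂ 3) b.c (boxDomain b.k b.r) q v] = b.σ * v.2 := by
  have h1 := b.deriv_z _ (b.c_mem q hq)
    (mfderivWithin 𝓘(ℝ, V2 × ℝ) (𝓡∂ 3) b.c (boxDomain b.k b.r) q v)
  have h2 : v.2 = b.σ * ν (b.c q)
      ![mfderivWithin 𝓘(ℝ, V2 × ℝ) (𝓡∂ 3) b.c (boxDomain b.k b.r) q v] :=
    (congrArg Prod.snd (b.mfderiv_χ_mfderivWithin_c hq v)).symm.trans h1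
  rw [h2, ← mul_assoc, b.sign_mul_self, one_mul]

/-- The transition between two flow boxes commutes with the translations, infinitesimally. -/
theorem hasDerivWithinAt_transition (b : FlowBox B u ν x) (b' : FlowBox B u ν x') {q : V2 × ℝ}
    {w : V2} {s : Set ℝ} {t : ℝ} (hs : ∀ τ ∈ s, q + τ • ((w, 0) : V2 × ℝ) ∈ boxDomain b.k b.r)
    (ht : t ∈ s) (hW : b.c (q + t • ((w, 0) : V2 × ℝ)) ∈ b'.W) :
    HasDerivWithinAt (fun τ => b'.χ (b.c (q + τ • ((w, 0) : V2 × ℝ)))) ((w, 0) : V2 × ℝ) s t := by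
  have h1 : HasMFDerivWithinAt 𝓘(ℝ, V2 × ℝ) 𝓘(ℝ, V2 × ℝ) (b'.χ ∘ b.c) (boxDomain b.k b.r) _ _ :=
    (b'.hasMFDerivAt_χ hW).comp_hasMFDerivWithinAt _ (b.hasMFDerivWithinAt_c (hs t ht))
  have h3 : ∀ T : V2 × ℝ →L[ℝ] V2 × ℝ, HasFDerivWithinAt (b'.χ ∘ b.c) T (boxDomain b.k b.r)
      (q + t • ((w, 0) : V2 × ℝ)) → T (w, 0) = (w, 0) →
      HasDerivWithinAt (fun τ => b'.χ (b.c (q + τ • ((w, 0) : V2 × ℝ))))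
        ((w, 0) : V2 × ℝ) s t := by
    intro T hT hTw
    have h5 : HasDerivWithinAt (fun τ : ℝ => q + τ • ((w, 0) : V2 × ℝ)) ((w, 0) : V2 × ℝ) s t := by
      simpa using ((hasDerivWithinAt_id t s).smul_const ((w, 0) : V2 × ℝ)).const_add q
    have h6 := hT.comp_hasDerivWithinAt t h5 hs
    rw [hTw] at h6
    exact h6
  refine h3 _ h1.hasFDerivWithinAt ?_
  refine Eq.trans (congrArg (mfderiv (𝓡∂ 3) 𝓘(ℝ, V2 × ℝ) b'.χ _)
    (b.mfderivWithin_c_apply (hs t ht) w)) ?_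
  refine (map_add (mfderiv (𝓡∂ 3) 𝓘(ℝ, V2 × ℝ) b'.χ _) _ _).trans ((congrArg₂ (· + ·)
      ((map_smul _ _ _).trans (congrArg (w.1 • ·) (b'.deriv_B _ hW)))
      ((map_smul _ _ _).trans (congrArg (w.2 • ·) (b'.deriv_u _ hW)))).trans ?_)
  change w.1 • (((1, 0), 0) : V2 × ℝ) + w.2 • (((0, 1), 0) : V2 × ℝ) = ((w, 0) : V2 × ℝ)
  ext <;> simp

theorem eqOn_of_hasDerivWithinAt_const {E : Type*} [NormedAddCommGroup E] [NormedSpace ℝ E]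
    {f : ℝ → E} {s : Set ℝ} (hs : Convex ℝ s) (w : E)
    (hf : ∀ τ ∈ s, HasDerivWithinAt f w s τ) {t τ : ℝ} (ht : t ∈ s) (hτ : τ ∈ s) :
    f τ = f t + (τ - t) • w := by
  have h1 : ∀ τ ∈ s, HasDerivWithinAt (fun τ => f τ - τ • w) 0 s τ := fun τ hτ => by
    have h := (hf τ hτ).sub ((hasDerivWithinAt_id τ s).smul_const w)
    rw [one_smul, sub_self] at h
    exact h
  have h2 := hs.norm_image_sub_le_of_norm_hasDerivWithin_le (C := 0) h1 (by simp) ht hτ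
  rw [zero_mul, norm_le_zero_iff, sub_eq_zero, sub_eq_iff_eq_add] at h2
  rw [h2]
  module

variable [T2Space M]

/-- The translations of two flow boxes agree as long as both are defined. -/
theorem c_add_eq (b : FlowBox B u ν x) (b' : FlowBox B u ν x') {q q' : V2 × ℝ}
    {w : V2} (hq : q ∈ boxDomain b.k b.r) (hq' : q' ∈ boxDomain b'.k b'.r)
    (hqw : q + (w, 0) ∈ boxDomain b.k b.r) (hqw' : q' + (w, 0) ∈ boxDomain b'.k b'.r)
    (h : b.c q = b'.c q') : b.c (q + (w, 0)) = b'.c (q' + (w, 0)) := by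
  have key : ∀ {k r : ℝ} {p : V2 × ℝ}, p ∈ boxDomain k r → p + (w, 0) ∈ boxDomain k r →
      ∀ t ∈ Icc (0 : ℝ) 1, p + t • ((w, 0) : V2 × ℝ) ∈ boxDomain k r := fun h1 h2 t ht =>
    (convex_boxDomain _ _).add_smul_mem h1 h2 ht
  have hγ := key hq hqw
  have hγ' := key hq' hqw'
  have hc : ∀ p : V2 × ℝ, ContinuousOn (fun t : ℝ => p + t • ((w, 0) : V2 × ℝ)) (Icc 0 1) :=
    fun p => by fun_prop
  have c1 : ContinuousOn (fun t : ℝ => b.c (q + t • ((w, 0) : V2 × ℝ))) (Icc 0 1) :=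
    b.continuousOn_c.comp (hc q) hγ
  have c2 : ContinuousOn (fun t : ℝ => b'.c (q' + t • ((w, 0) : V2 × ℝ))) (Icc 0 1) :=
    b'.continuousOn_c.comp (hc q') hγ'
  set A := {t : ℝ | b.c (q + t • ((w, 0) : V2 × ℝ)) = b'.c (q' + t • ((w, 0) : V2 × ℝ))} with hA
  have hclosed : IsClosed (A ∩ Icc 0 1) := by
    have := (c1.prodMk c2).preimage_isClosed_of_isClosed isClosed_Icc isClosed_diagonal
    rw [inter_comm]
    exact this
  have hsub : Icc (0 : ℝ) 1 ⊆ A := by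
    -- Continuous induction: the two curves agree on a closed set of times as `M` is Hausdorff. Once
    -- they meet they agree a little longer, since both have velocity $(w,0)$ when read in `b'`.
    refine hclosed.Icc_subset_of_forall_mem_nhdsWithin (by
      change b.c _ = b'.c _
      rwa [zero_smul, add_zero, add_zero]) ?_
    rintro t ⟨htA, ht⟩
    have htI : t ∈ Icc (0 : ℝ) 1 := Ico_subset_Icc_self ht
    have hm : b.c (q + t • ((w, 0) : V2 × ℝ)) ∈ b'.W := by
      rw [show b.c (q + t • ((w, 0) : V2 × ℝ)) = _ from htA]
      exact b'.c_mem _ (hγ' t htI)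
    obtain ⟨ε, hε, hεs⟩ := Metric.mem_nhdsWithin_iff.1
      ((c1 t htI).preimage_mem_nhdsWithin (b'.isOpen.mem_nhds hm))
    have hder : ∀ τ ∈ ball t ε ∩ Icc 0 1, HasDerivWithinAt
        (fun τ => b'.χ (b.c (q + τ • ((w, 0) : V2 × ℝ)))) ((w, 0) : V2 × ℝ)
        (ball t ε ∩ Icc 0 1) τ := fun τ hτ =>
      b.hasDerivWithinAt_transition b' (fun a ha => hγ a ha.2) hτ (hεs hτ)
    have hconv : Convex ℝ (ball t ε ∩ Icc (0 : ℝ) 1) := (convex_ball _ _).inter (convex_Icc _ _)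
    have h1 : ball t ε ∩ Icc 0 1 ∈ 𝓝[>] t :=
      inter_mem (mem_nhdsWithin_of_mem_nhds (ball_mem_nhds _ hε)) (Icc_mem_nhdsGT_of_mem ht)
    filter_upwards [h1] with τ hτ
    have h2 := eqOn_of_hasDerivWithinAt_const hconv _ hder ⟨mem_ball_self hε, htI⟩ hτ
    have h3 : b'.χ (b.c (q + t • ((w, 0) : V2 × ℝ))) = q' + t • ((w, 0) : V2 × ℝ) := by
      rw [show b.c (q + t • ((w, 0) : V2 × ℝ)) = _ from htA, b'.χ_c _ (hγ' t htI)]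
    rw [h3] at h2
    have h4 : b'.χ (b.c (q + τ • ((w, 0) : V2 × ℝ))) = q' + τ • ((w, 0) : V2 × ℝ) := by
      rw [h2]; module
    change _ = _
    rw [← h4, b'.c_χ _ (hεs hτ)]
  have := hsub (right_mem_Icc.2 zero_le_one)
  simpa [hA] using this

end FlowBox

/-- The transverse coordinates of two flow boxes, up to sign, differ by a local constant. -/
theorem FlowBox.eventually_z_eq (b : FlowBox B u ν x) (b' : FlowBox B u ν x') {y : M}
    (hy : y ∈ b.W) (hy' : y ∈ b'.W) (h : b.σ * (b.χ y).2 = b'.σ * (b'.χ y).2) :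
    ∀ᶠ z in 𝓝 y, b.σ * (b.χ z).2 = b'.σ * (b'.χ z).2 := by
  set D := boxDomain b.k b.r
  have hq := b.χ_mem y hy
  have h1 : b.c ⁻¹' b'.W ∈ 𝓝[D] (b.χ y) :=
    (b.continuousOn_c _ hq).preimage_mem_nhdsWithin
      (b'.isOpen.mem_nhds (by rwa [b.c_χ y hy]))
  obtain ⟨ε, hε, hεs⟩ := Metric.mem_nhdsWithin_iff.1 h1
  set s := D ∩ ball (b.χ y) ε
  have hs : ∀ p ∈ s, b.c p ∈ b'.W := fun p hp => hεs ⟨hp.2, hp.1⟩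
  have hsc : Convex ℝ s := (convex_boxDomain _ _).inter (convex_ball _ _)
  have hsu : UniqueDiffOn ℝ s := (uniqueDiffOn_boxDomain _ _).inter isOpen_ball
  -- Both signed transverse coordinates have differential $\nu$, so their difference is constant on
  -- the convex set `s`.
  have hder : ∀ p ∈ s, HasFDerivWithinAt (fun p => b'.σ * (b'.χ (b.c p)).2 - b.σ * p.2)
      (0 : V2 × ℝ →L[ℝ] ℝ) s p := by
    intro p hp
    have h1 : HasMFDerivWithinAt 𝓘(ℝ, V2 × ℝ) 𝓘(ℝ, V2 × ℝ) (b'.χ ∘ b.c) D p _ :=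
      (b'.hasMFDerivAt_χ (hs p hp)).comp_hasMFDerivWithinAt _ (b.hasMFDerivWithinAt_c hp.1)
    have h3 : ∀ T : V2 × ℝ →L[ℝ] V2 × ℝ, HasFDerivWithinAt (b'.χ ∘ b.c) T D p →
        (∀ v, (T v).2 = b'.σ * (b.σ * v.2)) →
        HasFDerivWithinAt (fun p => b'.σ * (b'.χ (b.c p)).2 - b.σ * p.2)
          (0 : V2 × ℝ →L[ℝ] ℝ) s p := by
      intro T hT hTv
      have h4 := ((hT.mono (inter_subset_left : s ⊆ D)).snd.const_mul b'.σ).sub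
        ((hasFDerivWithinAt_snd (p := p) (s := s)).const_mul b.σ)
      refine h4.congr_fderiv ?_
      ext
      all_goals simp [hTv, ← mul_assoc, b'.sign_mul_self]
    refine h3 _ h1.hasFDerivWithinAt fun v => ?_
    refine (b'.deriv_z _ (hs p hp) _).trans (congrArg (b'.σ * ·) ?_)
    exact b.ν_mfderivWithin_c hp.1 v
  have hyS : b.χ y ∈ s := ⟨hq, mem_ball_self hε⟩
  have hconst : ∀ p ∈ s, b'.σ * (b'.χ (b.c p)).2 = b.σ * p.2 := by
    intro p hp
    have h2 := hsc.is_const_of_fderivWithin_eq_zero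
      (fun p hp => (hder p hp).differentiableWithinAt)
      (fun p hp => (hder p hp).fderivWithin (hsu p hp)) hp hyS
    simp only [b.c_χ y hy, h, sub_self] at h2
    exact sub_eq_zero.1 h2
  have hcont := b.smooth_χ.continuousOn.continuousAt (b.isOpen.mem_nhds hy)
  filter_upwards [b.isOpen.mem_nhds hy, hcont.preimage_mem_nhds (ball_mem_nhds _ hε)] with z hz hz2
  have h5 := hconst (b.χ z) ⟨b.χ_mem z hz, hz2⟩
  rw [b.c_χ z hz] at h5
  exact h5.symm

end Transition
-- Extension of a local homomorphism
/-- A local homomorphism from a ball of a normed space extends to a homomorphism. -/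
theorem exists_extension_of_local_hom {E : Type*} [NormedAddCommGroup E] [NormedSpace ℝ E]
    {G : Type*} [Monoid G] {f : E → G} {r : ℝ} (hr : 0 < r) (h0 : f 0 = 1)
    (hadd : ∀ x y, ‖x‖ + ‖y‖ < r → f (x + y) = f x * f y) :
    ∃ φ : E → G, φ 0 = 1 ∧ (∀ x y, φ (x + y) = φ x * φ y) ∧ (∀ x, ‖x‖ < r → φ x = f x) ∧
      ∀ x, ∃ (n : ℕ) (y : E), ‖y‖ < r ∧ φ x = f y ^ n := by
  have hpow : ∀ (k : ℕ) (x : E), k * ‖x‖ < r → f ((k : ℝ) • x) = f x ^ k := by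
    intro k x
    induction k with
    | zero => intro _; simp [h0]
    | succ k ih =>
      intro h
      push_cast at h ⊢
      have h1 : ‖(k : ℝ) • x‖ + ‖x‖ < r := by
        rw [norm_smul, Real.norm_natCast]; linarith
      have h2 : (k : ℝ) * ‖x‖ < r := by linarith [norm_nonneg x]
      rw [add_smul, one_smul, hadd _ _ h1, ih h2, pow_succ]
  have hle : ∀ {n : ℕ} {x : E}, 0 < n → ‖x‖ < n * r → ‖(n : ℝ)⁻¹ • x‖ < r := by
    intro n x hn hx
    have : (0 : ℝ) < n := Nat.cast_pos.2 hn
    rw [norm_smul, norm_inv, Real.norm_natCast, inv_mul_lt_iff₀ this]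
    exact hx
  have hmul : ∀ {n m : ℕ} {x : E}, 0 < n → 0 < m → ‖x‖ < n * r →
      f ((n : ℝ)⁻¹ • x) ^ n = f (((n * m : ℕ) : ℝ)⁻¹ • x) ^ (n * m) := by
    intro n m x hn hm hx
    have hn' : (n : ℝ) ≠ 0 := Nat.cast_ne_zero.2 hn.ne'
    have hm' : (m : ℝ) ≠ 0 := Nat.cast_ne_zero.2 hm.ne'
    have e1 : (m : ℝ) • (((n * m : ℕ) : ℝ)⁻¹ • x) = (n : ℝ)⁻¹ • x := by
      rw [smul_smul]; congr 1; push_cast; field_simp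
    have e2 : m * ‖((n * m : ℕ) : ℝ)⁻¹ • x‖ < r := by
      have := hle hn hx
      rw [← e1, norm_smul, Real.norm_natCast] at this
      exact this
    rw [← e1, hpow m _ e2, ← pow_mul, mul_comm m n]
  -- The extension is $f(x/n)^n$ for any large $n$; passing to the common subdivision $nm$ shows
  -- that the choice of $n$ is immaterial.
  have hind : ∀ {n m : ℕ} {x : E}, 0 < n → 0 < m → ‖x‖ < n * r → ‖x‖ < m * r →
      f ((n : ℝ)⁻¹ • x) ^ n = f ((m : ℝ)⁻¹ • x) ^ m := by
    intro n m x hn hm h1 h2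
    rw [hmul hn hm h1, hmul hm hn h2, mul_comm n m]
  set N : E → ℕ := fun x => ⌊‖x‖ / r⌋₊ + 1 with hN
  have hNx : ∀ x, ‖x‖ < N x * r := fun x => by
    have := Nat.lt_floor_add_one (‖x‖ / r)
    rw [div_lt_iff₀ hr] at this
    simpa [hN] using this
  have hN0 : ∀ x, 0 < N x := fun x => Nat.succ_pos _
  refine ⟨fun x => f ((N x : ℝ)⁻¹ • x) ^ N x, by simp [h0], fun x y => ?_, fun x hx => ?_,
    fun x => ⟨N x, _, hle (hN0 x) (hNx x), rfl⟩⟩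
  · set n := N x + N y with hn
    have hn0 : 0 < n := Nat.add_pos_left (hN0 x) _
    have hnr : (n : ℝ) * r = N x * r + N y * r := by rw [hn]; push_cast; ring
    have hx : ‖x‖ < n * r := by
      rw [hnr]; linarith [hNx x, hNx y, norm_nonneg y]
    have hy : ‖y‖ < n * r := by
      rw [hnr]; linarith [hNx x, hNx y, norm_nonneg x]
    have hxy' : ‖x‖ + ‖y‖ < n * r := by
      rw [hnr]; linarith [hNx x, hNx y]
    have hsum : ‖(n : ℝ)⁻¹ • x‖ + ‖(n : ℝ)⁻¹ • y‖ < r := by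
      have : (0 : ℝ) < n := Nat.cast_pos.2 hn0
      rw [norm_smul, norm_smul, norm_inv, Real.norm_natCast, ← mul_add, inv_mul_lt_iff₀ this]
      exact hxy'
    have h1 := hadd _ _ hsum
    have h2 := hadd ((n : ℝ)⁻¹ • y) ((n : ℝ)⁻¹ • x) (by rwa [add_comm])
    -- The target is only a monoid, but values at small vectors commute because addition does; this
    -- allows the $n$-th power of the product to be split.
    have hcomm : Commute (f ((n : ℝ)⁻¹ • x)) (f ((n : ℝ)⁻¹ • y)) := by
      rw [Commute, SemiconjBy, ← h1, ← h2, add_comm]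
    change f ((N (x + y) : ℝ)⁻¹ • (x + y)) ^ N (x + y) = _
    rw [hind (hN0 (x + y)) hn0 (hNx _) ((norm_add_le x y).trans_lt hxy'), smul_add, h1,
      hcomm.mul_pow, ← hind (hN0 x) hn0 (hNx x) hx, ← hind (hN0 y) hn0 (hNx y) hy]
  · change f ((N x : ℝ)⁻¹ • x) ^ N x = f x
    rw [hind (hN0 x) one_pos (hNx x) (by simpa using hx)]
    simp

/-! ### Gluing along the compact leaf -/

section Glue

universe u

variable {M : Type u} [TopologicalSpace M] [ChartedSpace (EuclideanHalfSpace 3) M]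
  {B u : VField M} {ν : DForm 1 M} {S U : Set M}

/-- The transverse coordinates of flow boxes along a compact leaf, glued to a primitive of `ν`. -/
theorem exists_transverse_function [T2Space M] (hSc : IsCompact S)
    (hbox : ∀ x ∈ S, ∃ b : FlowBox B u ν x, b.W ⊆ U ∧ ∀ y ∈ b.W, y ∈ S ↔ (b.χ y).2 = 0) :
    ∃ ψ : M → ℝ, ∀ x ∈ S, ∃ b : FlowBox B u ν x, b.W ⊆ U ∧
      ∀ y ∈ b.W, (y ∈ S ↔ ψ y = 0) ∧ ψ y = b.σ * (b.χ y).2 := by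
  have : LocallyCompactSpace M := Manifold.locallyCompact_of_finiteDimensional (𝓡∂ 3)
  choose b hbU hbS using fun x : S => hbox x x.2
  -- Closed neighbourhoods are used so that a set not containing $x$ is also missed by all points
  -- near $x$.
  have hC : ∀ x : S, ∃ C ∈ 𝓝 x.1, IsClosed C ∧ C ⊆ (b x).W := fun x =>
    exists_mem_nhds_isClosed_subset ((b x).isOpen.mem_nhds (b x).mem)
  choose C hCn hCc hCW using hC
  obtain ⟨t, ht⟩ := hSc.elim_nhds_subcover' (fun x hx => interior (C ⟨x, hx⟩))
    fun x hx => interior_mem_nhds.2 (hCn ⟨x, hx⟩)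
  classical
  set ψ : M → ℝ := fun y => if h : ∃ s ∈ t, y ∈ C s then
    (b h.choose).σ * ((b h.choose).χ y).2 else 0 with hψ
  have key : ∀ x : S, ∀ᶠ y in 𝓝 x.1, ψ y = (b x).σ * ((b x).χ y).2 := by
    intro x
    -- All signed transverse coordinates vanish on $S$, so those defined at $x$ agree near $x$ and
    -- the arbitrary choice made in `ψ` does no harm.
    have h1 : ∀ᶠ y in 𝓝 x.1, ∀ s ∈ t, y ∈ C s →
        (b s).σ * ((b s).χ y).2 = (b x).σ * ((b x).χ y).2 := by
      rw [Filter.eventually_all_finset]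
      intro s hs
      by_cases hxs : x.1 ∈ C s
      · have hxW := hCW s hxs
        have := (b s).eventually_z_eq (b x) hxW (b x).mem (by
          rw [(hbS s x hxW).1 x.2, (b x).χ_self]; simp)
        exact this.mono fun y hy _ => hy
      · filter_upwards [(hCc s).isOpen_compl.mem_nhds hxs] with y hy hy'
        exact absurd hy' hy
    have h2 : ∀ᶠ y in 𝓝 x.1, ∃ s ∈ t, y ∈ C s := by
      obtain ⟨s, hs, hxs⟩ := mem_iUnion₂.1 (ht x.2)
      filter_upwards [isOpen_interior.mem_nhds hxs] with y hy
      exact ⟨s, hs, interior_subset hy⟩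
    filter_upwards [h1, h2] with y hy1 hy2
    rw [hψ]
    simp only [dif_pos hy2]
    exact hy1 _ hy2.choose_spec.1 hy2.choose_spec.2
  refine ⟨ψ, fun x hx => ?_⟩
  obtain ⟨r', h0, hr, hs⟩ := (b ⟨x, hx⟩).exists_shrink (key ⟨x, hx⟩)
  refine ⟨(b ⟨x, hx⟩).shrink r' h0 hr, inter_subset_left.trans (hbU _), fun y hy => ?_⟩
  have h1 : ψ y = (b ⟨x, hx⟩).σ * ((b ⟨x, hx⟩).χ y).2 := hs hy
  refine ⟨?_, h1⟩
  rw [hbS ⟨x, hx⟩ y hy.1, h1]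
  rcases (b ⟨x, hx⟩).sign with h | h <;> simp [h]

/-- Along a compact leaf the sizes of the flow boxes are bounded from below. -/
theorem exists_uniform_flowBox (hSc : IsCompact S) {ψ : M → ℝ}
    (hbox : ∀ x ∈ S, ∃ b : FlowBox B u ν x, b.W ⊆ U ∧
      ∀ y ∈ b.W, (y ∈ S ↔ ψ y = 0) ∧ ψ y = b.σ * (b.χ y).2) :
    ∃ (O : Set M) (ρ : ℝ), IsOpen O ∧ S ⊆ O ∧ 0 < ρ ∧ ∀ y ∈ O, ∃ (x : M) (b : FlowBox B u ν x),
      b.W ⊆ U ∧ (∀ z ∈ b.W, (z ∈ S ↔ ψ z = 0) ∧ ψ z = b.σ * (b.χ z).2) ∧ y ∈ b.W ∧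
      ∀ w : V2, ‖w‖ < ρ → b.χ y + (w, 0) ∈ boxDomain b.k b.r := by
  choose b hbU hbS using fun x : S => hbox x x.2
  have ho : ∀ x : S, IsOpen ((b x).W ∩ (b x).χ ⁻¹' ball 0 ((b x).r / 2)) := fun x =>
    (b x).smooth_χ.continuousOn.isOpen_inter_preimage (b x).isOpen isOpen_ball
  obtain ⟨t, ht⟩ := hSc.elim_nhds_subcover'
    (fun x hx => (b ⟨x, hx⟩).W ∩ (b ⟨x, hx⟩).χ ⁻¹' ball 0 ((b ⟨x, hx⟩).r / 2))
    fun x hx => (ho ⟨x, hx⟩).mem_nhds ⟨(b ⟨x, hx⟩).mem, by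
      rw [mem_preimage, (b ⟨x, hx⟩).χ_self]; exact mem_ball_self (half_pos (b ⟨x, hx⟩).r_pos)⟩
  -- Points within half the radius can be translated by less than half the radius without leaving
  -- the box; finitely many boxes suffice.
  obtain ⟨ρ, hρ, hρt⟩ : ∃ ρ : ℝ, 0 < ρ ∧ ∀ s ∈ t, ρ ≤ (b s).r / 2 := by
    clear ht
    classical
    induction t using Finset.induction_on with
    | empty => exact ⟨1, one_pos, by simp⟩
    | insert a t _ ih =>
      obtain ⟨ρ, hρ, h⟩ := ih
      refine ⟨min ρ ((b a).r / 2), lt_min hρ (half_pos (b a).r_pos), fun s hs => ?_⟩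
      rcases Finset.mem_insert.1 hs with rfl | hs
      · exact min_le_right _ _
      · exact (min_le_left _ _).trans (h s hs)
  refine ⟨⋃ x ∈ t, (b x).W ∩ (b x).χ ⁻¹' ball 0 ((b x).r / 2), ρ, ?_, ht, hρ, ?_⟩
  · exact isOpen_biUnion fun x _ => ho x
  · intro y hy
    obtain ⟨s, hs, hyW, hyb⟩ := mem_iUnion₂.1 hy
    refine ⟨s, b s, hbU s, hbS s, hyW, fun w hw => ?_⟩
    have h1 := (b s).χ_mem y hyW
    refine ⟨?_, ?_⟩
    · have h2 := h1.1
      simp only [mem_halfSpace, lastForm, _root_.smul_apply, ContinuousLinearMap.coe_snd',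
        smul_eq_mul, Prod.snd_add, add_zero] at h2 ⊢
      exact h2
    · rw [mem_ball_zero_iff]
      have h3 : ‖((w, 0) : V2 × ℝ)‖ = ‖w‖ := by simp [Prod.norm_def]
      have h4 : ‖(b s).χ y‖ < (b s).r / 2 := mem_ball_zero_iff.1 hyb
      calc ‖(b s).χ y + (w, 0)‖ ≤ ‖(b s).χ y‖ + ‖((w, 0) : V2 × ℝ)‖ := norm_add_le _ _
        _ < (b s).r := by rw [h3]; linarith [hρt s hs]

end Glue
-- The action of the plane near the leaf
section LeafAction

universe u

variable {M : Type u} [TopologicalSpace M] [ChartedSpace (EuclideanHalfSpace 3) M]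

/-- The action of `ℝ²` generated by the commuting fields `B` and `u` on an invariant open
neighbourhood `V` of a compact leaf `S`, on which `ν` has the primitive `ψ`. -/
structure LeafAction (B u : VField M) (ν : DForm 1 M) (S : Set M) where
  /-- The invariant neighbourhood. -/
  V : Set M
  /-- The action. -/
  φ : V2 → M → M
  /-- The primitive of `ν`. -/
  ψ : M → ℝ
  /-- In every flow box, the vectors of norm less than `ρ` act by translations. -/
  ρ : ℝ
  isOpen : IsOpen V
  subset : S ⊆ V
  ρ_pos : 0 < ρ
  zero : ∀ y, φ 0 y = y
  add : ∀ v w y, φ (v + w) y = φ v (φ w y)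
  mem : ∀ v, ∀ y ∈ V, φ v y ∈ V
  mem_iff : ∀ y ∈ V, y ∈ S ↔ ψ y = 0
  ψ_φ : ∀ v, ∀ y ∈ V, ψ (φ v y) = ψ y
  smooth : ∀ v, ContMDiffOn (𝓡∂ 3) (𝓡∂ 3) ∞ (φ v) V
  flow : ∀ {x : M} (b : FlowBox B u ν x) (q : V2 × ℝ) (w : V2), q ∈ boxDomain b.k b.r →
    b.c q ∈ V → ‖w‖ < ρ → q + (w, 0) ∈ boxDomain b.k b.r → φ w (b.c q) = b.c (q + (w, 0))
  exists_box : ∀ y ∈ V, ∃ (x : M) (b : FlowBox B u ν x), y ∈ b.W ∧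
    ∀ z ∈ b.W, ψ z = b.σ * (b.χ z).2
  exists_center : ∀ x ∈ S, ∃ b : FlowBox B u ν x, b.W ⊆ V ∧
    ∀ z ∈ b.W, ψ z = b.σ * (b.χ z).2

variable [T2Space M] {B u : VField M} {ν : DForm 1 M} {S U : Set M}

/-- A neighbourhood of a compact leaf that is saturated by the level sets of `ψ`. -/
theorem exists_saturated_nhds (hSc : IsCompact S) {ψ : M → ℝ} {O : Set M} (hO : IsOpen O)
    (hSO : S ⊆ O) (hψc : ContinuousOn ψ O) (hψ : ∀ y ∈ O, y ∈ S ↔ ψ y = 0) :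
    ∃ V, IsOpen V ∧ S ⊆ V ∧ V ⊆ O ∧ ∀ P : Set M, IsPreconnected P → (P ∩ V).Nonempty →
      (∀ y ∈ P, ∀ z ∈ P, ψ y = ψ z) → P ⊆ V := by
  have : LocallyCompactSpace M := Manifold.locallyCompact_of_finiteDimensional (𝓡∂ 3)
  obtain ⟨K, hK, hSK, hKO⟩ := exists_compact_between hSc hO hSO
  have hfK : frontier K ⊆ K := hK.isClosed.frontier_subset
  -- On the compact frontier of `K` the function `ψ` has no zero, so $|\psi|\ge\delta>0$ there. A
  -- connected set in a level below $\delta$ cannot cross the frontier.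
  obtain ⟨δ, hδ, hδK⟩ := (hK.of_isClosed_subset isClosed_frontier hfK).exists_forall_le'
    (f := fun y => |ψ y|) (a := 0) ((hψc.mono (hfK.trans hKO)).abs) fun y hy => by
      rw [abs_pos]
      intro h
      exact hy.2 (hSK ((hψ y (hKO (hfK hy))).2 h))
  have hiO : interior K ⊆ O := interior_subset.trans hKO
  refine ⟨interior K ∩ ψ ⁻¹' ball 0 δ,
    (hψc.mono hiO).isOpen_inter_preimage isOpen_interior isOpen_ball,
    fun y hy => ⟨hSK hy, ?_⟩, inter_subset_left.trans hiO, ?_⟩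
  · rw [mem_preimage, (hψ y (hSO hy)).1 hy]
    exact mem_ball_self hδ
  · rintro P hP ⟨y, hyP, hyK, hyδ⟩ hconst
    have hPδ : ∀ z ∈ P, ψ z ∈ ball (0 : ℝ) δ := fun z hz => by
      rw [hconst z hz y hyP]
      exact hyδ
    have hPK : P ⊆ interior K := by
      refine hP.subset_left_of_subset_union isOpen_interior hK.isClosed.isOpen_compl
        (disjoint_compl_right.mono_left interior_subset) (fun z hz => ?_) ⟨y, hyP, hyK⟩
      by_contra h
      rw [Set.mem_union, not_or, mem_compl_iff, not_not] at h
      have h1 := hδK z ⟨subset_closure h.2, h.1⟩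
      have h2 := hPδ z hz
      rw [mem_ball_zero_iff, Real.norm_eq_abs] at h2
      exact h1.not_gt h2
    exact fun z hz => ⟨hPK hz, hPδ z hz⟩

/-- Small vectors act by translations in the boxes; `FlowBox.c_add_eq` shows that the box does not
matter. Extended by the identity outside `V`, these maps form a local homomorphism into
`Function.End M`, and `exists_extension_of_local_hom` gives the action. -/
theorem exists_leafAction (hSc : IsCompact S)
    (hbox : ∀ x ∈ S, ∃ b : FlowBox B u ν x, b.W ⊆ U ∧ ∀ y ∈ b.W, y ∈ S ↔ (b.χ y).2 = 0) :
    ∃ A : LeafAction B u ν S, A.V ⊆ U := by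
  obtain ⟨ψ, hψ⟩ := exists_transverse_function hSc hbox
  obtain ⟨O, ρ, hO, hSO, hρ, hOb⟩ := exists_uniform_flowBox hSc hψ
  have hψO : ∀ y ∈ O, y ∈ S ↔ ψ y = 0 := fun y hy => by
    obtain ⟨x, b, -, h1, h2, -⟩ := hOb y hy
    exact (h1 y h2).1
  have hψc : ContinuousOn ψ O := fun y hy => by
    obtain ⟨x, b, -, h1, h2, -⟩ := hOb y hy
    have h3 : ContinuousAt (fun z => b.σ * (b.χ z).2) y :=
      continuousAt_const.mul (continuous_snd.continuousAt.comp
        (b.smooth_χ.continuousOn.continuousAt (b.isOpen.mem_nhds h2)))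
    refine (h3.congr ?_).continuousWithinAt
    filter_upwards [b.isOpen.mem_nhds h2] with z hz
    exact (h1 z hz).2.symm
  obtain ⟨V, hV, hSV, hVO, hVP⟩ := exists_saturated_nhds hSc hO hSO hψc hψO
  choose x b hbU hbψ hbW hbρ using fun y : O => hOb y y.2
  classical
  -- the local action
  set f : V2 → Function.End M := fun w y => if h : y ∈ V then
    (b ⟨y, hVO h⟩).c ((b ⟨y, hVO h⟩).χ y + (w, 0)) else y with hf
  have hfV : ∀ w y (h : y ∈ V), f w y =
    (b ⟨y, hVO h⟩).c ((b ⟨y, hVO h⟩).χ y + (w, 0)) := fun w y h => dif_pos h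
  have hfn : ∀ w y, y ∉ V → f w y = y := fun w y h => dif_neg h
  have hf0 : f 0 = 1 := by
    funext y
    change f 0 y = y
    by_cases h : y ∈ V
    · rw [hfV 0 y h, show ((0, 0) : V2 × ℝ) = 0 from rfl, add_zero, (b _).c_χ y (hbW _)]
    · exact hfn 0 y h
  have hflow : ∀ {x : M} (b' : FlowBox B u ν x) (q : V2 × ℝ) (w : V2),
      q ∈ boxDomain b'.k b'.r → b'.c q ∈ V → ‖w‖ < ρ → q + (w, 0) ∈ boxDomain b'.k b'.r →
      f w (b'.c q) = b'.c (q + (w, 0)) := by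
    intro x b' q w hq hqV hw hqw
    rw [hfV w _ hqV]
    exact (b _).c_add_eq b' ((b _).χ_mem _ (hbW ⟨b'.c q, hVO hqV⟩)) hq
      (hbρ ⟨b'.c q, hVO hqV⟩ w hw) hqw ((b _).c_χ _ (hbW ⟨b'.c q, hVO hqV⟩))
  have hmem : ∀ w, ‖w‖ < ρ → ∀ y ∈ V, f w y ∈ V ∧ ψ (f w y) = ψ y := by
    intro w hw y hy
    have hyO := hVO hy
    set b' := b ⟨y, hyO⟩
    have hyW : y ∈ b'.W := hbW ⟨y, hyO⟩
    have hseg : ∀ t ∈ Icc (0 : ℝ) 1, b'.χ y + t • ((w, 0) : V2 × ℝ) ∈ boxDomain b'.k b'.r :=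
      fun t ht => (convex_boxDomain _ _).add_smul_mem (b'.χ_mem y hyW) (hbρ ⟨y, hyO⟩ w hw) ht
    have hcont : ContinuousOn (fun t : ℝ => b'.c (b'.χ y + t • ((w, 0) : V2 × ℝ))) (Icc 0 1) :=
      b'.continuousOn_c.comp (by fun_prop) hseg
    have hψt : ∀ t ∈ Icc (0 : ℝ) 1,
        ψ (b'.c (b'.χ y + t • ((w, 0) : V2 × ℝ))) = b'.σ * (b'.χ y).2 := by
      intro t ht
      rw [(hbψ ⟨y, hyO⟩ _ (b'.c_mem _ (hseg t ht))).2, b'.χ_c _ (hseg t ht), Prod.snd_add,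
        Prod.smul_snd, smul_zero, add_zero]
    -- The translation path is connected and stays in one level of `ψ`, so saturation keeps it
    -- inside `V`.
    have hP := hVP _ (isPreconnected_Icc.image _ hcont)
      ⟨y, ⟨0, left_mem_Icc.2 zero_le_one, by simp [b'.c_χ y hyW]⟩, hy⟩ (by
        rintro _ ⟨t, ht, rfl⟩ _ ⟨s, hs, rfl⟩
        exact (hψt t ht).trans (hψt s hs).symm)
    have h1 : f w y = b'.c (b'.χ y + (1 : ℝ) • ((w, 0) : V2 × ℝ)) := by
      rw [one_smul]
      exact hfV w y hy
    rw [h1]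
    refine ⟨hP ⟨1, right_mem_Icc.2 zero_le_one, rfl⟩, ?_⟩
    rw [hψt 1 (right_mem_Icc.2 zero_le_one)]
    exact (hbψ ⟨y, hyO⟩ y hyW).2.symm
  have hsmooth : ∀ w, ‖w‖ < ρ → ContMDiffOn (𝓡∂ 3) (𝓡∂ 3) ∞ (f w) V := by
    intro w hw y hy
    have hyO := hVO hy
    set b' := b ⟨y, hyO⟩
    have hyW : y ∈ b'.W := hbW ⟨y, hyO⟩
    have hχc := b'.smooth_χ.continuousOn.continuousAt (b'.isOpen.mem_nhds hyW)
    have hnear : ∀ᶠ z in 𝓝 y, b'.χ z + (w, 0) ∈ boxDomain b'.k b'.r := by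
      have h1 : ∀ᶠ z in 𝓝 y, b'.χ z + (w, 0) ∈ ball (0 : V2 × ℝ) b'.r :=
        (hχc.add continuousAt_const).eventually (isOpen_ball.mem_nhds (hbρ ⟨y, hyO⟩ w hw).2)
      filter_upwards [h1, b'.isOpen.mem_nhds hyW] with z hz hzW
      refine ⟨?_, hz⟩
      have h2 := (b'.χ_mem z hzW).1
      simp only [mem_halfSpace, lastForm, _root_.smul_apply, ContinuousLinearMap.coe_snd',
        smul_eq_mul, Prod.snd_add, add_zero] at h2 ⊢
      exact h2
    have h2 : ContMDiffWithinAt (𝓡∂ 3) (𝓡∂ 3) ∞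
        (b'.c ∘ fun z => b'.χ z + (w, 0)) (V ∩ {z | b'.χ z + (w, 0) ∈ boxDomain b'.k b'.r}) y := by
      refine (b'.smooth_c _ (hbρ ⟨y, hyO⟩ w hw)).comp y ?_ fun z hz => hz.2
      have h3 : ContMDiffAt (𝓡∂ 3) 𝓘(ℝ, V2 × ℝ) ∞ b'.χ y :=
        b'.smooth_χ.contMDiffAt (b'.isOpen.mem_nhds hyW)
      exact (h3.add contMDiffAt_const).contMDiffWithinAt
    have h3 : ContMDiffAt (𝓡∂ 3) (𝓡∂ 3) ∞ (b'.c ∘ fun z => b'.χ z + (w, 0)) y :=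
      h2.contMDiffAt (inter_mem (hV.mem_nhds hy) hnear)
    refine (h3.congr_of_eventuallyEq ?_).contMDiffWithinAt
    filter_upwards [hnear, b'.isOpen.mem_nhds hyW, hV.mem_nhds hy] with z hz hzW hzV
    have := hflow b' (b'.χ z) w (b'.χ_mem z hzW) (by rwa [b'.c_χ z hzW]) hw hz
    rwa [b'.c_χ z hzW] at this
  have hadd : ∀ v w, ‖v‖ + ‖w‖ < ρ → f (v + w) = f v * f w := by
    intro v w hvw
    funext y
    change f (v + w) y = f v (f w y)
    by_cases hy : y ∈ V
    · have hw : ‖w‖ < ρ := by linarith [norm_nonneg v]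
      have hv : ‖v‖ < ρ := by linarith [norm_nonneg w]
      have h1 := hbρ ⟨y, hVO hy⟩ w hw
      have h2 := hbρ ⟨y, hVO hy⟩ (v + w) ((norm_add_le v w).trans_lt hvw)
      have h3 := (hmem w hw y hy).1
      have e : ∀ q : V2 × ℝ, q + (w, 0) + (v, 0) = q + (v + w, 0) := fun q => by
        rw [add_assoc]
        congr 1
        rw [Prod.mk_add_mk, add_zero, add_comm w v]
      rw [hfV w y hy] at h3 ⊢
      rw [hfV (v + w) y hy, hflow _ _ v h1 h3 hv (by rwa [e]), e]
    · rw [hfn _ _ hy, hfn _ _ hy, hfn _ _ hy]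
  obtain ⟨φ, hφ0, hφa, hφf, hφn⟩ := exists_extension_of_local_hom hρ hf0 hadd
  -- Every element acts as a power of a small one, so a reflexive and transitive relation need only
  -- be checked for small vectors.
  have hpow : ∀ (p : M → M → Prop), (∀ y, p y y) → (∀ x y z, p x y → p y z → p x z) →
      (∀ w, ‖w‖ < ρ → ∀ y ∈ V, p y (f w y)) → ∀ v, ∀ y ∈ V, φ v y ∈ V ∧ p y (φ v y) := by
    intro p hp0 hp hpf v y hy
    obtain ⟨n, w, hw, h⟩ := hφn v
    rw [h]
    clear h
    induction n with
    | zero => exact ⟨hy, hp0 y⟩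
    | succ n ih =>
      rw [pow_succ']
      exact ⟨(hmem w hw _ ih.1).1, hp _ _ _ ih.2 (hpf w hw _ ih.1)⟩
  refine ⟨{
    V := V
    φ := φ
    ψ := ψ
    ρ := ρ
    isOpen := hV
    subset := hSV
    ρ_pos := hρ
    zero := fun y => by rw [hφ0]; rfl
    add := fun v w y => by rw [hφa]; rfl
    mem := fun v y hy => (hpow (fun _ _ => True) (fun _ => trivial) (fun _ _ _ _ _ => trivial)
      (fun _ _ _ _ => trivial) v y hy).1
    mem_iff := fun y hy => hψO y (hVO hy)
    ψ_φ := fun v y hy => (hpow (fun y z => ψ z = ψ y) (fun _ => rfl)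
      (fun _ _ _ h1 h2 => h2.trans h1) (fun w hw y hy => (hmem w hw y hy).2) v y hy).2
    smooth := fun v => ?_
    flow := fun b' q w h1 h2 h3 h4 => by rw [hφf w h3]; exact hflow b' q w h1 h2 h3 h4
    exists_box := fun y hy => ⟨_, b ⟨y, hVO hy⟩, hbW _, fun z hz => (hbψ _ z hz).2⟩
    exists_center := fun x hx => ?_ }, ?_⟩
  · obtain ⟨n, w, hw, h⟩ := hφn v
    rw [h]
    clear h
    have : MapsTo (f w ^ n) V V ∧ ContMDiffOn (𝓡∂ 3) (𝓡∂ 3) ∞ (f w ^ n) V := by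
      induction n with
      | zero => exact ⟨mapsTo_id V, contMDiffOn_id⟩
      | succ n ih =>
        rw [pow_succ']
        exact ⟨fun y hy => (hmem w hw _ (ih.1 hy)).1, (hsmooth w hw).comp ih.2 ih.1⟩
    exact this.2
  · obtain ⟨b', hb', h⟩ := hψ x hx
    obtain ⟨r', h0, hr, hs⟩ := b'.exists_shrink (hV.mem_nhds (hSV hx))
    exact ⟨b'.shrink r' h0 hr, hs, fun z hz => (h z hz.1).2⟩
  · intro y hy
    exact hbU ⟨y, hVO hy⟩ (hbW _)

end LeafAction
-- Orbits and isotropy on the leaf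
section Orbit

universe u

variable {M : Type u} [TopologicalSpace M] [ChartedSpace (EuclideanHalfSpace 3) M]
  {B u : VField M} {ν : DForm 1 M} {S : Set M}

namespace LeafAction

theorem φ_neg_φ (A : LeafAction B u ν S) (v : V2) (y : M) : A.φ (-v) (A.φ v y) = y := by
  rw [← A.add, neg_add_cancel, A.zero]

theorem φ_φ_neg (A : LeafAction B u ν S) (v : V2) (y : M) : A.φ v (A.φ (-v) y) = y := by
  rw [← A.add, add_neg_cancel, A.zero]

theorem φ_mem_leaf (A : LeafAction B u ν S) (v : V2) {y : M} (hy : y ∈ S) : A.φ v y ∈ S := by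
  have hV := A.subset hy
  rw [A.mem_iff _ (A.mem v y hV), A.ψ_φ v y hV]
  exact (A.mem_iff y hV).1 hy

/-- In a box centred at `x` the points of $S$ have last coordinate zero, so their first two
coordinates are the vector that carries `x` to them. -/
theorem eventually_orbit (A : LeafAction B u ν S) {x : M} (hx : x ∈ S) {ε : ℝ} (hε : 0 < ε) :
    ∀ᶠ y in 𝓝 x, y ∈ S → ∃ w : V2, ‖w‖ < ε ∧ A.φ w x = y := by
  obtain ⟨b, hbV, hbψ⟩ := A.exists_center x hx
  have hc := b.smooth_χ.continuousOn.continuousAt (b.isOpen.mem_nhds b.mem)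
  have h1 : ∀ᶠ y in 𝓝 x, b.χ y ∈ ball (0 : V2 × ℝ) (min ε A.ρ) :=
    hc.eventually (by rw [b.χ_self]; exact ball_mem_nhds _ (lt_min hε A.ρ_pos))
  filter_upwards [h1, b.isOpen.mem_nhds b.mem] with y hy hyW hyS
  have h2 : (b.χ y).2 = 0 := by
    have h3 := (A.mem_iff y (A.subset hyS)).1 hyS
    rw [hbψ y hyW] at h3
    rcases b.sign with h | h <;> simpa [h] using h3
  have h3 : b.χ y = 0 + ((b.χ y).1, 0) := by rw [zero_add, ← h2]
  have h4 : ‖(b.χ y).1‖ < min ε A.ρ :=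
    (norm_fst_le _).trans_lt (mem_ball_zero_iff.1 hy)
  refine ⟨(b.χ y).1, h4.trans_le (min_le_left _ _), ?_⟩
  have h5 := A.flow b 0 (b.χ y).1 (zero_mem_boxDomain _ b.r_pos)
    (by rw [b.c_zero]; exact A.subset hx) (h4.trans_le (min_le_right _ _))
    (h3 ▸ b.χ_mem y hyW)
  rwa [b.c_zero, ← h3, b.c_χ y hyW] at h5

/-- The action is transitive on a connected leaf. -/
theorem exists_φ_eq (A : LeafAction B u ν S) (hS : IsPreconnected S) {x y : M} (hx : x ∈ S)
    (hy : y ∈ S) : ∃ v, A.φ v x = y := by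
  have : PreconnectedSpace S := Subtype.preconnectedSpace hS
  have hev : ∀ s : S, ∀ᶠ z : S in 𝓝 s, ∃ w, A.φ w s = z := fun s => by
    filter_upwards [continuous_subtype_val.continuousAt.eventually
      (A.eventually_orbit s.2 one_pos)] with z hz
    exact (hz z.2).imp fun _ h => h.2
  -- By `eventually_orbit`, orbits in $S$ are open; so is the complement of an orbit, and
  -- connectedness leaves only one.
  have hclopen : IsClopen {s : S | ∃ v, A.φ v x = s} := by
    constructor
    · rw [← isOpen_compl_iff, isOpen_iff_mem_nhds]
      intro s hs
      filter_upwards [hev s] with z ⟨w, hw⟩ ⟨v, hv⟩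
      exact hs ⟨-w + v, by rw [A.add, hv, ← hw, A.φ_neg_φ]⟩
    · rw [isOpen_iff_mem_nhds]
      rintro s ⟨v, hv⟩
      filter_upwards [hev s] with z ⟨w, hw⟩
      exact ⟨w + v, by rw [A.add, hv, hw]⟩
  have h := hclopen.eq_univ ⟨⟨x, hx⟩, 0, A.zero x⟩
  exact h.ge (mem_univ (⟨y, hy⟩ : S))

/-- Compactness of $S$ bounds the vectors needed for transitivity; this is what makes the isotropy
group cocompact. -/
theorem exists_bounded_φ_eq (A : LeafAction B u ν S) (hS : IsPreconnected S) (hSc : IsCompact S)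
    {x : M} (hx : x ∈ S) : ∃ R : ℝ, ∀ y ∈ S, ∃ v, ‖v‖ < R ∧ A.φ v x = y := by
  have key : ∃ R : ℝ, ∀ y ∈ S, y ∈ S → ∃ v, ‖v‖ < R ∧ A.φ v x = y := by
    refine hSc.induction_on (p := fun T => ∃ R : ℝ, ∀ y ∈ T, y ∈ S → ∃ v, ‖v‖ < R ∧ A.φ v x = y)
      ⟨0, by simp⟩ (fun s t hst ⟨R, h⟩ => ⟨R, fun y hy => h y (hst hy)⟩) ?_ ?_
    · rintro s t ⟨R, h⟩ ⟨R', h'⟩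
      refine ⟨max R R', fun y hy hyS => ?_⟩
      rcases hy with hy | hy
      · exact (h y hy hyS).imp fun _ h => ⟨h.1.trans_le (le_max_left _ _), h.2⟩
      · exact (h' y hy hyS).imp fun _ h => ⟨h.1.trans_le (le_max_right _ _), h.2⟩
    · intro y hy
      obtain ⟨v, hv⟩ := A.exists_φ_eq hS hx hy
      refine ⟨_, mem_nhdsWithin_of_mem_nhds (A.eventually_orbit hy one_pos), 1 + ‖v‖,
        fun z hz hzS => ?_⟩
      obtain ⟨w, hw, h⟩ := hz hzS
      exact ⟨w + v, (norm_add_le _ _).trans_lt (add_lt_add_left hw _), by rw [A.add, hv, h]⟩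
  obtain ⟨R, h⟩ := key
  exact ⟨R, fun y hy => h y hy hy⟩

/-- The isotropy group of a point. -/
def stabilizer (A : LeafAction B u ν S) (x : M) : AddSubgroup V2 where
  carrier := {v | A.φ v x = x}
  zero_mem' := A.zero x
  add_mem' {v w} hv hw := by
    change A.φ (v + w) x = x
    rw [A.add, hw, hv]
  neg_mem' {v} hv := by
    change A.φ (-v) x = x
    conv_lhs => rw [← show A.φ v x = x from hv]
    exact A.φ_neg_φ v x

theorem mem_stabilizer (A : LeafAction B u ν S) {x : M} {v : V2} :
    v ∈ A.stabilizer x ↔ A.φ v x = x := Iff.rfl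

/-- Small vectors move the points of a flow box. -/
theorem eq_zero_of_φ_c_eq (A : LeafAction B u ν S) {x : M} (b : FlowBox B u ν x) {q : V2 × ℝ}
    {w : V2} (hq : q ∈ boxDomain b.k b.r) (hqV : b.c q ∈ A.V) (hw : ‖w‖ < A.ρ)
    (hqw : q + (w, 0) ∈ boxDomain b.k b.r) (h : A.φ w (b.c q) = b.c q) : w = 0 := by
  rw [A.flow b q w hq hqV hw hqw] at h
  have h1 := congrArg b.χ h
  rw [b.χ_c _ hqw, b.χ_c _ hq, add_eq_left] at h1
  exact congrArg Prod.fst h1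

/-- A small vector acts near `x` as a translation of a box, on which the chart is injective. -/
theorem exists_stabilizer_discrete (A : LeafAction B u ν S) {x : M} (hx : x ∈ S) :
    ∃ ε > 0, ∀ v ∈ A.stabilizer x, ‖v‖ < ε → v = 0 := by
  obtain ⟨b, hbV, hbψ⟩ := A.exists_center x hx
  refine ⟨min A.ρ b.r, lt_min A.ρ_pos b.r_pos, fun v hv hvε => ?_⟩
  refine A.eq_zero_of_φ_c_eq b (q := 0) (zero_mem_boxDomain _ b.r_pos)
    (by rw [b.c_zero]; exact A.subset hx) (hvε.trans_le (min_le_left _ _)) ?_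
    (by rw [b.c_zero]; exact hv)
  rw [zero_add]
  refine ⟨by simp [mem_halfSpace, lastForm], ?_⟩
  rw [mem_ball_zero_iff, Prod.norm_def]
  simpa using hvε.trans_le (min_le_right _ _)

end LeafAction

end Orbit

/-! ### Lattices and linear algebra in the plane -/

/-- A discrete cocompact subgroup of the plane is a lattice. -/
theorem exists_lattice_basis (Λ : AddSubgroup V2) (hd : ∃ ε > 0, ∀ v ∈ Λ, ‖v‖ < ε → v = 0)
    (hc : ∃ R : ℝ, ∀ v : V2, ∃ l ∈ Λ, ‖v - l‖ < R) :
    ∃ l₁ l₂ : V2, l₁.1 * l₂.2 - l₁.2 * l₂.1 ≠ 0 ∧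
      ∀ v, v ∈ Λ ↔ ∃ m n : ℤ, v = (m : ℝ) • l₁ + (n : ℝ) • l₂ := by
  obtain ⟨ε, hε, hd⟩ := hd
  obtain ⟨R, hR⟩ := hc
  set L : Submodule ℤ V2 := Λ.toIntSubmodule with hL
  have hdisc : DiscreteTopology L := by
    rw [discreteTopology_iff_isOpen_singleton_zero, Metric.isOpen_singleton_iff]
    refine ⟨ε, hε, fun y hy => Subtype.ext (hd _ y.2 ?_)⟩
    rw [dist_zero_right] at hy
    exact hy
  -- Were the span proper, Riesz's lemma would give a direction `x₀` such that $tx_0$ is at distance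
  -- at least $t\|x_0\|/2$ from it. The choice of `t` makes this $|R|+1$, against cocompactness.
  have hspan : Submodule.span ℝ (L : Set V2) = ⊤ := by
    by_contra h
    set F := Submodule.span ℝ (L : Set V2) with hF
    have hex : ∃ x, x ∉ F := by
      by_contra! h'
      exact h (Submodule.eq_top_iff'.2 h')
    obtain ⟨x₀, hx₀, hr⟩ := riesz_lemma F.closed_of_finiteDimensional hex
      (r := 1 / 2) (by norm_num)
    have hx0 : 0 < ‖x₀‖ := norm_pos_iff.2 fun h => hx₀ (h ▸ F.zero_mem)
    set t : ℝ := 2 * (|R| + 1) / ‖x₀‖ with ht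
    have htp : 0 < t := by positivity
    obtain ⟨l, hl, hlR⟩ := hR (t • x₀)
    have hlF : t⁻¹ • l ∈ F := F.smul_mem _ (Submodule.subset_span hl)
    have h1 := hr _ hlF
    have h2 : ‖t • x₀ - l‖ = t * ‖x₀ - t⁻¹ • l‖ := by
      rw [← abs_of_pos htp, ← Real.norm_eq_abs, ← norm_smul, smul_sub, smul_smul, Real.norm_eq_abs,
        abs_of_pos htp, mul_inv_cancel₀ htp.ne', one_smul]
    have h3 : t * (1 / 2 * ‖x₀‖) = |R| + 1 := by
      rw [ht]; field_simp
    have h4 := mul_le_mul_of_nonneg_left h1 htp.le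
    rw [← h2, h3] at h4
    linarith [le_abs_self R]
  have hZ : IsZLattice ℝ L := ⟨hspan⟩
  have hfree : Module.Free ℤ L := ZLattice.module_free ℝ L
  have hfin : Module.Finite ℤ L := ZLattice.module_finite ℝ L
  have hrank : Module.finrank ℤ L = 2 := by
    rw [ZLattice.rank ℝ L]; simp [V2]
  set e := Module.finBasisOfFinrankEq ℤ L hrank with he
  set e' := e.ofZLatticeBasis ℝ L with he'
  have hv : ∀ i, e' i = (e i : V2) := fun i => e.ofZLatticeBasis_apply ℝ L i
  refine ⟨e 0, e 1, fun hdet => ?_, fun v => ⟨fun hv => ?_, ?_⟩⟩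
  -- A vanishing determinant gives two linear relations whose coefficients are coordinates of the
  -- basis vectors; independence then forces the first vector to be zero.
  · have hli := Fintype.linearIndependent_iff.1 e'.linearIndependent
    have hpair : ∀ s t : ℝ, s • (e 0 : V2) + t • (e 1 : V2) = 0 → s = 0 ∧ t = 0 := by
      intro s t hst
      have h := hli ![s, t] (by rw [Fin.sum_univ_two, hv, hv]; exact hst)
      exact ⟨h 0, h 1⟩
    obtain ⟨h1, h2⟩ := hpair (e 1 : V2).2 (-(e 0 : V2).2) (Prod.ext
      (by simp only [Prod.fst_add, Prod.smul_fst, smul_eq_mul, Prod.fst_zero]; linarith)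
      (by simp only [Prod.snd_add, Prod.smul_snd, smul_eq_mul, Prod.snd_zero]; ring))
    obtain ⟨h3, h4⟩ := hpair (e 1 : V2).1 (-(e 0 : V2).1) (Prod.ext
      (by simp only [Prod.fst_add, Prod.smul_fst, smul_eq_mul, Prod.fst_zero]; ring)
      (by simp only [Prod.snd_add, Prod.smul_snd, smul_eq_mul, Prod.snd_zero]; linarith))
    exact (hv 0 ▸ e'.ne_zero 0) (Prod.ext (neg_eq_zero.1 h4) (neg_eq_zero.1 h2))
  · have h := congrArg Subtype.val (e.sum_repr (⟨v, hv⟩ : L))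
    rw [Fin.sum_univ_two] at h
    simp only [Submodule.coe_add, Submodule.coe_smul] at h
    refine ⟨e.repr (⟨v, hv⟩ : L) 0, e.repr (⟨v, hv⟩ : L) 1, ?_⟩
    rw [Int.cast_smul_eq_zsmul, Int.cast_smul_eq_zsmul]
    exact h.symm
  · rintro ⟨m, n, rfl⟩
    rw [Int.cast_smul_eq_zsmul, Int.cast_smul_eq_zsmul]
    exact Λ.add_mem (Λ.zsmul_mem (e 0).2 m) (Λ.zsmul_mem (e 1).2 n)

/-- The linear combination of two vectors of the plane with coefficients `x`. -/
def planeComb (l₁ l₂ x : V2) : V2 := x.1 • l₁ + x.2 • l₂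

/-- The determinant of two vectors of the plane. -/
def planeDet (l₁ l₂ : V2) : ℝ := l₁.1 * l₂.2 - l₁.2 * l₂.1

/-- The coordinates of `w` with respect to two vectors of the plane. -/
noncomputable def planeCoord (l₁ l₂ w : V2) : V2 :=
  ((w.1 * l₂.2 - w.2 * l₂.1) / planeDet l₁ l₂, (l₁.1 * w.2 - l₁.2 * w.1) / planeDet l₁ l₂)

theorem planeCoord_planeComb {l₁ l₂ : V2} (h : planeDet l₁ l₂ ≠ 0) (x : V2) :
    planeCoord l₁ l₂ (planeComb l₁ l₂ x) = x := by
  ext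
  · simp only [planeCoord, planeComb, Prod.fst_add, Prod.snd_add, Prod.smul_fst, Prod.smul_snd,
      smul_eq_mul]
    rw [div_eq_iff h, planeDet]; ring
  · simp only [planeCoord, planeComb, Prod.fst_add, Prod.snd_add, Prod.smul_fst, Prod.smul_snd,
      smul_eq_mul]
    rw [div_eq_iff h, planeDet]; ring

theorem planeComb_planeCoord {l₁ l₂ : V2} (h : planeDet l₁ l₂ ≠ 0) (w : V2) :
    planeComb l₁ l₂ (planeCoord l₁ l₂ w) = w := by
  ext
  · simp only [planeCoord, planeComb, Prod.fst_add, Prod.smul_fst, smul_eq_mul]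
    field_simp
    rw [planeDet]; ring
  · simp only [planeCoord, planeComb, Prod.snd_add, Prod.smul_snd, smul_eq_mul]
    field_simp
    rw [planeDet]; ring

theorem planeComb_add (l₁ l₂ x y : V2) :
    planeComb l₁ l₂ (x + y) = planeComb l₁ l₂ x + planeComb l₁ l₂ y := by
  simp only [planeComb, Prod.fst_add, Prod.snd_add]; module

theorem planeComb_zero (l₁ l₂ : V2) : planeComb l₁ l₂ 0 = 0 := by
  simp [planeComb]

/-- The values of the last coordinate in a flow box. -/
def transversal (k r : ℝ) : Set ℝ := {z | 0 ≤ k * z ∧ |z| < r}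

theorem mk_mem_boxDomain {k r : ℝ} {w : V2} {z : ℝ} :
    (w, z) ∈ boxDomain k r ↔ z ∈ transversal k r ∧ ‖w‖ < r := by
  simp only [boxDomain, mem_inter_iff, mem_halfSpace, lastForm, _root_.smul_apply,
    ContinuousLinearMap.coe_snd', smul_eq_mul, mem_ball_zero_iff, Prod.norm_def, sup_lt_iff,
    transversal, mem_ofPred_eq, Real.norm_eq_abs]
  tauto

theorem zero_mk_mem_boxDomain {k r : ℝ} {z : ℝ} :
    ((0 : V2), z) ∈ boxDomain k r ↔ z ∈ transversal k r := by
  rw [mk_mem_boxDomain, norm_zero, and_iff_left_iff_imp]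
  exact fun h => (abs_nonneg z).trans_lt h.2

theorem transversal_mono (k : ℝ) {r r' : ℝ} (h : r' ≤ r) : transversal k r' ⊆ transversal k r :=
  fun _ hz => ⟨hz.1, hz.2.trans_le h⟩

theorem zero_mem_transversal (k : ℝ) {r : ℝ} (hr : 0 < r) : (0 : ℝ) ∈ transversal k r :=
  ⟨by simp, by simpa⟩

theorem ordConnected_transversal (k r : ℝ) : (transversal k r).OrdConnected := by
  have h1 : transversal k r = ((fun z : ℝ => k * z) ⁻¹' Ici 0) ∩ ball 0 r := by
    ext z; simp [transversal]
  rw [h1, ← convex_iff_ordConnected]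
  exact ((convex_Ici 0).linear_preimage (LinearMap.mulLeft ℝ k)).inter (convex_ball _ _)

theorem transversal_nontrivial (k : ℝ) {r : ℝ} (hr : 0 < r) : (transversal k r).Nontrivial := by
  have h2 : |r / 2| < r := by rw [abs_of_pos (half_pos hr)]; exact half_lt_self hr
  rcases le_total 0 k with hk | hk
  · exact ⟨0, zero_mem_transversal k hr, r / 2, ⟨by positivity, h2⟩, (half_pos hr).ne⟩
  · refine ⟨0, zero_mem_transversal k hr, -(r / 2), ⟨?_, by rwa [abs_neg]⟩, by linarith⟩
    rw [mul_neg, neg_nonneg]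
    exact mul_nonpos_of_nonpos_of_nonneg hk (half_pos hr).le

theorem exists_transversal_of_mem_nhdsWithin {k r : ℝ} {s : Set ℝ} (hr : 0 < r)
    (hs : s ∈ 𝓝[transversal k r] 0) : ∃ ε, 0 < ε ∧ ε ≤ r ∧ transversal k ε ⊆ s := by
  obtain ⟨ε, hε, h⟩ := Metric.mem_nhdsWithin_iff.1 hs
  refine ⟨min ε r, lt_min hε hr, min_le_right _ _, fun z hz => h ⟨?_, ?_⟩⟩
  · rw [mem_ball_zero_iff]
    exact hz.2.trans_le (min_le_left _ _)
  · exact transversal_mono k (min_le_right _ _) hz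

/-! ### Deformation of a single period -/

section Periods

universe u

variable {M : Type u} [TopologicalSpace M] [ChartedSpace (EuclideanHalfSpace 3) M]
  {B u : VField M} {ν : DForm 1 M} {S : Set M} {p : M}

/-- A flow box at `p` which is adapted to the action. -/
structure LeafAction.AdaptedBox (A : LeafAction B u ν S) (p : M) extends FlowBox B u ν p where
  subset : W ⊆ A.V
  ψ_eq : ∀ z ∈ W, A.ψ z = σ * (χ z).2
  flow : ∀ q ∈ boxDomain k r, ∀ w : V2, q + (w, 0) ∈ boxDomain k r → A.φ w (c q) = c (q + (w, 0))

namespace LeafAction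

theorem exists_adaptedBox (A : LeafAction B u ν S) (hp : p ∈ S) :
    Nonempty (A.AdaptedBox p) := by
  obtain ⟨b, hbV, hbψ⟩ := A.exists_center p hp
  -- In a box of radius at most $\rho/2$, two points differ by less than $\rho$, so the size
  -- condition in `LeafAction.flow` holds automatically.
  have h0 : 0 < min b.r (A.ρ / 2) := lt_min b.r_pos (half_pos A.ρ_pos)
  refine ⟨{ b.shrink _ h0 (min_le_left _ _) with
    subset := inter_subset_left.trans hbV
    ψ_eq := fun z hz => hbψ z hz.1
    flow := fun q hq w hqw => ?_ }⟩
  refine A.flow b q w (boxDomain_mono _ (min_le_left _ _) hq)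
    (hbV (b.c_mem _ (boxDomain_mono _ (min_le_left _ _) hq))) ?_
    (boxDomain_mono _ (min_le_left _ _) hqw)
  have h1 := mem_ball_zero_iff.1 hq.2
  have h2 := mem_ball_zero_iff.1 hqw.2
  have h3 : ‖w‖ ≤ ‖((w, 0) : V2 × ℝ)‖ := norm_fst_le ((w, 0) : V2 × ℝ)
  have h4 : ‖((w, 0) : V2 × ℝ)‖ ≤ ‖q + (w, 0)‖ + ‖q‖ := by
    have := norm_sub_le (q + (w, 0)) q
    rwa [add_sub_cancel_left] at this
  have h5 : min b.r (A.ρ / 2) ≤ A.ρ / 2 := min_le_right _ _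
  change ‖q‖ < min b.r (A.ρ / 2) at h1
  change ‖q + (w, 0)‖ < min b.r (A.ρ / 2) at h2
  linarith

variable {A : LeafAction B u ν S}

theorem AdaptedBox.flow_zero (b : A.AdaptedBox p) {w : V2} {z : ℝ}
    (h : (w, z) ∈ boxDomain b.k b.r) : A.φ w (b.c (0, z)) = b.c (w, z) := by
  have h1 := b.flow (0, z) (zero_mk_mem_boxDomain.2 (mk_mem_boxDomain.1 h).1) w
  rw [Prod.mk_add_mk, zero_add, add_zero] at h1
  exact h1 h

theorem AdaptedBox.c_mem_V (b : A.AdaptedBox p) {q : V2 × ℝ} (h : q ∈ boxDomain b.k b.r) :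
    b.c q ∈ A.V := b.subset (b.c_mem q h)

theorem AdaptedBox.ψ_c (b : A.AdaptedBox p) {q : V2 × ℝ} (h : q ∈ boxDomain b.k b.r) :
    A.ψ (b.c q) = b.σ * q.2 := by
  rw [b.ψ_eq _ (b.c_mem q h), b.χ_c q h]

theorem AdaptedBox.σ_ne (b : A.AdaptedBox p) : b.σ ≠ 0 := by
  rcases b.sign with h | h <;> simp [h]

/-- Periods extend to the neighbouring leaves. -/
theorem AdaptedBox.exists_deformed_period (b : A.AdaptedBox p) {l : V2}
    (hl : l ∈ A.stabilizer p) : ∃ ε, 0 < ε ∧ ε ≤ b.r ∧ ∃ l' : ℝ → V2, l' 0 = l ∧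
      ContDiffOn ℝ ∞ l' (transversal b.k ε) ∧
      ∀ z ∈ transversal b.k ε, A.φ (l' z) (b.c (0, z)) = b.c (0, z) := by
  set g : ℝ → M := fun z => A.φ l (b.c (0, z)) with hg
  have hmem : ∀ z ∈ transversal b.k b.r, ((0, z) : V2 × ℝ) ∈ boxDomain b.k b.r :=
    fun z hz => zero_mk_mem_boxDomain.2 hz
  have h0 : ContDiff ℝ ∞ (fun z : ℝ => ((0, z) : V2 × ℝ)) := contDiff_const.prodMk contDiff_id
  have hgs : ContMDiffOn 𝓘(ℝ, ℝ) (𝓡∂ 3) ∞ g (transversal b.k b.r) :=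
    (A.smooth l).comp (b.smooth_c.comp h0.contMDiff.contMDiffOn hmem)
      fun z hz => b.c_mem_V (hmem z hz)
  have hg0 : g 0 = p := by
    have h1 : b.c ((0, 0) : V2 × ℝ) = p := b.c_zero
    rw [hg]
    simp only [h1]
    exact hl
  have hW : g ⁻¹' b.W ∈ 𝓝[transversal b.k b.r] 0 :=
    (hgs.continuousOn 0 (zero_mem_transversal _ b.r_pos)).preimage_mem_nhdsWithin
      (b.isOpen.mem_nhds (by rw [hg0]; exact b.mem))
  obtain ⟨ε, hε, hεr, hεW⟩ := exists_transversal_of_mem_nhdsWithin b.r_pos hW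
  have hsub := transversal_mono b.k hεr
  -- The vector `l` returns $c(0,z)$ to the box on the same leaf; subtracting the displacement read
  -- off in the chart corrects it to an exact period.
  refine ⟨ε, hε, hεr, fun z => l - (b.χ (g z)).1, ?_, ?_, fun z hz => ?_⟩
  · simp only [hg0, b.χ_self]
    simp
  · have h1 : ContMDiffOn 𝓘(ℝ, ℝ) 𝓘(ℝ, V2 × ℝ) ∞ (b.χ ∘ g) (transversal b.k ε) :=
      b.smooth_χ.comp (hgs.mono hsub) hεW
    exact contDiffOn_const.sub (contDiff_fst.comp_contDiffOn h1.contDiffOn)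
  -- The action preserves `ψ`, so the returned point still has last coordinate $z$.
  · have hzW : g z ∈ b.W := hεW hz
    have h1 : (b.χ (g z)).2 = z := by
      have h2 := b.ψ_eq _ hzW
      rw [hg] at h2
      simp only at h2
      rw [A.ψ_φ l _ (b.c_mem_V (hmem z (hsub hz))), b.ψ_c (hmem z (hsub hz))] at h2
      exact (mul_left_cancel₀ b.σ_ne h2).symm
    have h3 : b.χ (g z) + (-(b.χ (g z)).1, 0) = (0, z) := by
      ext <;> simp [h1]
    have h4 := b.flow _ (b.χ_mem _ hzW) (-(b.χ (g z)).1) (by rw [h3]; exact hmem z (hsub hz))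
    rw [h3, b.c_χ _ hzW] at h4
    change A.φ (l - (b.χ (g z)).1) _ = _
    rw [sub_eq_neg_add, A.add]
    exact h4

/-- The parametrization of a neighbourhood of the leaf by `ℝ² × ℝ`. -/
def AdaptedBox.param (b : A.AdaptedBox p) (l₁ l₂ : ℝ → V2) (q : V2 × ℝ) : M :=
  A.φ (planeComb (l₁ q.2) (l₂ q.2) q.1) (b.c (0, q.2))

theorem contDiffOn_planeComb {l₁ l₂ : ℝ → V2} {T : Set ℝ} (h₁ : ContDiffOn ℝ ∞ l₁ T)
    (h₂ : ContDiffOn ℝ ∞ l₂ T) :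
    ContDiffOn ℝ ∞ (fun q : V2 × ℝ => planeComb (l₁ q.2) (l₂ q.2) q.1) (univ ×ˢ T) := by
  have e1 : ContDiffOn ℝ ∞ (fun q : V2 × ℝ => l₁ q.2) (univ ×ˢ T) :=
    h₁.comp contDiff_snd.contDiffOn fun q hq => hq.2
  have e2 : ContDiffOn ℝ ∞ (fun q : V2 × ℝ => l₂ q.2) (univ ×ˢ T) :=
    h₂.comp contDiff_snd.contDiffOn fun q hq => hq.2
  have e3 : ContDiffOn ℝ ∞ (fun q : V2 × ℝ => q.1.1) (univ ×ˢ T) :=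
    (contDiff_fst.comp contDiff_fst).contDiffOn
  have e4 : ContDiffOn ℝ ∞ (fun q : V2 × ℝ => q.1.2) (univ ×ˢ T) :=
    (contDiff_snd.comp contDiff_fst).contDiffOn
  exact (e3.smul e1).add (e4.smul e2)

/-- Splitting off a fixed vector `v` leaves a displacement small enough to be a translation in the
box. Smoothness and local inverses of the parametrization are read off in this way. -/
theorem AdaptedBox.param_eq (b : A.AdaptedBox p) (l₁ l₂ : ℝ → V2) (v : V2) {q : V2 × ℝ}
    (h : (planeComb (l₁ q.2) (l₂ q.2) q.1 - v, q.2) ∈ boxDomain b.k b.r) :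
    b.param l₁ l₂ q = A.φ v (b.c (planeComb (l₁ q.2) (l₂ q.2) q.1 - v, q.2)) := by
  rw [← b.flow_zero h, ← A.add, add_sub_cancel]
  rfl

theorem AdaptedBox.eventually_mem_boxDomain (b : A.AdaptedBox p) {l₁ l₂ : ℝ → V2} {ε : ℝ}
    (hε : ε ≤ b.r) (h₁ : ContDiffOn ℝ ∞ l₁ (transversal b.k ε))
    (h₂ : ContDiffOn ℝ ∞ l₂ (transversal b.k ε)) {q₀ : V2 × ℝ}
    (hq₀ : q₀ ∈ (univ : Set V2) ×ˢ transversal b.k ε) :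
    ∀ᶠ q in 𝓝[univ ×ˢ transversal b.k ε] q₀, (planeComb (l₁ q.2) (l₂ q.2) q.1 -
      planeComb (l₁ q₀.2) (l₂ q₀.2) q₀.1, q.2) ∈ boxDomain b.k b.r := by
  have h1 := (((contDiffOn_planeComb h₁ h₂).continuousOn q₀ hq₀).sub
    (continuousWithinAt_const (b := planeComb (l₁ q₀.2) (l₂ q₀.2) q₀.1))).eventually
      (isOpen_ball.mem_nhds (x := _) (s := ball 0 b.r) (by
        change planeComb (l₁ q₀.2) (l₂ q₀.2) q₀.1 - planeComb (l₁ q₀.2) (l₂ q₀.2) q₀.1 ∈ _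
        rw [sub_self]; exact mem_ball_self b.r_pos))
  filter_upwards [h1, self_mem_nhdsWithin] with q hq hqT
  rw [mk_mem_boxDomain]
  exact ⟨transversal_mono _ hε hqT.2, mem_ball_zero_iff.1 hq⟩

/-- `LeafAction.smooth` only concerns a fixed vector. Near `q₀` the acting vector is the fixed one
at `q₀` plus a small one, and the small part is absorbed in the smooth map `b.c`. -/
theorem AdaptedBox.contMDiffOn_param (b : A.AdaptedBox p) {l₁ l₂ : ℝ → V2} {ε : ℝ}
    (hε : ε ≤ b.r) (h₁ : ContDiffOn ℝ ∞ l₁ (transversal b.k ε))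
    (h₂ : ContDiffOn ℝ ∞ l₂ (transversal b.k ε)) :
    ContMDiffOn 𝓘(ℝ, V2 × ℝ) (𝓡∂ 3) ∞ (b.param l₁ l₂) (univ ×ˢ transversal b.k ε) := by
  intro q₀ hq₀
  have hev := b.eventually_mem_boxDomain hε h₁ h₂ hq₀
  set v := planeComb (l₁ q₀.2) (l₂ q₀.2) q₀.1
  set D := (univ : Set V2) ×ˢ transversal b.k ε
  set f : V2 × ℝ → V2 × ℝ := fun q => (planeComb (l₁ q.2) (l₂ q.2) q.1 - v, q.2)
  have hf : ContDiffOn ℝ ∞ f D :=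
    ((contDiffOn_planeComb h₁ h₂).sub contDiffOn_const).prodMk contDiff_snd.contDiffOn
  have hD : D ∩ f ⁻¹' boxDomain b.k b.r ∈ 𝓝[D] q₀ := inter_mem self_mem_nhdsWithin hev
  have h1 : ContMDiffOn 𝓘(ℝ, V2 × ℝ) (𝓡∂ 3) ∞ (A.φ v ∘ b.c ∘ f) (D ∩ f ⁻¹' boxDomain b.k b.r) :=
    (A.smooth v).comp (b.smooth_c.comp (hf.mono inter_subset_left).contMDiffOn fun q hq => hq.2)
      fun q hq => b.c_mem_V hq.2
  have hq : q₀ ∈ D ∩ f ⁻¹' boxDomain b.k b.r := mem_of_mem_nhdsWithin hq₀ hD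
  refine ((h1 q₀ hq).mono_of_mem_nhdsWithin hD).congr_of_eventuallyEq ?_ ?_
  · filter_upwards [hev] with q hq using b.param_eq l₁ l₂ v hq
  · exact b.param_eq l₁ l₂ v hq.2

end LeafAction

end Periods

/-! ### Bases of the isotropy groups of the nearby leaves -/

section Periods

universe u

variable {M : Type u} [TopologicalSpace M] [ChartedSpace (EuclideanHalfSpace 3) M]
  {B u : VField M} {ν : DForm 1 M} {S : Set M} {p : M}

namespace LeafAction

/-- Bases of the isotropy groups along a transversal of the leaf. -/
structure Periods (A : LeafAction B u ν S) (p : M) where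
  /-- The flow box. -/
  b : A.AdaptedBox p
  /-- The size of the transversal. -/
  ε : ℝ
  /-- The first basis vector. -/
  l₁ : ℝ → V2
  /-- The second basis vector. -/
  l₂ : ℝ → V2
  ε_pos : 0 < ε
  ε_le : ε ≤ b.r
  smooth₁ : ContDiffOn ℝ ∞ l₁ (transversal b.k ε)
  smooth₂ : ContDiffOn ℝ ∞ l₂ (transversal b.k ε)
  det_ne : ∀ z ∈ transversal b.k ε, planeDet (l₁ z) (l₂ z) ≠ 0
  period : ∀ z ∈ transversal b.k ε, ∀ x : V2,
    b.param l₁ l₂ (x, z) = b.c (0, z) ↔ ∃ m n : ℤ, x = ((m : ℝ), (n : ℝ))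

/-- Cocompactness: any `v` differs from an isotropy element by a bounded vector that reaches the
same point of the orbit. -/
theorem exists_stabilizer_basis (A : LeafAction B u ν S) (hS : IsPreconnected S)
    (hSc : IsCompact S) (hp : p ∈ S) : ∃ l₁ l₂ : V2, planeDet l₁ l₂ ≠ 0 ∧
      ∀ v, v ∈ A.stabilizer p ↔ ∃ m n : ℤ, v = (m : ℝ) • l₁ + (n : ℝ) • l₂ := by
  refine exists_lattice_basis _ (A.exists_stabilizer_discrete hp) ?_
  obtain ⟨R, hR⟩ := A.exists_bounded_φ_eq hS hSc hp
  refine ⟨R, fun v => ?_⟩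
  obtain ⟨w, hw, h⟩ := hR _ (A.φ_mem_leaf v hp)
  refine ⟨-w + v, ?_, by simpa using hw⟩
  rw [A.mem_stabilizer, A.add, ← h, A.φ_neg_φ]

theorem continuousWithinAt_planeDet {l₁ l₂ : ℝ → V2} {T : Set ℝ} {z : ℝ}
    (h₁ : ContinuousWithinAt l₁ T z) (h₂ : ContinuousWithinAt l₂ T z) :
    ContinuousWithinAt (fun z => planeDet (l₁ z) (l₂ z)) T z :=
  (h₁.fst.mul h₂.snd).sub (h₁.snd.mul h₂.fst)

variable {A : LeafAction B u ν S}

theorem AdaptedBox.param_intCast (b : A.AdaptedBox p) {l₁ l₂ : ℝ → V2} {z : ℝ}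
    (h₁ : A.φ (l₁ z) (b.c (0, z)) = b.c (0, z)) (h₂ : A.φ (l₂ z) (b.c (0, z)) = b.c (0, z))
    (m n : ℤ) : b.param l₁ l₂ (((m : ℝ), (n : ℝ)), z) = b.c (0, z) := by
  change planeComb (l₁ z) (l₂ z) ((m : ℝ), (n : ℝ)) ∈ A.stabilizer (b.c (0, z))
  simp only [planeComb]
  rw [Int.cast_smul_eq_zsmul, Int.cast_smul_eq_zsmul]
  exact (A.stabilizer _).add_mem ((A.stabilizer _).zsmul_mem h₁ m)
    ((A.stabilizer _).zsmul_mem h₂ n)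

theorem AdaptedBox.param_add (b : A.AdaptedBox p) (l₁ l₂ : ℝ → V2) (x y : V2) (z : ℝ) :
    b.param l₁ l₂ (x + y, z) = A.φ (planeComb (l₁ z) (l₂ z) x) (b.param l₁ l₂ (y, z)) := by
  simp only [param, planeComb_add, A.add]

variable [T2Space M]

/-- Near $x_0=0$, injectivity of the box leaves only the zero coordinate. If $x_0\neq 0$, the square
of half-width $1/2$ contains no other integer point, so $x_0$ is not a period on $S$, an open
condition. -/
theorem AdaptedBox.eventually_param_ne (b : A.AdaptedBox p) {l₁ l₂ : ℝ → V2} {ε : ℝ}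
    (hε0 : 0 < ε) (hε : ε ≤ b.r) (h₁ : ContDiffOn ℝ ∞ l₁ (transversal b.k ε))
    (h₂ : ContDiffOn ℝ ∞ l₂ (transversal b.k ε))
    (hdet : ∀ z ∈ transversal b.k ε, planeDet (l₁ z) (l₂ z) ≠ 0)
    (hstab : ∀ v, v ∈ A.stabilizer p ↔ ∃ m n : ℤ, v = (m : ℝ) • l₁ 0 + (n : ℝ) • l₂ 0)
    {x₀ : V2} (hx₀ : x₀ ∈ closedBall (0 : V2) (1 / 2)) :
    ∀ᶠ q in 𝓝[univ ×ˢ transversal b.k ε] (x₀, (0 : ℝ)),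
      b.param l₁ l₂ q = b.c (0, q.2) → q.1 = 0 := by
  have h0 : (0 : ℝ) ∈ transversal b.k ε := zero_mem_transversal _ hε0
  have hq₀ : (x₀, (0 : ℝ)) ∈ (univ : Set V2) ×ˢ transversal b.k ε := ⟨mem_univ _, h0⟩
  by_cases hx : x₀ = 0
  · have h1 := b.eventually_mem_boxDomain hε h₁ h₂ hq₀
    subst hx
    simp only [planeComb_zero, sub_zero] at h1
    filter_upwards [h1, self_mem_nhdsWithin] with q hq hqT h
    have hq' : (planeComb (l₁ q.2) (l₂ q.2) q.1 - 0, q.2) ∈ boxDomain b.k b.r := by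
      rwa [sub_zero]
    rw [b.param_eq l₁ l₂ 0 hq', A.zero, sub_zero] at h
    have h2 := congrArg b.χ h
    rw [b.χ_c _ hq, b.χ_c _ (zero_mk_mem_boxDomain.2 (mk_mem_boxDomain.1 hq).1)] at h2
    have h3 : planeComb (l₁ q.2) (l₂ q.2) q.1 = 0 := congrArg Prod.fst h2
    have h4 := planeCoord_planeComb (hdet _ hqT.2) (0 : V2)
    rw [planeComb_zero] at h4
    rw [← planeCoord_planeComb (hdet _ hqT.2) q.1, h3, h4]
  · have hc1 := (b.contMDiffOn_param hε h₁ h₂).continuousOn _ hq₀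
    have hc2 : ContinuousWithinAt (fun q : V2 × ℝ => b.c (0, q.2))
        (univ ×ˢ transversal b.k ε) (x₀, 0) := by
      have hd : ContinuousOn (fun q : V2 × ℝ => b.c (0, q.2)) (univ ×ˢ transversal b.k ε) :=
        b.continuousOn_c.comp (by fun_prop)
          fun q hq => zero_mk_mem_boxDomain.2 (transversal_mono _ hε hq.2)
      exact hd _ hq₀
    have hne : b.param l₁ l₂ (x₀, 0) ≠ b.c (0, 0) := by
      intro h
      have h00 : b.c ((0 : V2), (0 : ℝ)) = p := b.c_zero
      have h' : planeComb (l₁ 0) (l₂ 0) x₀ ∈ A.stabilizer p := by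
        rw [A.mem_stabilizer]
        conv_lhs => rw [← h00]
        exact h.trans h00
      obtain ⟨m, n, hmn⟩ := (hstab _).1 h'
      have h2 : x₀ = ((m : ℝ), (n : ℝ)) := by
        rw [← planeCoord_planeComb (hdet 0 h0) x₀, hmn,
          ← planeCoord_planeComb (hdet 0 h0) ((m : ℝ), (n : ℝ))]
        rfl
      have hint : ∀ m : ℤ, |(m : ℝ)| ≤ 1 / 2 → m = 0 := fun m hm => by
        rw [← Int.abs_lt_one_iff, ← Int.cast_lt (R := ℝ)]
        push_cast
        linarith
      rw [mem_closedBall_zero_iff, Prod.norm_def, max_le_iff, h2] at hx₀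
      apply hx
      rw [h2, hint m hx₀.1, hint n hx₀.2]
      simp
    filter_upwards [(Filter.Tendsto.prodMk_nhds hc1 hc2).eventually (isOpen_ne_fun continuous_fst continuous_snd |>.mem_nhds hne)] with q hq h
    exact absurd h hq

/-- A lattice basis on $S$ deforms to periods of the nearby leaves. The point is that no further
periods appear, which follows from `AdaptedBox.eventually_param_ne` and compactness of the square.
-/
theorem exists_periods (A : LeafAction B u ν S) (hS : IsPreconnected S) (hSc : IsCompact S)
    (hp : p ∈ S) : Nonempty (A.Periods p) := by
  obtain ⟨b⟩ := A.exists_adaptedBox hp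
  obtain ⟨e₁, e₂, hdet, hstab⟩ := A.exists_stabilizer_basis hS hSc hp
  have he₁ : e₁ ∈ A.stabilizer p := (hstab e₁).2 ⟨1, 0, by simp⟩
  have he₂ : e₂ ∈ A.stabilizer p := (hstab e₂).2 ⟨0, 1, by simp⟩
  obtain ⟨ε₁, hε₁, hε₁r, l₁, hl₁0, hl₁, hl₁p⟩ := b.exists_deformed_period he₁
  obtain ⟨ε₂, hε₂, hε₂r, l₂, hl₂0, hl₂, hl₂p⟩ := b.exists_deformed_period he₂
  set ε₃ := min ε₁ ε₂ with hε₃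
  have hε₃0 : 0 < ε₃ := lt_min hε₁ hε₂
  have hs₁ := transversal_mono b.k (min_le_left ε₁ ε₂)
  have hs₂ := transversal_mono b.k (min_le_right ε₁ ε₂)
  have h0 : (0 : ℝ) ∈ transversal b.k ε₃ := zero_mem_transversal _ hε₃0
  have hdetc := continuousWithinAt_planeDet ((hl₁.mono hs₁).continuousOn 0 h0)
    ((hl₂.mono hs₂).continuousOn 0 h0)
  have hdetn : {z | planeDet (l₁ z) (l₂ z) ≠ 0} ∈ 𝓝[transversal b.k ε₃] 0 :=
    hdetc.tendsto.eventually_ne (by simpa only [hl₁0, hl₂0] using hdet)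
  obtain ⟨ε₄, hε₄, hε₄₃, hε₄d⟩ := exists_transversal_of_mem_nhdsWithin hε₃0 hdetn
  have hs₃ := transversal_mono b.k hε₄₃
  have hε₄r : ε₄ ≤ b.r := hε₄₃.trans ((min_le_left _ _).trans hε₁r)
  -- One transversal works for the whole fundamental square.
  have hc := (isCompact_closedBall (0 : V2) (1 / 2)).eventually_forall_of_forall_eventually
    (x₀ := (0 : ℝ)) (P := fun z x => z ∈ transversal b.k ε₄ →
      b.param l₁ l₂ (x, z) = b.c (0, z) → x = 0) (by
    intro x₀ hx₀
    have h1 := b.eventually_param_ne hε₄ hε₄r (hl₁.mono (hs₃.trans hs₁))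
      (hl₂.mono (hs₃.trans hs₂)) hε₄d (by rw [hl₁0, hl₂0]; exact hstab) hx₀
    rw [eventually_nhdsWithin_iff] at h1
    have h2 : Tendsto (fun q : ℝ × V2 => (q.2, q.1)) (𝓝 (0, x₀)) (𝓝 (x₀, 0)) :=
      continuous_swap.continuousAt
    filter_upwards [h2.eventually h1] with q hq hqT
    exact hq ⟨mem_univ _, hqT⟩)
  obtain ⟨ε, hε, hε₄', hεs⟩ := exists_transversal_of_mem_nhdsWithin hε₄
    (nhdsWithin_le_nhds hc)
  have hs := transversal_mono b.k hε₄'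
  have hint : ∀ z ∈ transversal b.k ε, ∀ m n : ℤ,
      b.param l₁ l₂ (((m : ℝ), (n : ℝ)), z) = b.c (0, z) := fun z hz m n =>
    b.param_intCast (hl₁p z (hs₁ (hs₃ (hs hz)))) (hl₂p z (hs₂ (hs₃ (hs hz)))) m n
  refine ⟨⟨b, ε, l₁, l₂, hε, hε₄'.trans hε₄r, hl₁.mono (hs.trans (hs₃.trans hs₁)),
    hl₂.mono (hs.trans (hs₃.trans hs₂)), fun z hz => hε₄d (hs hz),
    fun z hz x => ⟨fun h => ⟨round x.1, round x.2, ?_⟩, ?_⟩⟩⟩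
  -- Rounding moves any period into the square by integral periods, where it must be zero.
  · have h1 : b.param l₁ l₂ (x - ((round x.1 : ℝ), (round x.2 : ℝ)), z) = b.c (0, z) := by
      have h2 := hint z hz (-round x.1) (-round x.2)
      have h3 := b.param_add l₁ l₂ (((-round x.1 : ℤ) : ℝ), ((-round x.2 : ℤ) : ℝ)) x z
      rw [h] at h3
      rw [show x - ((round x.1 : ℝ), (round x.2 : ℝ)) =
        (((-round x.1 : ℤ) : ℝ), ((-round x.2 : ℤ) : ℝ)) + x by ext <;> simp [sub_eq_neg_add]]
      exact h3.trans h2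
    have h2 := hεs hz _ (by
      rw [mem_closedBall_zero_iff, Prod.norm_def]
      exact max_le (abs_sub_round x.1) (abs_sub_round x.2)) (hs hz) h1
    exact sub_eq_zero.1 h2
  · rintro ⟨m, n, rfl⟩
    exact hint z hz m n

end LeafAction

end Periods

/-! ### The parametrization by the plane and the transversal -/

section Param

universe u

variable {M : Type u} [TopologicalSpace M] [ChartedSpace (EuclideanHalfSpace 3) M]
  {B u : VField M} {ν : DForm 1 M} {S : Set M} {p : M}

namespace LeafAction

/-- The velocities of the action. -/
theorem mfderiv_φ_smul (A : LeafAction B u ν S) {y : M} (hy : y ∈ A.V) (w : V2) :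
    mfderiv 𝓘(ℝ, ℝ) (𝓡∂ 3) (fun t : ℝ => A.φ (t • w) y) 0 (1 : ℝ) = w.1 • B y + w.2 • u y := by
  obtain ⟨x, b, hyW, -⟩ := A.exists_box y hy
  set D := boxDomain b.k b.r
  have hq := b.χ_mem y hyW
  set q := b.χ y
  have hcq : b.c q = y := b.c_χ y hyW
  set f : ℝ → V2 × ℝ := fun t => q + t • ((w, 0) : V2 × ℝ) with hf
  have hf' : HasFDerivAt f (ContinuousLinearMap.toSpanSingleton ℝ ((w, 0) : V2 × ℝ)) 0 := by
    have h1 : HasDerivAt f ((1 : ℝ) • ((w, 0) : V2 × ℝ)) 0 :=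
      ((hasDerivAt_id (0 : ℝ)).smul_const ((w, 0) : V2 × ℝ)).const_add q
    rw [one_smul] at h1
    exact h1.hasFDerivAt
  have hf0 : f 0 = q := by simp [hf]
  have hfD : ∀ᶠ t in 𝓝 (0 : ℝ), f t ∈ D := by
    have h1 : ∀ᶠ t in 𝓝 (0 : ℝ), f t ∈ ball (0 : V2 × ℝ) b.r :=
      hf'.continuousAt.eventually (by rw [hf0]; exact isOpen_ball.mem_nhds hq.2)
    filter_upwards [h1] with t ht
    refine ⟨?_, ht⟩
    have h2 := hq.1
    simp only [mem_halfSpace, lastForm, _root_.smul_apply, ContinuousLinearMap.coe_snd',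
      smul_eq_mul, Prod.snd_add, Prod.smul_snd, mul_zero, add_zero, hf] at h2 ⊢
    exact h2
  have hd := (b.hasMFDerivWithinAt_c (q := f 0) (by rwa [hf0])).comp (0 : ℝ)
    (hf'.hasMFDerivAt.hasMFDerivWithinAt (s := f ⁻¹' D)) Subset.rfl
  have hd' := hd.hasMFDerivAt hfD
  have heq : (fun t : ℝ => A.φ (t • w) y) =ᶠ[𝓝 0] b.c ∘ f := by
    have h1 : ∀ᶠ t in 𝓝 (0 : ℝ), t • w ∈ ball (0 : V2) A.ρ := by
      have : ContinuousAt (fun t : ℝ => t • w) 0 := by fun_prop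
      exact this.eventually (by
        simp only [zero_smul]
        exact ball_mem_nhds _ A.ρ_pos)
    filter_upwards [h1, hfD] with t ht htD
    have e : f t = q + (t • w, 0) := by simp [hf]
    rw [Function.comp_apply, e]
    rw [e] at htD
    have := A.flow b q (t • w) hq (by rwa [hcq]) (mem_ball_zero_iff.1 ht) htD
    rwa [hcq] at this
  have hd2 := hd'.congr_of_eventuallyEq heq
  rw [hd2.mfderiv]
  refine Eq.trans (b := mfderivWithin 𝓘(ℝ, V2 × ℝ) (𝓡∂ 3) b.c D (f 0) ((w, 0) : V2 × ℝ)) ?_ ?_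
  · refine congrArg (mfderivWithin 𝓘(ℝ, V2 × ℝ) (𝓡∂ 3) b.c D (f 0)) ?_
    exact one_smul ℝ ((w, 0) : V2 × ℝ)
  · have h1 := b.mfderivWithin_c_apply hq w
    rw [hcq] at h1
    rw [hf0]
    exact h1

/-- `ψ` is a primitive of `ν`. -/
theorem mfderiv_ψ (A : LeafAction B u ν S) {y : M} (hy : y ∈ A.V) (v : TangentSpace (𝓡∂ 3) y) :
    mfderiv (𝓡∂ 3) 𝓘(ℝ, ℝ) A.ψ y v = ν y ![v] := by
  obtain ⟨x, b, hyW, hψ⟩ := A.exists_box y hy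
  have h1 : HasMFDerivAt 𝓘(ℝ, V2 × ℝ) 𝓘(ℝ, ℝ) (fun q : V2 × ℝ => b.σ * q.2) (b.χ y)
      (b.σ • ContinuousLinearMap.snd ℝ V2 ℝ) :=
    ((hasFDerivAt_snd (𝕜 := ℝ) (E := V2) (F := ℝ)).const_mul b.σ).hasMFDerivAt
  have h2 := h1.comp y (b.hasMFDerivAt_χ hyW)
  have h3 : A.ψ =ᶠ[𝓝 y] (fun q : V2 × ℝ => b.σ * q.2) ∘ b.χ := by
    filter_upwards [b.isOpen.mem_nhds hyW] with z hz using hψ z hz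
  rw [(h2.congr_of_eventuallyEq h3).mfderiv]
  refine Eq.trans (congrArg (b.σ * ·) (b.deriv_z y hyW v)) ?_
  change b.σ * (b.σ * _) = _
  rw [← mul_assoc, b.sign_mul_self, one_mul]

variable {A : LeafAction B u ν S}

namespace Periods

/-- The set of parameters. -/
def dom (P : A.Periods p) : Set (V2 × ℝ) := univ ×ˢ transversal P.b.k P.ε

/-- The parametrization of a neighbourhood of the leaf. -/
def F (P : A.Periods p) (q : V2 × ℝ) : M := P.b.param P.l₁ P.l₂ q

theorem zero_mk_mem (P : A.Periods p) {q : V2 × ℝ} (hq : q ∈ P.dom) :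
    ((0 : V2), q.2) ∈ boxDomain P.b.k P.b.r :=
  zero_mk_mem_boxDomain.2 (transversal_mono _ P.ε_le hq.2)

theorem F_mem (P : A.Periods p) {q : V2 × ℝ} (hq : q ∈ P.dom) : P.F q ∈ A.V :=
  A.mem _ _ (P.b.c_mem_V (P.zero_mk_mem hq))

theorem ψ_F (P : A.Periods p) {q : V2 × ℝ} (hq : q ∈ P.dom) : A.ψ (P.F q) = P.b.σ * q.2 := by
  rw [F, AdaptedBox.param, A.ψ_φ _ _ (P.b.c_mem_V (P.zero_mk_mem hq)),
    P.b.ψ_c (P.zero_mk_mem hq)]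

theorem contMDiffOn_F (P : A.Periods p) : ContMDiffOn 𝓘(ℝ, V2 × ℝ) (𝓡∂ 3) ∞ P.F P.dom :=
  P.b.contMDiffOn_param P.ε_le P.smooth₁ P.smooth₂

theorem F_add (P : A.Periods p) (x y : V2) (z : ℝ) :
    P.F (x + y, z) = A.φ (planeComb (P.l₁ z) (P.l₂ z) x) (P.F (y, z)) :=
  P.b.param_add P.l₁ P.l₂ x y z

/-- The invariant `ψ` separates the values of $z$; on one leaf the action reduces the question to
the periods. -/
theorem F_eq_iff (P : A.Periods p) {x y : V2} {z z' : ℝ} (hz : z ∈ transversal P.b.k P.ε)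
    (hz' : z' ∈ transversal P.b.k P.ε) :
    P.F (x, z) = P.F (y, z') ↔ z = z' ∧ ∃ m n : ℤ, x = y + ((m : ℝ), (n : ℝ)) := by
  have key : P.F (x, z) = P.F (y, z) ↔ ∃ m n : ℤ, x = y + ((m : ℝ), (n : ℝ)) := by
    have h1 : P.F (x, z) = P.F (y, z) ↔ P.F (x - y, z) = P.b.c (0, z) := by
      have e1 : P.F (x, z) = A.φ (planeComb (P.l₁ z) (P.l₂ z) y) (P.F (x - y, z)) := by
        rw [← P.F_add, add_sub_cancel]
      have e2 : P.F (y, z) = A.φ (planeComb (P.l₁ z) (P.l₂ z) y) (P.b.c (0, z)) := rfl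
      rw [e1, e2]
      constructor
      · intro h
        have := congrArg (A.φ (-planeComb (P.l₁ z) (P.l₂ z) y)) h
        rwa [A.φ_neg_φ, A.φ_neg_φ] at this
      · exact fun h => congrArg _ h
    rw [h1, F, P.period z hz]
    simp only [sub_eq_iff_eq_add']
  constructor
  · intro h
    have h1 : z = z' := by
      have h2 := congrArg A.ψ h
      rw [P.ψ_F ⟨mem_univ _, hz⟩, P.ψ_F ⟨mem_univ _, hz'⟩] at h2
      exact mul_left_cancel₀ P.b.σ_ne h2
    subst h1
    exact ⟨rfl, key.1 h⟩
  · rintro ⟨rfl, h⟩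
    exact key.2 h

/-- The parametrization has smooth local sections. -/
theorem exists_local_section (P : A.Periods p) {q₀ : V2 × ℝ} (hq₀ : q₀ ∈ P.dom) :
    ∃ (N : Set M) (G : M → V2 × ℝ), IsOpen N ∧ P.F q₀ ∈ N ∧
      ContMDiffOn (𝓡∂ 3) 𝓘(ℝ, V2 × ℝ) ∞ G N ∧ MapsTo G N P.dom ∧ ∀ y ∈ N, P.F (G y) = y := by
  set b := P.b
  set v := planeComb (P.l₁ q₀.2) (P.l₂ q₀.2) q₀.1
  set N₁ : Set M := A.V ∩ A.φ (-v) ⁻¹' b.W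
  have hN₁ : IsOpen N₁ := (A.smooth (-v)).continuousOn.isOpen_inter_preimage A.isOpen b.isOpen
  set g : M → V2 × ℝ := b.χ ∘ A.φ (-v)
  have hg : ContMDiffOn (𝓡∂ 3) 𝓘(ℝ, V2 × ℝ) ∞ g N₁ :=
    b.smooth_χ.comp ((A.smooth (-v)).mono inter_subset_left) fun y hy => hy.2
  have hF : A.φ (-v) (P.F q₀) = b.c (0, q₀.2) := A.φ_neg_φ v _
  have hq₀D := P.zero_mk_mem hq₀
  have hgF : g (P.F q₀) = (0, q₀.2) := by
    change b.χ (A.φ (-v) (P.F q₀)) = _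
    rw [hF, b.χ_c _ hq₀D]
  have hN : IsOpen (N₁ ∩ g ⁻¹' {q | |q.2| < P.ε}) :=
    hg.continuousOn.isOpen_inter_preimage hN₁
      (isOpen_lt (continuous_abs.comp continuous_snd) continuous_const)
  have hT : ∀ y ∈ N₁ ∩ g ⁻¹' {q | |q.2| < P.ε}, (g y).2 ∈ transversal b.k P.ε := fun y hy =>
    ⟨(mk_mem_boxDomain.1 (b.χ_mem _ hy.1.2)).1.1, hy.2⟩
  -- The section brings the point back into the box by $-v$, reads off the vector from the
  -- transversal, and expresses $v$ plus this vector in the basis of periods.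
  set H : V2 × ℝ → V2 × ℝ := fun q => (planeCoord (P.l₁ q.2) (P.l₂ q.2) (v + q.1), q.2)
  have hH : ContDiffOn ℝ ∞ H (univ ×ˢ transversal b.k P.ε) := by
    have e1 : ContDiffOn ℝ ∞ (fun q : V2 × ℝ => P.l₁ q.2) (univ ×ˢ transversal b.k P.ε) :=
      P.smooth₁.comp contDiff_snd.contDiffOn fun q hq => hq.2
    have e2 : ContDiffOn ℝ ∞ (fun q : V2 × ℝ => P.l₂ q.2) (univ ×ˢ transversal b.k P.ε) :=
      P.smooth₂.comp contDiff_snd.contDiffOn fun q hq => hq.2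
    have e3 : ContDiffOn ℝ ∞ (fun q : V2 × ℝ => v + q.1) (univ ×ˢ transversal b.k P.ε) :=
      (contDiff_const.add contDiff_fst).contDiffOn
    have e4 : ContDiffOn ℝ ∞ (fun q : V2 × ℝ => planeDet (P.l₁ q.2) (P.l₂ q.2))
        (univ ×ˢ transversal b.k P.ε) := (e1.fst.mul e2.snd).sub (e1.snd.mul e2.fst)
    have hne : ∀ q ∈ (univ : Set V2) ×ˢ transversal b.k P.ε,
      planeDet (P.l₁ q.2) (P.l₂ q.2) ≠ 0 := fun q hq => P.det_ne _ hq.2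
    exact ((((e3.fst.mul e2.snd).sub (e3.snd.mul e2.fst)).div e4 hne).prodMk
      (((e1.fst.mul e3.snd).sub (e1.snd.mul e3.fst)).div e4 hne)).prodMk contDiff_snd.contDiffOn
  refine ⟨N₁ ∩ g ⁻¹' {q | |q.2| < P.ε}, H ∘ g, hN, ⟨⟨P.F_mem hq₀, ?_⟩, ?_⟩,
    hH.contMDiffOn.comp (hg.mono inter_subset_left) fun y hy => ⟨mem_univ _, hT y hy⟩,
    fun y hy => ⟨mem_univ _, hT y hy⟩, fun y hy => ?_⟩
  · rw [mem_preimage, hF]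
    exact b.c_mem _ hq₀D
  · rw [mem_preimage, hgF]
    exact hq₀.2.2
  · have h1 := P.det_ne _ (hT y hy)
    change A.φ (planeComb (P.l₁ (g y).2) (P.l₂ (g y).2)
      (planeCoord (P.l₁ (g y).2) (P.l₂ (g y).2) (v + (g y).1))) (b.c (0, (g y).2)) = y
    rw [planeComb_planeCoord h1, A.add, b.flow_zero (w := (g y).1) (z := (g y).2)
      (b.χ_mem _ hy.1.2)]
    change A.φ v (b.c (b.χ (A.φ (-v) y))) = y
    rw [b.c_χ _ hy.1.2, A.φ_φ_neg]

theorem isOpen_image (P : A.Periods p) : IsOpen (P.F '' P.dom) := by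
  rw [isOpen_iff_mem_nhds]
  rintro _ ⟨q, hq, rfl⟩
  obtain ⟨N, G, hN, hqN, -, hG, hFG⟩ := P.exists_local_section hq
  exact mem_of_superset (hN.mem_nhds hqN) fun y hy => ⟨G y, hG hy, hFG y hy⟩

theorem subset_image (P : A.Periods p) (hS : IsPreconnected S) (hp : p ∈ S) :
    S ⊆ P.F '' P.dom := by
  intro y hy
  obtain ⟨v, rfl⟩ := A.exists_φ_eq hS hp hy
  have h0 := zero_mem_transversal P.b.k P.ε_pos
  refine ⟨(planeCoord (P.l₁ 0) (P.l₂ 0) v, 0), ⟨mem_univ _, h0⟩, ?_⟩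
  have h1 : P.b.c ((0 : V2), (0 : ℝ)) = p := P.b.c_zero
  rw [F, AdaptedBox.param, planeComb_planeCoord (P.det_ne 0 h0), h1]

end Periods

end LeafAction

end Param

/-! ### Local logarithms on the circle -/

section CircleLog

/-- A logarithm on the circle which is smooth near `a₀`. -/
noncomputable def circleLog (a₀ a : Circle) : ℝ :=
  Complex.arg (a * a₀⁻¹ : Circle) + Complex.arg a₀

theorem exp_circleLog (a₀ a : Circle) : Circle.exp (circleLog a₀ a) = a := by
  rw [circleLog, Circle.exp_add, Circle.exp_arg, Circle.exp_arg, inv_mul_cancel_right]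

/-- Rotating `a₀` to $1$ moves it off the branch cut of the argument. -/
theorem contMDiffAt_circleLog (a₀ : Circle) :
    ContMDiffAt (𝓡 1) 𝓘(ℝ, ℝ) ∞ (circleLog a₀) a₀ := by
  have h1 : ContMDiffAt (𝓡 1) (𝓡 1) ∞ (fun a : Circle => a * a₀⁻¹) a₀ :=
    (contMDiff_id.mul contMDiff_const).contMDiffAt
  have : Fact (Module.finrank ℝ ℂ = 1 + 1) := Complex.finrank_real_complex_fact
  have h2 : ContMDiff (𝓡 1) 𝓘(ℝ, ℂ) ∞ (fun a : Circle => (a : ℂ)) :=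
    contMDiff_coe_sphere (E := ℂ)
  have h3 : ContDiffAt ℝ ∞ (fun z : ℂ => (Complex.log z).im) (((a₀ * a₀⁻¹ : Circle)) : ℂ) := by
    have h4 : ContDiffAt ℂ ∞ Complex.log (((a₀ * a₀⁻¹ : Circle)) : ℂ) :=
      Complex.contDiffAt_log (by rw [mul_inv_cancel]; exact Complex.one_mem_slitPlane)
    exact (Complex.imCLM.contDiff (n := ∞)).contDiffAt.comp _ (h4.restrict_scalars ℝ)
  have h5 : ContMDiffAt (𝓡 1) 𝓘(ℝ, ℝ) ∞
      (fun a : Circle => (Complex.log ((a * a₀⁻¹ : Circle) : ℂ)).im) a₀ :=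
    ContMDiffAt.comp (g := fun z : ℂ => (Complex.log z).im) a₀ h3.contMDiffAt
      (h2.contMDiffAt.comp a₀ h1)
  refine (h5.add (contMDiffAt_const (c := Complex.arg a₀))).congr_of_eventuallyEq
    (Eventually.of_forall fun a => ?_)
  simp [circleLog, Complex.log_im]

end CircleLog

/-! ### Torus coordinates -/

section TorusChart

universe u

variable {M : Type u} [TopologicalSpace M] [ChartedSpace (EuclideanHalfSpace 3) M]
  {B u : VField M} {ν : DForm 1 M} {S : Set M} {p : M}

namespace LeafAction

variable {A : LeafAction B u ν S}

namespace Periods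

open Real in
/-- The parametrization of a neighbourhood of the leaf by `𝕋² × J`. -/
noncomputable def torusParam (P : A.Periods p) (t : Circle × Circle × ℝ) : M :=
  P.F (((2 * π)⁻¹ * Complex.arg t.1, (2 * π)⁻¹ * Complex.arg t.2.1), t.2.2)

-- `torusParam` uses the discontinuous principal argument. Other choices of angle differ by
-- multiples of $2\pi$, that is, by integral periods, and do not affect the point.
open Real in
theorem torusParam_exp (P : A.Periods p) (s t : ℝ) {z : ℝ} (hz : z ∈ transversal P.b.k P.ε) :
    P.torusParam (Circle.exp s, Circle.exp t, z) = P.F (((2 * π)⁻¹ * s, (2 * π)⁻¹ * t), z) := by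
  obtain ⟨m, hm⟩ := Circle.exp_eq_exp.1 (Circle.exp_arg (Circle.exp s))
  obtain ⟨n, hn⟩ := Circle.exp_eq_exp.1 (Circle.exp_arg (Circle.exp t))
  refine (P.F_eq_iff hz hz).2 ⟨rfl, m, n, ?_⟩
  rw [hm, hn]
  ext
  · simp only [Prod.fst_add]; field_simp
  · simp only [Prod.snd_add]; field_simp

-- The argument may be replaced by logarithms smooth near a given point of the torus, whence the
-- smoothness of `torusParam`.
open Real in
theorem torusParam_eq (P : A.Periods p) (a₀ b₀ : Circle) {t : Circle × Circle × ℝ}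
    (hz : t.2.2 ∈ transversal P.b.k P.ε) : P.torusParam t =
      P.F (((2 * π)⁻¹ * circleLog a₀ t.1, (2 * π)⁻¹ * circleLog b₀ t.2.1), t.2.2) := by
  rw [← P.torusParam_exp _ _ hz, exp_circleLog, exp_circleLog]

open Real in
theorem injOn_torusParam (P : A.Periods p) :
    InjOn P.torusParam (univ ×ˢ univ ×ˢ transversal P.b.k P.ε) := by
  rintro ⟨a, b, z⟩ ⟨-, -, hz⟩ ⟨a', b', z'⟩ ⟨-, -, hz'⟩ h
  obtain ⟨h1, m, n, h2⟩ := (P.F_eq_iff hz hz').1 h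
  have key : ∀ (a a' : Circle) (m : ℤ), (2 * π)⁻¹ * Complex.arg a =
      (2 * π)⁻¹ * Complex.arg a' + m → a = a' := by
    intro a a' m h
    rw [← Circle.exp_arg a, ← Circle.exp_arg a', Circle.exp_eq_exp]
    refine ⟨m, ?_⟩
    field_simp at h
    linarith
  rw [key a a' m (congrArg Prod.fst h2), key b b' n (congrArg Prod.snd h2)]
  exact Prod.ext rfl (Prod.ext rfl h1)

open Real in
theorem bijOn_torusParam (P : A.Periods p) :
    BijOn P.torusParam (univ ×ˢ univ ×ˢ transversal P.b.k P.ε) (P.F '' P.dom) := by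
  refine ⟨fun t ht => ⟨_, ⟨mem_univ _, ht.2.2⟩, rfl⟩, P.injOn_torusParam, ?_⟩
  rintro _ ⟨q, hq, rfl⟩
  refine ⟨(Circle.exp (2 * π * q.1.1), Circle.exp (2 * π * q.1.2), q.2),
    ⟨mem_univ _, mem_univ _, hq.2⟩, ?_⟩
  rw [P.torusParam_exp _ _ hq.2]
  congr 1
  ext
  · field_simp
  · field_simp
  · rfl

/-- The coordinates `(θ₁, θ₂, z)`. -/
noncomputable def torusChart (P : A.Periods p) : PartialEquiv M (Circle × Circle × ℝ) :=
  (P.bijOn_torusParam.toPartialEquiv P.torusParam _ _).symm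

theorem torusChart_torusParam (P : A.Periods p) {t : Circle × Circle × ℝ}
    (ht : t.2.2 ∈ transversal P.b.k P.ε) : P.torusChart (P.torusParam t) = t :=
  P.torusChart.right_inv (x := t) ⟨mem_univ _, mem_univ _, ht⟩

theorem torusChart_mem (P : A.Periods p) {y : M} (hy : y ∈ P.F '' P.dom) :
    (P.torusChart y).2.2 ∈ transversal P.b.k P.ε :=
  (P.torusChart.map_source (x := y) hy).2.2

theorem torusParam_torusChart (P : A.Periods p) {y : M} (hy : y ∈ P.F '' P.dom) :
    P.torusParam (P.torusChart y) = y :=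
  P.torusChart.left_inv (x := y) hy

open Real in
theorem isTorusChart (P : A.Periods p) :
    IsTorusChart P.torusChart (P.F '' P.dom) (transversal P.b.k P.ε) where
  interval := ordConnected_transversal _ _
  nondegenerate := transversal_nontrivial _ P.ε_pos
  source_eq := rfl
  target_eq := rfl
  smooth := by
    rintro _ ⟨q, hq, rfl⟩
    obtain ⟨N, G, hN, hqN, hGs, hG, hFG⟩ := P.exists_local_section hq
    have hG' := hGs.contMDiffAt (hN.mem_nhds hqN)
    have e1 : ContMDiffAt (𝓡∂ 3) (𝓡 1) ∞ (fun y => Circle.exp (2 * π * (G y).1.1)) (P.F q) :=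
      contMDiff_circleExp.contMDiffAt.comp _ (((contDiff_const.mul (contDiff_fst.comp
        contDiff_fst)).contDiffAt (x := G (P.F q))).contMDiffAt.comp _ hG')
    have e2 : ContMDiffAt (𝓡∂ 3) (𝓡 1) ∞ (fun y => Circle.exp (2 * π * (G y).1.2)) (P.F q) :=
      contMDiff_circleExp.contMDiffAt.comp _ (((contDiff_const.mul (contDiff_snd.comp
        contDiff_fst)).contDiffAt (x := G (P.F q))).contMDiffAt.comp _ hG')
    have e3 : ContMDiffAt (𝓡∂ 3) 𝓘(ℝ, ℝ) ∞ (fun y => (G y).2) (P.F q) :=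
      (contDiff_snd.contDiffAt (x := G (P.F q))).contMDiffAt.comp _ hG'
    refine ((e1.prodMk (e2.prodMk e3)).congr_of_eventuallyEq ?_).contMDiffWithinAt
    filter_upwards [hN.mem_nhds hqN] with y hy
    conv_lhs => rw [← hFG y hy]
    have h1 : P.torusParam (Circle.exp (2 * π * (G y).1.1), Circle.exp (2 * π * (G y).1.2),
        (G y).2) = P.F (G y) := by
      rw [P.torusParam_exp _ _ (hG hy).2]
      congr 1
      ext
      · field_simp
      · field_simp
      · rfl
    rw [← h1]
    exact P.torusChart_torusParam (hG hy).2
  smooth_symm := by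
    rintro ⟨a, b, z⟩ ⟨-, -, hz⟩
    have e0 : ContMDiffAt ((𝓡 1).prod ((𝓡 1).prod 𝓘(ℝ, ℝ))) (𝓡 1) ∞
        (fun t : Circle × Circle × ℝ => t.2.1) (a, b, z) :=
      contMDiffAt_fst.comp (x := (a, b, z)) (f := Prod.snd) contMDiffAt_snd
    have e3 : ContMDiffAt ((𝓡 1).prod ((𝓡 1).prod 𝓘(ℝ, ℝ))) 𝓘(ℝ, ℝ) ∞
        (fun t : Circle × Circle × ℝ => t.2.2) (a, b, z) :=
      contMDiffAt_snd.comp (x := (a, b, z)) (f := Prod.snd) contMDiffAt_snd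
    have e1 : ContMDiffAt ((𝓡 1).prod ((𝓡 1).prod 𝓘(ℝ, ℝ))) 𝓘(ℝ, ℝ) ∞
        (fun t : Circle × Circle × ℝ => (2 * π)⁻¹ * circleLog a t.1) (a, b, z) :=
      ((contDiff_const.mul contDiff_id).contDiffAt (x := circleLog a a)).contMDiffAt.comp
        (x := (a, b, z)) (f := fun t : Circle × Circle × ℝ => circleLog a t.1)
        ((contMDiffAt_circleLog a).comp (x := (a, b, z)) (f := Prod.fst) contMDiffAt_fst)
    have e2 : ContMDiffAt ((𝓡 1).prod ((𝓡 1).prod 𝓘(ℝ, ℝ))) 𝓘(ℝ, ℝ) ∞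
        (fun t : Circle × Circle × ℝ => (2 * π)⁻¹ * circleLog b t.2.1) (a, b, z) :=
      ((contDiff_const.mul contDiff_id).contDiffAt (x := circleLog b b)).contMDiffAt.comp
        (x := (a, b, z)) (f := fun t : Circle × Circle × ℝ => circleLog b t.2.1)
        ((contMDiffAt_circleLog b).comp (x := (a, b, z)) (f := fun t => t.2.1) e0)
    have e4 := (e1.prodMk_space e2).prodMk_space e3
    have e5 : ContMDiffWithinAt ((𝓡 1).prod ((𝓡 1).prod 𝓘(ℝ, ℝ))) (𝓡∂ 3) ∞
        (fun t : Circle × Circle × ℝ =>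
          P.F (((2 * π)⁻¹ * circleLog a t.1, (2 * π)⁻¹ * circleLog b t.2.1), t.2.2))
        (univ ×ˢ univ ×ˢ transversal P.b.k P.ε) (a, b, z) :=
      (P.contMDiffOn_F _ ⟨mem_univ _, hz⟩).comp (a, b, z) e4.contMDiffWithinAt
        fun t ht => ⟨mem_univ _, ht.2.2⟩
    exact e5.congr (fun t ht => P.torusParam_eq a b ht.2.2) (P.torusParam_eq a b hz)

end Periods

end LeafAction

end TorusChart

/-! ### The fields and the form in torus coordinates -/

section Rectify

universe u

variable {M : Type u} [TopologicalSpace M] [ChartedSpace (EuclideanHalfSpace 3) M]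
  {B u : VField M} {ν : DForm 1 M} {S : Set M} {p : M}

namespace LeafAction.Periods

variable {A : LeafAction B u ν S}

-- A rotation by $s$ in $\theta_1$ is the action of $\frac{s}{2\pi}\,l_1(z)$, and the velocities of
-- the action are combinations of $B$ and $u$.
open Real in
theorem dTheta1_torusChart (P : A.Periods p) {x : M} (hx : x ∈ P.F '' P.dom) :
    dTheta1 P.torusChart x = ((2 * π)⁻¹ • P.l₁ (zCoord P.torusChart x)).1 • B x +
      ((2 * π)⁻¹ • P.l₁ (zCoord P.torusChart x)).2 • u x := by
  have hz := P.torusChart_mem hx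
  have hxV : x ∈ A.V := by
    obtain ⟨q, hq, rfl⟩ := hx
    exact P.F_mem hq
  rw [← A.mfderiv_φ_smul hxV]
  have h1 : (fun s : ℝ => P.torusChart.symm (Circle.exp s * (P.torusChart x).1,
      (P.torusChart x).2.1, (P.torusChart x).2.2)) =
      fun s : ℝ => A.φ (s • (2 * π)⁻¹ • P.l₁ (zCoord P.torusChart x)) x := by
    funext s
    set t := P.torusChart x with ht
    have h2 : P.F (((2 * π)⁻¹ * Complex.arg t.1, (2 * π)⁻¹ * Complex.arg t.2.1), t.2.2) = x :=
      P.torusParam_torusChart hx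
    have h3 := P.torusParam_exp (s + Complex.arg t.1) (Complex.arg t.2.1) hz
    rw [Circle.exp_add, Circle.exp_arg, Circle.exp_arg] at h3
    refine h3.trans ?_
    have h4 := P.F_add ((2 * π)⁻¹ * s, 0)
      ((2 * π)⁻¹ * Complex.arg t.1, (2 * π)⁻¹ * Complex.arg t.2.1) t.2.2
    rw [h2] at h4
    rw [mul_add]
    rw [Prod.mk_add_mk, zero_add] at h4
    rw [h4]
    congr 1
    change ((2 * π)⁻¹ * s) • P.l₁ t.2.2 + (0 : ℝ) • P.l₂ t.2.2 = s • (2 * π)⁻¹ • P.l₁ t.2.2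
    module
  exact congrArg (fun f : ℝ → M => mfderiv 𝓘(ℝ, ℝ) (𝓡∂ 3) f 0 (1 : ℝ)) h1

open Real in
theorem dTheta2_torusChart (P : A.Periods p) {x : M} (hx : x ∈ P.F '' P.dom) :
    dTheta2 P.torusChart x = ((2 * π)⁻¹ • P.l₂ (zCoord P.torusChart x)).1 • B x +
      ((2 * π)⁻¹ • P.l₂ (zCoord P.torusChart x)).2 • u x := by
  have hz := P.torusChart_mem hx
  have hxV : x ∈ A.V := by
    obtain ⟨q, hq, rfl⟩ := hx
    exact P.F_mem hq
  rw [← A.mfderiv_φ_smul hxV]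
  have h1 : (fun s : ℝ => P.torusChart.symm ((P.torusChart x).1,
      Circle.exp s * (P.torusChart x).2.1, (P.torusChart x).2.2)) =
      fun s : ℝ => A.φ (s • (2 * π)⁻¹ • P.l₂ (zCoord P.torusChart x)) x := by
    funext s
    set t := P.torusChart x with ht
    have h2 : P.F (((2 * π)⁻¹ * Complex.arg t.1, (2 * π)⁻¹ * Complex.arg t.2.1), t.2.2) = x :=
      P.torusParam_torusChart hx
    have h3 := P.torusParam_exp (Complex.arg t.1) (s + Complex.arg t.2.1) hz
    rw [Circle.exp_add, Circle.exp_arg, Circle.exp_arg] at h3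
    refine h3.trans ?_
    have h4 := P.F_add (0, (2 * π)⁻¹ * s)
      ((2 * π)⁻¹ * Complex.arg t.1, (2 * π)⁻¹ * Complex.arg t.2.1) t.2.2
    rw [h2] at h4
    rw [mul_add]
    rw [Prod.mk_add_mk, zero_add] at h4
    rw [h4]
    congr 1
    change (0 : ℝ) • P.l₁ t.2.2 + ((2 * π)⁻¹ * s) • P.l₂ t.2.2 = s • (2 * π)⁻¹ • P.l₂ t.2.2
    module
  exact congrArg (fun f : ℝ → M => mfderiv 𝓘(ℝ, ℝ) (𝓡∂ 3) f 0 (1 : ℝ)) h1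

/-- On this neighbourhood $\sigma z$ is the primitive $\psi$ of $\nu$. -/
theorem mfderiv_zCoord (P : A.Periods p) {x : M} (hx : x ∈ P.F '' P.dom)
    (v : TangentSpace (𝓡∂ 3) x) :
    mfderiv (𝓡∂ 3) 𝓘(ℝ, ℝ) (fun y => P.b.σ * zCoord P.torusChart y) x v = ν x ![v] := by
  have hxV : x ∈ A.V := by
    obtain ⟨q, hq, rfl⟩ := hx
    exact P.F_mem hq
  rw [← A.mfderiv_ψ hxV]
  have h1 : (fun y => P.b.σ * zCoord P.torusChart y) =ᶠ[𝓝 x] A.ψ := by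
    filter_upwards [P.isOpen_image.mem_nhds hx] with y hy
    have h2 := P.torusParam_torusChart hy
    conv_rhs => rw [← h2]
    exact (P.ψ_F (q := (_, (P.torusChart y).2.2)) ⟨mem_univ _, P.torusChart_mem hy⟩).symm
  rw [h1.mfderiv_eq]
  rfl

open Real in
/-- The coefficients of `c₁ B + c₂ u` with respect to `∂_{θ₁}` and `∂_{θ₂}`. -/
noncomputable def coeff (P : A.Periods p) (c : V2) (z : ℝ) : V2 :=
  (2 * π) • planeCoord (P.l₁ z) (P.l₂ z) c

theorem contDiffOn_coeff (P : A.Periods p) (c : V2) :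
    ContDiffOn ℝ ∞ (P.coeff c) (transversal P.b.k P.ε) := by
  have h1 := P.smooth₁
  have h2 := P.smooth₂
  have e4 : ContDiffOn ℝ ∞ (fun z => planeDet (P.l₁ z) (P.l₂ z)) (transversal P.b.k P.ε) :=
    (h1.fst.mul h2.snd).sub (h1.snd.mul h2.fst)
  have e5 : ∀ t : ℝ, ContDiffOn ℝ ∞ (fun _ : ℝ => t) (transversal P.b.k P.ε) :=
    fun _ => contDiffOn_const
  exact (e5 (2 * Real.pi)).smul (((((e5 c.1).mul h2.snd).sub ((e5 c.2).mul h2.fst)).div e4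
    P.det_ne).prodMk (((h1.fst.mul (e5 c.2)).sub (h1.snd.mul (e5 c.1))).div e4 P.det_ne))

/-- Inverts the expression of the coordinate fields through $B$ and $u$; the matrix consists of the
periods, so its inverse depends on $z$ only. -/
theorem smul_dTheta (P : A.Periods p) (c : V2) {x : M} (hx : x ∈ P.F '' P.dom) :
    c.1 • B x + c.2 • u x = (P.coeff c (zCoord P.torusChart x)).1 • dTheta1 P.torusChart x +
      (P.coeff c (zCoord P.torusChart x)).2 • dTheta2 P.torusChart x := by
  rw [P.dTheta1_torusChart hx, P.dTheta2_torusChart hx]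
  set z := zCoord P.torusChart x
  have h1 : planeComb (P.l₁ z) (P.l₂ z) (planeCoord (P.l₁ z) (P.l₂ z) c) = c :=
    planeComb_planeCoord (P.det_ne z (P.torusChart_mem hx)) c
  have h2 := congrArg Prod.fst h1
  have h3 := congrArg Prod.snd h1
  have hπ : (2 * Real.pi) * (2 * Real.pi)⁻¹ = 1 := mul_inv_cancel₀ (by positivity)
  simp only [planeComb, Prod.fst_add, Prod.snd_add, Prod.smul_fst, Prod.smul_snd,
    smul_eq_mul] at h2 h3
  simp only [coeff, Prod.smul_fst, Prod.smul_snd, smul_eq_mul]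
  set d := planeCoord (P.l₁ z) (P.l₂ z) c
  have key : ∀ X Y : TangentSpace (𝓡∂ 3) x, c.1 • X + c.2 • Y =
      (2 * Real.pi * d.1) • (((2 * Real.pi)⁻¹ * (P.l₁ z).1) • X +
        ((2 * Real.pi)⁻¹ * (P.l₁ z).2) • Y) +
      (2 * Real.pi * d.2) • (((2 * Real.pi)⁻¹ * (P.l₂ z).1) • X +
        ((2 * Real.pi)⁻¹ * (P.l₂ z).2) • Y) := by
    intro X Y
    rw [← h2, ← h3]
    have e : ∀ s t : ℝ, (2 * Real.pi * s) * ((2 * Real.pi)⁻¹ * t) = s * t := fun s t => by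
      rw [mul_mul_mul_comm, hπ, one_mul]
    simp only [smul_add, smul_smul, e, add_smul]
    module
  exact key _ _

theorem rectifies (P : A.Periods p) :
    Rectifies P.torusChart B ν u (P.F '' P.dom) (transversal P.b.k P.ε) := by
  refine ⟨fun z => P.b.σ * z, fun z => (P.coeff (1, 0) z).1, fun z => (P.coeff (1, 0) z).2,
    fun z => (P.coeff (0, 1) z).1, fun z => (P.coeff (0, 1) z).2,
    (contDiff_const.mul contDiff_id).contDiffOn, (P.contDiffOn_coeff _).fst,
    (P.contDiffOn_coeff _).snd, (P.contDiffOn_coeff _).fst, (P.contDiffOn_coeff _).snd,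
    fun x hx => ?_, fun x hx => ?_, fun x hx => ?_⟩
  · ext v
    have h1 : v = ![v 0] := by
      funext i
      rw [Subsingleton.elim i 0]
      rfl
    rw [h1]
    exact (P.mfderiv_zCoord hx (v 0)).symm
  · have h := P.smul_dTheta (1, 0) hx
    simpa using h
  · have h := P.smul_dTheta (0, 1) hx
    simpa using h

end LeafAction.Periods

end Rectify

/-! ### From commuting fields to torus coordinates -/

theorem exists_torusChart {M : Type*} [TopologicalSpace M] [T2Space M]
    [ChartedSpace (EuclideanHalfSpace 3) M] [IsManifold (𝓡∂ 3) ∞ M]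
    {B u : VField M} {ν : DForm 1 M} {μ : DForm 3 M} (hflux : IsTangentialFluxSystem B ν μ)
    {S U : Set M} (hS : IsRegularClosedLeaf ν S) (hu : IsFluxFieldOn B ν μ S U u)
    (hbr : ∀ x ∈ U, mlieBracket (𝓡∂ 3) u B x = 0) :
    ∃ (U : Set M) (J : Set ℝ) (Φ : PartialEquiv M (Circle × Circle × ℝ)),
      IsFluxFieldOn B ν μ S U u ∧ IsTorusChart Φ U J ∧ Rectifies Φ B ν u U J := by
  have hbox : ∀ x ∈ S, ∃ b : FlowBox B u ν x, b.W ⊆ U ∧ ∀ y ∈ b.W, y ∈ S ↔ (b.χ y).2 = 0 := by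
    intro x hx
    have hν : ν x ≠ 0 := by
      obtain ⟨N, _, _, _, _, _, f, hf, rfl⟩ := hS
      obtain ⟨n, rfl⟩ := hx
      exact hf.nonzero n
    obtain ⟨b, hbU⟩ := exists_flowBox hflux hu hbr (hu.subset hx) hν hu.isOpen (hu.subset hx)
    obtain ⟨O, hO, hOW, hOS⟩ := b.exists_nhds_leaf hS hx
    obtain ⟨r', h0, hr, hs⟩ := b.exists_shrink hO
    exact ⟨b.shrink r' h0 hr, inter_subset_left.trans hbU, fun y hy => hOS y (hs hy)⟩
  obtain ⟨hSc, hSp, p, hp⟩ : IsCompact S ∧ IsPreconnected S ∧ S.Nonempty := by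
    obtain ⟨N, _, _, _, _, _, f, hf, rfl⟩ := hS
    exact ⟨isCompact_range hf.smooth.continuous, isPreconnected_range hf.smooth.continuous,
      range_nonempty f⟩
  obtain ⟨A, hAU⟩ := exists_leafAction hSc hbox
  obtain ⟨P⟩ := A.exists_periods hSp hSc hp
  have hPU : P.F '' P.dom ⊆ U := by
    rintro _ ⟨q, hq, rfl⟩
    exact hAU (P.F_mem hq)
  exact ⟨P.F '' P.dom, transversal P.b.k P.ε, P.torusChart,
    ⟨P.isOpen_image, P.subset_image hSp hp, hu.smooth.mono hPU, fun x hx => hu.flux x (hPU hx)⟩,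
    P.isTorusChart, P.rectifies⟩

/-! ### From torus coordinates to commuting fields -/

section Converse

/-- Two vector fields which are constant in the coordinates of a common immersed surface commute
along this surface. -/
theorem lieBracketWithin_eq_zero_of_param {E F : Type*} [NormedAddCommGroup E] [NormedSpace ℝ E]
    [NormedAddCommGroup F] [NormedSpace ℝ F] {X Y : E → E} {R : Set E} {f : F → E} {θ : F}
    (hf : ContDiffAt ℝ ∞ f θ) (hfR : ∀ᶠ η in 𝓝 θ, f η ∈ R)
    (hXd : DifferentiableWithinAt ℝ X R (f θ)) (hYd : DifferentiableWithinAt ℝ Y R (f θ))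
    {v w : F} (hX : ∀ᶠ η in 𝓝 θ, X (f η) = fderiv ℝ f η v)
    (hY : ∀ᶠ η in 𝓝 θ, Y (f η) = fderiv ℝ f η w) :
    lieBracketWithin ℝ X Y R (f θ) = 0 := by
  have hfd : HasFDerivAt f (fderiv ℝ f θ) θ := (hf.differentiableAt (by simp)).hasFDerivAt
  have hf2 : HasFDerivAt (fderiv ℝ f) (fderiv ℝ (fderiv ℝ f) θ) θ :=
    ((hf.fderiv_right (m := 1) (by exact WithTop.coe_le_coe.2 le_top)).differentiableAt
      (by simp)).hasFDerivAt
  -- Differentiating $Z\circ f=Df\cdot a$ in the direction $b$ gives $DZ(Df\,b)=D^2f(b,a)$. Both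
  -- terms of the bracket thus become values of one symmetric bilinear map.
  have key : ∀ {Z : E → E} {a : F}, DifferentiableWithinAt ℝ Z R (f θ) →
      (∀ᶠ η in 𝓝 θ, Z (f η) = fderiv ℝ f η a) → ∀ b,
      fderivWithin ℝ Z R (f θ) (fderiv ℝ f θ b) = fderiv ℝ (fderiv ℝ f) θ b a := by
    intro Z a hZd hZ b
    have h1 : HasFDerivAt (fun η => Z (f η)) ((fderivWithin ℝ Z R (f θ)).comp (fderiv ℝ f θ)) θ :=
      (hZd.hasFDerivWithinAt.comp θ (hfd.hasFDerivWithinAt (s := f ⁻¹' R))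
        (mapsTo_preimage f R)).hasFDerivAt hfR
    have h2 : HasFDerivAt (fun η => fderiv ℝ f η a)
        ((ContinuousLinearMap.apply ℝ E a).comp (fderiv ℝ (fderiv ℝ f) θ)) θ :=
      (ContinuousLinearMap.apply ℝ E a).hasFDerivAt.comp θ hf2
    have h3 := h1.unique (h2.congr_of_eventuallyEq hZ)
    exact congrArg (fun T => T b) h3
  have hsymm : IsSymmSndFDerivAt ℝ f θ := hf.isSymmSndFDerivAt two_le_infty
  rw [lieBracketWithin, hX.self_of_nhds, hY.self_of_nhds, key hYd hY, key hXd hX,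
    hsymm.eq, sub_self]

universe u

variable {M : Type u} [TopologicalSpace M] [ChartedSpace (EuclideanHalfSpace 3) M]

/-- The torus through the point with coordinates `t`, parametrized by the plane. -/
noncomputable def torusMap (Φ : PartialEquiv M (Circle × Circle × ℝ)) (t : Circle × Circle × ℝ)
    (θ : V2) : M :=
  Φ.symm (Circle.exp θ.1 * t.1, Circle.exp θ.2 * t.2.1, t.2.2)

theorem contMDiff_torusMap {Φ : PartialEquiv M (Circle × Circle × ℝ)} {U : Set M} {J : Set ℝ}
    (hΦ : IsTorusChart Φ U J) {t : Circle × Circle × ℝ} (ht : t.2.2 ∈ J) :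
    ContMDiff 𝓘(ℝ, V2) (𝓡∂ 3) ∞ (torusMap Φ t) := by
  have e1 : ContMDiff 𝓘(ℝ, V2) (𝓡 1) ∞ (fun θ : V2 => Circle.exp θ.1 * t.1) :=
    (contMDiff_circleExp.comp contDiff_fst.contMDiff).mul contMDiff_const
  have e2 : ContMDiff 𝓘(ℝ, V2) (𝓡 1) ∞ (fun θ : V2 => Circle.exp θ.2 * t.2.1) :=
    (contMDiff_circleExp.comp contDiff_snd.contMDiff).mul contMDiff_const
  exact hΦ.smooth_symm.comp_contMDiff (e1.prodMk (e2.prodMk contMDiff_const))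
    fun θ => ⟨mem_univ _, mem_univ _, ht⟩

theorem apply_torusMap {Φ : PartialEquiv M (Circle × Circle × ℝ)} {U : Set M} {J : Set ℝ}
    (hΦ : IsTorusChart Φ U J) {t : Circle × Circle × ℝ} (ht : t.2.2 ∈ J) (θ : V2) :
    Φ (torusMap Φ t θ) = (Circle.exp θ.1 * t.1, Circle.exp θ.2 * t.2.1, t.2.2) :=
  Φ.right_inv (by rw [hΦ.target_eq]; exact ⟨mem_univ _, mem_univ _, ht⟩)

theorem torusMap_mem {Φ : PartialEquiv M (Circle × Circle × ℝ)} {U : Set M} {J : Set ℝ}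
    (hΦ : IsTorusChart Φ U J) {t : Circle × Circle × ℝ} (ht : t.2.2 ∈ J) (θ : V2) :
    torusMap Φ t θ ∈ U := by
  rw [← hΦ.source_eq]
  exact Φ.map_target (by rw [hΦ.target_eq]; exact ⟨mem_univ _, mem_univ _, ht⟩)

theorem mfderiv_torusMap_line {Φ : PartialEquiv M (Circle × Circle × ℝ)} {U : Set M} {J : Set ℝ}
    (hΦ : IsTorusChart Φ U J) {t : Circle × Circle × ℝ} (ht : t.2.2 ∈ J) (θ w : V2) :
    mfderiv 𝓘(ℝ, ℝ) (𝓡∂ 3) (fun s : ℝ => torusMap Φ t (θ + s • w)) 0 (1 : ℝ) =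
      mfderiv 𝓘(ℝ, V2) (𝓡∂ 3) (torusMap Φ t) θ w := by
  have h1 : HasMFDerivAt 𝓘(ℝ, V2) (𝓡∂ 3) (torusMap Φ t) (θ + (0 : ℝ) • w)
      (mfderiv 𝓘(ℝ, V2) (𝓡∂ 3) (torusMap Φ t) (θ + (0 : ℝ) • w)) :=
    ((contMDiff_torusMap hΦ ht).contMDiffAt.mdifferentiableAt (by simp)).hasMFDerivAt
  have h2 : HasDerivAt (fun s : ℝ => θ + s • w) ((1 : ℝ) • w) 0 :=
    ((hasDerivAt_id (0 : ℝ)).smul_const w).const_add θ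
  have h3 := h1.comp (0 : ℝ) h2.hasFDerivAt.hasMFDerivAt
  refine (congrArg (fun T => T (1 : ℝ)) h3.mfderiv).trans ?_
  have h4 : ∀ v : V2, v = w → ∀ η : V2, η = θ →
      (mfderiv 𝓘(ℝ, V2) (𝓡∂ 3) (torusMap Φ t) η v : E3) =
        mfderiv 𝓘(ℝ, V2) (𝓡∂ 3) (torusMap Φ t) θ w := by
    rintro v rfl η rfl
    rfl
  refine h4 _ ?_ _ (by simp)
  change (1 : ℝ) • (1 : ℝ) • w = w
  rw [one_smul, one_smul]

theorem dTheta1_torusMap {Φ : PartialEquiv M (Circle × Circle × ℝ)} {U : Set M} {J : Set ℝ}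
    (hΦ : IsTorusChart Φ U J) {t : Circle × Circle × ℝ} (ht : t.2.2 ∈ J) (θ : V2) :
    dTheta1 Φ (torusMap Φ t θ) =
      mfderiv 𝓘(ℝ, V2) (𝓡∂ 3) (torusMap Φ t) θ ((1, 0) : V2) := by
  refine Eq.trans ?_ (mfderiv_torusMap_line hΦ ht θ (1, 0))
  refine congrArg (fun f : ℝ → M => mfderiv 𝓘(ℝ, ℝ) (𝓡∂ 3) f 0 (1 : ℝ)) ?_
  funext s
  rw [apply_torusMap hΦ ht]
  simp [torusMap, Circle.exp_add, mul_comm, mul_left_comm]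

theorem dTheta2_torusMap {Φ : PartialEquiv M (Circle × Circle × ℝ)} {U : Set M} {J : Set ℝ}
    (hΦ : IsTorusChart Φ U J) {t : Circle × Circle × ℝ} (ht : t.2.2 ∈ J) (θ : V2) :
    dTheta2 Φ (torusMap Φ t θ) =
      mfderiv 𝓘(ℝ, V2) (𝓡∂ 3) (torusMap Φ t) θ ((0, 1) : V2) := by
  refine Eq.trans ?_ (mfderiv_torusMap_line hΦ ht θ (0, 1))
  refine congrArg (fun f : ℝ → M => mfderiv 𝓘(ℝ, ℝ) (𝓡∂ 3) f 0 (1 : ℝ)) ?_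
  funext s
  rw [apply_torusMap hΦ ht]
  simp [torusMap, Circle.exp_add, mul_comm, mul_left_comm]

/-- A field with constant coefficients on the tori is the image of a constant field. -/
theorem field_torusMap {Φ : PartialEquiv M (Circle × Circle × ℝ)} {U : Set M} {J : Set ℝ}
    (hΦ : IsTorusChart Φ U J) {t : Circle × Circle × ℝ} (ht : t.2.2 ∈ J) {X : VField M}
    {a b : ℝ → ℝ} (hX : ∀ x ∈ U,
      X x = a (zCoord Φ x) • dTheta1 Φ x + b (zCoord Φ x) • dTheta2 Φ x) (θ : V2) :
    X (torusMap Φ t θ) =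
      mfderiv 𝓘(ℝ, V2) (𝓡∂ 3) (torusMap Φ t) θ ((a t.2.2, b t.2.2) : V2) := by
  rw [hX _ (torusMap_mem hΦ ht θ), dTheta1_torusMap hΦ ht, dTheta2_torusMap hΦ ht]
  have h1 : zCoord Φ (torusMap Φ t θ) = t.2.2 := by rw [zCoord, apply_torusMap hΦ ht]
  rw [h1]
  have h2 : ((a t.2.2, b t.2.2) : V2) = a t.2.2 • ((1, 0) : V2) + b t.2.2 • ((0, 1) : V2) := by
    ext <;> simp
  refine Eq.symm ((congrArg (mfderiv 𝓘(ℝ, V2) (𝓡∂ 3) (torusMap Φ t) θ) h2).trans ?_)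
  exact (map_add (mfderiv 𝓘(ℝ, V2) (𝓡∂ 3) (torusMap Φ t) θ) _ _).trans
    (congrArg₂ (· + ·) (map_smul _ _ _) (map_smul _ _ _))

variable [IsManifold (𝓡∂ 3) ∞ M]

theorem differentiableWithinAt_fieldInChart {X : VField M} {U : Set M} (hU : IsOpen U)
    (hX : SmoothVFieldOn X U) {x : M} (hx : x ∈ U) :
    DifferentiableWithinAt ℝ (fieldInChart X x) (range (𝓡∂ 3)) (extChartAt (𝓡∂ 3) x x) := by
  have hy : extChartAt (𝓡∂ 3) x x ∈ (extChartAt (𝓡∂ 3) x).target := mem_extChartAt_target x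
  have hxU : (extChartAt (𝓡∂ 3) x).symm (extChartAt (𝓡∂ 3) x x) ∈ U := by
    rwa [extChartAt_to_inv]
  refine ((contDiffOn_fieldInChart hU hX x).differentiableOn (by simp) _
    ⟨hy, hxU⟩).mono_of_mem_nhdsWithin ?_
  exact inter_mem (extChartAt_target_mem_nhdsWithin x)
    ((contMDiffWithinAt_extChartAt_symm_range (n := ∞) (I := 𝓡∂ 3) x
      hy).continuousWithinAt.preimage_mem_nhdsWithin (hU.mem_nhds hxU))

theorem fieldInChart_torusMap {Φ : PartialEquiv M (Circle × Circle × ℝ)} {U : Set M} {J : Set ℝ}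
    (hΦ : IsTorusChart Φ U J) {t : Circle × Circle × ℝ} (ht : t.2.2 ∈ J) {X : VField M}
    {a b : ℝ → ℝ} (hX : ∀ x ∈ U,
      X x = a (zCoord Φ x) • dTheta1 Φ x + b (zCoord Φ x) • dTheta2 Φ x) (x₀ : M) {θ : V2}
    (hθ : torusMap Φ t θ ∈ (extChartAt (𝓡∂ 3) x₀).source) :
    fieldInChart X x₀ (extChartAt (𝓡∂ 3) x₀ (torusMap Φ t θ)) =
      fderiv ℝ (fun η => extChartAt (𝓡∂ 3) x₀ (torusMap Φ t η)) θ (a t.2.2, b t.2.2) := by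
  have h1 : HasMFDerivAt 𝓘(ℝ, V2) (𝓡∂ 3) (torusMap Φ t) θ
      (mfderiv 𝓘(ℝ, V2) (𝓡∂ 3) (torusMap Φ t) θ) :=
    ((contMDiff_torusMap hΦ ht).contMDiffAt.mdifferentiableAt (by simp)).hasMFDerivAt
  have h2 : HasMFDerivAt (𝓡∂ 3) 𝓘(ℝ, E3) (extChartAt (𝓡∂ 3) x₀) (torusMap Φ t θ)
      (mfderiv (𝓡∂ 3) 𝓘(ℝ, E3) (extChartAt (𝓡∂ 3) x₀) (torusMap Φ t θ)) :=
    ((contMDiffAt_extChartAt' (n := ∞) (by rwa [← extChartAt_source (𝓡∂ 3)])).mdifferentiableAt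
      (by simp)).hasMFDerivAt
  have h3 : ∀ T : V2 →L[ℝ] E3,
      HasFDerivAt (fun η => extChartAt (𝓡∂ 3) x₀ (torusMap Φ t η)) T θ →
      fderiv ℝ (fun η => extChartAt (𝓡∂ 3) x₀ (torusMap Φ t η)) θ (a t.2.2, b t.2.2) =
        T (a t.2.2, b t.2.2) := fun T hT => by rw [hT.fderiv]
  refine Eq.symm ((h3 _ (h2.comp θ h1).hasFDerivAt).trans ?_)
  rw [← mfderiv_extChartAt_apply_field X x₀ hθ]
  exact congrArg (mfderiv (𝓡∂ 3) 𝓘(ℝ, E3) (extChartAt (𝓡∂ 3) x₀) (torusMap Φ t θ))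
    (field_torusMap hΦ ht hX θ).symm

/-- Both fields are tangent to the torus through `x`, so the bracket only differentiates along it.
There $z$ is constant and the $z$-derivatives of the coefficients play no role. -/
theorem mlieBracket_eq_zero_of_rectifies {B u : VField M} {ν : DForm 1 M} {U : Set M}
    {J : Set ℝ} {Φ : PartialEquiv M (Circle × Circle × ℝ)} (hU : IsOpen U)
    (hB : SmoothVFieldOn B U) (hu : SmoothVFieldOn u U) (hΦ : IsTorusChart Φ U J)
    (hR : Rectifies Φ B ν u U J) {x : M} (hx : x ∈ U) : mlieBracket (𝓡∂ 3) u B x = 0 := by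
  obtain ⟨ψ, a, b, c, d, -, -, -, -, -, -, hBR, huR⟩ := hR
  have hxs : x ∈ Φ.source := by rwa [hΦ.source_eq]
  have ht : (Φ x).2.2 ∈ J := by
    have := Φ.map_source hxs
    rw [hΦ.target_eq] at this
    exact this.2.2
  have hx0 : torusMap Φ (Φ x) 0 = x := by
    simp only [torusMap, Prod.fst_zero, Prod.snd_zero, Circle.exp_zero, one_mul]
    exact Φ.left_inv hxs
  have hQ := contMDiff_torusMap hΦ ht
  have hsrc : ∀ᶠ θ in 𝓝 (0 : V2), torusMap Φ (Φ x) θ ∈ (extChartAt (𝓡∂ 3) x).source :=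
    hQ.continuous.continuousAt.eventually (by
      rw [hx0]
      exact extChartAt_source_mem_nhds x)
  have hP : ContDiffAt ℝ ∞ (fun θ => extChartAt (𝓡∂ 3) x (torusMap Φ (Φ x) θ)) 0 := by
    refine ContMDiffAt.contDiffAt ?_
    exact ContMDiffAt.comp (0 : V2) (contMDiffAt_extChartAt' (by
      rw [hx0]; exact mem_chart_source _ x)) hQ.contMDiffAt
  have key := lieBracketWithin_eq_zero_of_param (X := fieldInChart u x) (Y := fieldInChart B x)
    (R := range (𝓡∂ 3)) hP
    (hsrc.mono fun θ hθ => extChartAt_target_subset_range x ((extChartAt _ x).map_source hθ))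
    (by rw [hx0]; exact differentiableWithinAt_fieldInChart hU hu hx)
    (by rw [hx0]; exact differentiableWithinAt_fieldInChart hU hB hx)
    (hsrc.mono fun θ hθ => fieldInChart_torusMap hΦ ht huR x hθ)
    (hsrc.mono fun θ hθ => fieldInChart_torusMap hΦ ht hBR x hθ)
  rw [hx0] at key
  rw [← mlieBracketWithin_univ, mlieBracketWithin_apply, preimage_univ, univ_inter]
  refine (congrArg _ key).trans ?_
  exact map_zero _

end Converse

end FluxSystem

/-! ### The equivalence -/

theorem mainTheorem7 {M : Type*} [TopologicalSpace M] [T2Space M] [SecondCountableTopology M]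
    [ChartedSpace (EuclideanHalfSpace 3) M] [IsManifold (𝓡∂ 3) ∞ M]
    (B : FluxSystem.VField M) (ν : FluxSystem.DForm 1 M) (μ : FluxSystem.DForm 3 M)
    (hflux : FluxSystem.IsTangentialFluxSystem B ν μ)
    (S : Set M) (hS : FluxSystem.IsRegularTorus B ν S) :
    (∃ (U : Set M) (u : FluxSystem.VField M),
        FluxSystem.IsFluxFieldOn B ν μ S U u ∧
        ∀ x ∈ U, VectorField.mlieBracket (𝓡∂ 3) u B x = 0) ↔
      ∃ (U : Set M) (u : FluxSystem.VField M) (J : Set ℝ)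
        (Φ : PartialEquiv M (Circle × Circle × ℝ)),
        FluxSystem.IsFluxFieldOn B ν μ S U u ∧
        FluxSystem.IsTorusChart Φ U J ∧
        FluxSystem.Rectifies Φ B ν u U J := by
  constructor
  · rintro ⟨U, u, hu, hbr⟩
    obtain ⟨U', J, Φ, h⟩ := FluxSystem.exists_torusChart hflux hS.1 hu hbr
    exact ⟨U', u, J, Φ, h⟩
  · rintro ⟨U, u, J, Φ, hu, hΦ, hR⟩
    exact ⟨U, u, hu, fun x hx => FluxSystem.mlieBracket_eq_zero_of_rectifies hu.isOpen
      (hflux.smooth_B.mono (Set.subset_univ _)) hu.smooth hΦ hR hx⟩
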